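/- **Setting.** Let $G$ be a connected complex Lie group with Lie algebra $\mathfrak g=T_eG$ (bracket of left invariant vector fields). Let $(\Sigma,V)$ be a marked surface: a compact Riemann surface $\Sigma$ with boundary, not necessarily connected, with a non-empty finite set $V\subset\partial\Sigma$. Let $\Gamma$ be an oriented skeleton of $(\Sigma,V)$: a finite graph embedded in $\Sigma$ with vertex set $V$ (loops and multiple edges allowed) onto which $\Sigma$ deformation retracts, with an orientation of each edge. Write $\Gamma_1$ for its set of edges, $\Gamma_{1/2}$ for its set of half edges, $\alpha_\gamma,\check\alpha_\gamma$ for the source and end half edges of $\gamma\in\Gamma_1$, and $\Gamma_v$ for the set of half edges at $v\in V$, linearly ordered counterclockwise with respect to the orientation of $\Sigma$. Let $\Pi_1(\Sigma,V)$ be the fundamental groupoid of $\Sigma$ over $V$ and $\mathcal A(\Sigma,V)=\mathrm{Hom}(\Pi_1(\Sigma,V),G)$. Evaluation on the edges of $\Gamma$ is a bijection $\mathcal A(\Sigma,V)\to G^{\Gamma_1}$. Denote its inverse by $I_\Gamma$, and give $\mathcal A(\Sigma,V)$ the complex structure for which $I_\Gamma$ is biholomorphic. The group $G^V$ acts on $\mathcal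 A(\Sigma,V)$ from the right by $$(y\cdot g)(p)=g_{\theta(p)}^{-1}\,y(p)\,g_{\tau(p)},$$ where $\theta(p),\tau(p)$ are the source and target of $p$. Let $\rho_V\colon\mathfrak g^V\to\mathfrak X^1(\mathcal A(\Sigma,V))$ be its derivative. **$r$-matrices.** Put $a\wedge b=a\otimes b-b\otimes a$. An element $r=\sum_i x_i\otimes y_i=s+\Lambda$ of $\mathfrak h\otimes\mathfrak h$, for a finite dimensional Lie algebra $\mathfrak h$, with $s$ symmetric and $\Lambda$ antisymmetric, is a quasitriangular $r$-matrix if $s$ is $\mathfrak h$-invariant and $[\Lambda,\Lambda]+\phi_s=0$. Here $[\,,]$ is the Schouten bracket, $\phi_s(\xi,\eta,\zeta)=2\langle\xi,[s^\sharp\eta,s^\sharp\zeta]\rangle$, and $\langle s^\sharp\xi,\eta\rangle=s(\xi,\eta)$. Set $\delta_r(x)=\sum_i[x,x_i]\otimes y_i+x_i\otimes[x,y_i]$. A right $(\mathfrak h,r)$-Poisson space is a triple $(Y,\pi,\rho)$, where $r$ is a quasitriangular $r$-matrix on $\mathfrak h$, $\pi$ is a holomorphic Poisson bivector field on the complex manifold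 $Y$, and $\rho\colon\mathfrak h\to\mathfrak X^1(Y)$ is a Lie algebra morphism into the holomorphic vector fields such that $[\rho(x),\pi]=\rho(\delta_r(x))$ for all $x\in\mathfrak h$. For $v\in V$ let $r_v=s+\Lambda_v\in\mathfrak g\otimes\mathfrak g$ be a quasitriangular $r$-matrix, all with the same symmetric part $s$. For $x$ in $\mathfrak g$ or $\mathfrak g\otimes\mathfrak g$, let $(x)_j$ be its image in the $j$-th component. Let $\varepsilon_v(\alpha)=1$ if $\alpha\in\Gamma_v$ is a source half edge and $\varepsilon_v(\alpha)=-1$ if it is an end half edge. With $r_v=\sum_i x_i\otimes y_i$ set $$r_v^{(\varepsilon_v,\Gamma_v)}=\sum_{\alpha\in\Gamma_v}(\varepsilon_v(\alpha)s+\Lambda_v)_\alpha-\sum_{\alpha<\beta\in\Gamma_v}\sum_i (y_i)_\alpha\wedge(x_i)_\beta\ \in\ \mathfrak g^{\Gamma_v}\otimes\mathfrak g^{\Gamma_v},$$ and $r_\Gamma=\sum_{v\in V}\big(r_v^{(\varepsilon_v,\Gamma_v)}\big)_v\in\mathfrak g^{\Gamma_{1/2}}\otimes\mathfrak g^{\Gamma_{1/2}}$.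 Let $\sigma_\Gamma\colon\mathfrak g^{\Gamma_{1/2}}\to\mathfrak X^1(G^{\Gamma_1})$ be the derivative of the right action $\sigma_\Gamma(g,h)_\gamma=h_{\alpha_\gamma}^{-1}g_\gamma h_{\check\alpha_\gamma}$ of $G^{\Gamma_{1/2}}$ on $G^{\Gamma_1}$, and put $\pi_\Gamma=\sigma_\Gamma(r_\Gamma)$. **Statement.** With $r=\sum_{v\in V}(r_v)_v\in\mathfrak g^V\otimes\mathfrak g^V$, the triple $(\mathcal A(\Sigma,V),\,I_\Gamma(\pi_\Gamma),\,\rho_V)$ is a right $(\mathfrak g^V,r)$-Poisson space. -/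

import Mathlib

open scoped Manifold ContDiff TensorProduct Topology

noncomputable section

namespace FockRosly

/-! ## Lie algebras, `r`-matrices -/

/-- The Lie ring structure on the power `L ^ ι`, with componentwise bracket. -/
instance piLieRing {ι L : Type*} [LieRing L] : LieRing (ι → L) where
  bracket x y := fun i => ⁅x i, y i⁆
  add_lie x y z := funext fun i => add_lie (x i) (y i) (z i)
  lie_add x y z := funext fun i => lie_add (x i) (y i) (z i)
  lie_self x := funext fun i => lie_self (x i)
  leibniz_lie x y z := funext fun i => leibniz_lie (x i) (y i) (z i)

/-- The Lie algebra `L ^ ι`, with componentwise bracket. -/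
instance piLieAlgebra {ι L : Type*} [LieRing L] [LieAlgebra ℂ L] : LieAlgebra ℂ (ι → L) where
  lie_smul t x y := funext fun i => lie_smul t (x i) (y i)

section RMatrix

variable {L : Type*} [LieRing L] [LieAlgebra ℂ L]

/-- The exchange of factors `x ⊗ y ↦ y ⊗ x`. -/
def swap : L ⊗[ℂ] L →ₗ[ℂ] L ⊗[ℂ] L := (TensorProduct.comm ℂ L L).toLinearMap

/-- The symmetric part `s` of `r = s + Λ`. -/
def symPart (r : L ⊗[ℂ] L) : L ⊗[ℂ] L := (1 / 2 : ℂ) • (r + swap r)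

/-- The antisymmetric part `Λ` of `r = s + Λ`. -/
def skewPart (r : L ⊗[ℂ] L) : L ⊗[ℂ] L := (1 / 2 : ℂ) • (r - swap r)

/-- The adjoint action of `x` on tensors, `[x, a ⊗ b] = [x, a] ⊗ b + a ⊗ [x, b]`. -/
def adTensor (x : L) : L ⊗[ℂ] L →ₗ[ℂ] L ⊗[ℂ] L :=
  TensorProduct.map (LieAlgebra.ad ℂ L x) LinearMap.id +
    TensorProduct.map LinearMap.id (LieAlgebra.ad ℂ L x)

/-- The map `s♯` from the dual of `L` to `L`, with `⟨s♯ ξ, η⟩ = s (ξ, η)`. -/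
def sharp (s : L ⊗[ℂ] L) (ξ : Module.Dual ℂ L) : L :=
  TensorProduct.lid ℂ L (TensorProduct.map ξ LinearMap.id s)

/-- Evaluation of a tensor of degree three on three covectors. -/
def eval₃ (ξ η ζ : Module.Dual ℂ L) : L ⊗[ℂ] (L ⊗[ℂ] L) →ₗ[ℂ] ℂ :=
  LinearMap.mul' ℂ ℂ ∘ₗ TensorProduct.map ξ (LinearMap.mul' ℂ ℂ ∘ₗ TensorProduct.map η ζ)

/-- Exchange of the first two factors. -/
def swap₁₂ : L ⊗[ℂ] (L ⊗[ℂ] L) →ₗ[ℂ] L ⊗[ℂ] (L ⊗[ℂ] L) :=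
  (TensorProduct.leftComm ℂ L L L).toLinearMap

/-- Exchange of the last two factors. -/
def swap₂₃ : L ⊗[ℂ] (L ⊗[ℂ] L) →ₗ[ℂ] L ⊗[ℂ] (L ⊗[ℂ] L) :=
  TensorProduct.map LinearMap.id swap

/-- The map `a ⊗ b ⊗ c ↦ a ∧ b ∧ c`, where `a ∧ b ∧ c` is the alternating sum (without
normalization) over the six permutations of the factors. -/
def wedge₃ : L ⊗[ℂ] (L ⊗[ℂ] L) →ₗ[ℂ] L ⊗[ℂ] (L ⊗[ℂ] L) :=
  LinearMap.id - swap₁₂ - swap₂₃ + swap₁₂ ∘ₗ swap₂₃ + swap₂₃ ∘ₗ swap₁₂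
    - swap₁₂ ∘ₗ swap₂₃ ∘ₗ swap₁₂

/-- The map `(a ⊗ b) ⊗ (c ⊗ d) ↦ [a, c] ⊗ b ⊗ d`. -/
def bracketFirst : (L ⊗[ℂ] L) ⊗[ℂ] (L ⊗[ℂ] L) →ₗ[ℂ] L ⊗[ℂ] (L ⊗[ℂ] L) :=
  TensorProduct.map (LieModule.toModuleHom ℂ L L).toLinearMap LinearMap.id ∘ₗ
    (TensorProduct.tensorTensorTensorComm ℂ L L L L).toLinearMap

/-- The Schouten bracket of two antisymmetric tensors `P, Q` of degree two. With
`a ∧ b = a ⊗ b - b ⊗ a`, this formula gives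
`[a ∧ b, c ∧ d] = [a, c] ∧ b ∧ d - [a, d] ∧ b ∧ c - [b, c] ∧ a ∧ d + [b, d] ∧ a ∧ c`. -/
def schouten (P Q : L ⊗[ℂ] L) : L ⊗[ℂ] (L ⊗[ℂ] L) := wedge₃ (bracketFirst (P ⊗ₜ[ℂ] Q))

/-- `r = s + Λ` is a quasitriangular `r`-matrix: `s` is invariant, and the classical
Yang--Baxter equation `[Λ, Λ] + φ_s = 0` holds, where
`φ_s (ξ, η, ζ) = 2 ⟨ξ, [s♯ η, s♯ ζ]⟩`. -/
structure IsQuasitriangular (r : L ⊗[ℂ] L) : Prop where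
  invariant : ∀ x : L, adTensor x (symPart r) = 0
  yangBaxter : ∀ ξ η ζ : Module.Dual ℂ L,
    eval₃ ξ η ζ (schouten (skewPart r) (skewPart r)) +
      2 * ξ ⁅sharp (symPart r) η, sharp (symPart r) ζ⁆ = 0

/-- The cobracket `δ_r x = ∑ᵢ [x, xᵢ] ⊗ yᵢ + xᵢ ⊗ [x, yᵢ]` of `r = ∑ᵢ xᵢ ⊗ yᵢ`. -/
def cobracket (r : L ⊗[ℂ] L) (x : L) : L ⊗[ℂ] L := adTensor x r

open Classical in
/-- The map `x ⊗ y ↦ (x)_j ⊗ (y)_k` from `L ⊗ L` to `L ^ ι ⊗ L ^ ι`. -/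
def place {ι : Type*} (j k : ι) : L ⊗[ℂ] L →ₗ[ℂ] (ι → L) ⊗[ℂ] (ι → L) :=
  TensorProduct.map (LinearMap.single ℂ (fun _ : ι => L) j)
    (LinearMap.single ℂ (fun _ : ι => L) k)

/-- `Mix r = ∑_{j < k} ∑ᵢ (yᵢ)_j ∧ (xᵢ)_k` for `r = ∑ᵢ xᵢ ⊗ yᵢ`. -/
def mix (ι : Type*) [Fintype ι] [LinearOrder ι] (r : L ⊗[ℂ] L) : (ι → L) ⊗[ℂ] (ι → L) :=
  ∑ j : ι, ∑ k : ι, if j < k then place j k (swap r) - place k j r else 0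

/-- The element `r^(ε, ι) = ∑_j (ε(j) s + Λ)_j - Mix r` of `L ^ ι ⊗ L ^ ι`. -/
def twist (ι : Type*) [Fintype ι] [LinearOrder ι] (ε : ι → ℤ) (r : L ⊗[ℂ] L) :
    (ι → L) ⊗[ℂ] (ι → L) :=
  ∑ j : ι, place j j (ε j • symPart r + skewPart r) - mix ι r

/-- The element `∑_v (r_v)_v` of `L ^ V ⊗ L ^ V`. -/
def directSum {V : Type*} [Fintype V] (r : V → L ⊗[ℂ] L) : (V → L) ⊗[ℂ] (V → L) :=
  ∑ v : V, place v v (r v)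

end RMatrix

/-! ## Complex manifolds: powers and transport of structure -/

section Manifolds

variable {E : Type*} [NormedAddCommGroup E] [NormedSpace ℂ E]

/-- The model with corners of a power `M ^ ι` of a complex manifold `M` modelled on `E`. -/
abbrev powModel (E : Type*) [NormedAddCommGroup E] [NormedSpace ℂ E] (ι : Type*) [Fintype ι] :
    ModelWithCorners ℂ (ι → E) (ModelPi fun _ : ι => E) :=
  ModelWithCorners.pi fun _ : ι => 𝓘(ℂ, E)

theorem contDiffGroupoid_mem {F H : Type*} [NormedAddCommGroup F] [NormedSpace ℂ F]
    [TopologicalSpace H] {I : ModelWithCorners ℂ F H} {e : OpenPartialHomeomorph H H}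
    (h : e ∈ contDiffGroupoid ω I) :
    ContDiffOn ℂ ω (I ∘ e ∘ I.symm) (I.symm ⁻¹' e.source ∩ Set.range I) := by
  rw [contDiffGroupoid, mem_groupoid_of_pregroupoid, contDiffPregroupoid] at h
  exact h.1

/-- A finite power of a complex manifold is a complex manifold. -/
instance isManifold_pow {ι : Type*} [Fintype ι] {M : Type*} [TopologicalSpace M]
    [ChartedSpace E M] [IsManifold 𝓘(ℂ, E) ω M] : IsManifold (powModel E ι) ω (ι → M) := by
  apply isManifold_of_contDiffOn
  rintro _ _ ⟨f, hf, rfl⟩ ⟨g, hg, rfl⟩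
  rw [contDiffOn_pi]
  intro i
  have h := (contDiffGroupoid ω 𝓘(ℂ, E)).compatible (hf i trivial) (hg i trivial)
  have h' := (contDiffGroupoid_mem h)
  refine h'.comp ((contDiff_apply (𝕜 := ℂ) (n := ω) E i).contDiffOn) ?_
  rintro x ⟨hx, -⟩
  exact ⟨⟨hx.1 i trivial, hx.2 i trivial⟩, ⟨x i, rfl⟩⟩

/-- The set `Y`, seen as a space with the structure transported from `M` by the bijection `e`. -/
@[nolint unusedArguments]
def Transport {M Y : Type*} (_e : M ≃ Y) : Type _ := Y

section

variable {M Y : Type*} [TopologicalSpace M] (e : M ≃ Y)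

instance : TopologicalSpace (Transport e) := TopologicalSpace.induced (Y := M) e.symm inferInstance

/-- The bijection `e` as a homeomorphism onto the space with transported structure. -/
def toTransport : M ≃ₜ Transport e :=
  (Equiv.toHomeomorphOfIsInducing (Y := M) (X := Transport e) (show Transport e ≃ M from e.symm)
    ⟨rfl⟩).symm

variable {H : Type*} [TopologicalSpace H] [ChartedSpace H M]

instance : ChartedSpace H (Transport e) where
  atlas := (fun c => (toTransport e).symm.toOpenPartialHomeomorph.trans c) '' atlas H M
  chartAt y := (toTransport e).symm.toOpenPartialHomeomorph.trans
    (chartAt H ((toTransport e).symm y))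
  mem_chart_source y := by simp
  chart_mem_atlas y := ⟨_, chart_mem_atlas H _, rfl⟩

instance {F : Type*} [NormedAddCommGroup F] [NormedSpace ℂ F] (I : ModelWithCorners ℂ F H)
    [IsManifold I ω M] : IsManifold I ω (Transport e) := by
  apply isManifold_of_contDiffOn
  rintro _ _ ⟨f, hf, rfl⟩ ⟨g, hg, rfl⟩
  have h := contDiffGroupoid_mem ((contDiffGroupoid ω I).compatible hf hg)
  have hs : (((toTransport e).symm.toOpenPartialHomeomorph.trans f).symm.trans
      ((toTransport e).symm.toOpenPartialHomeomorph.trans g)).source = (f.symm.trans g).source := by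
    ext x
    simp
  rw [hs]
  refine h.congr fun x _ => ?_
  simp

end

end Manifolds

/-! ## Poisson spaces -/

section Poisson

variable {F : Type*} [NormedAddCommGroup F] [NormedSpace ℂ F] {H : Type*} [TopologicalSpace H]
  (I : ModelWithCorners ℂ F H) {Y : Type*} [TopologicalSpace Y] [ChartedSpace H Y]

/-- The differential at `y` of a complex valued function. -/
def diffAt (f : Y → ℂ) (y : Y) : TangentSpace I y →ₗ[ℂ] ℂ :=
  (mfderiv I 𝓘(ℂ, ℂ) f y).toLinearMap

/-- The value of a tensor `t ∈ T_y Y ⊗ T_y Y` on the differentials of `f` and `g`. -/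
def tensorEval {y : Y} (t : TangentSpace I y ⊗[ℂ] TangentSpace I y) (f g : Y → ℂ) : ℂ :=
  LinearMap.mul' ℂ ℂ (TensorProduct.map (diffAt I f y) (diffAt I g y) t)

/-- The bracket `{f, g} = π (df, dg)` defined by a field of tensors of degree two. -/
def poissonBracket (π : ∀ y : Y, TangentSpace I y ⊗[ℂ] TangentSpace I y) (f g : Y → ℂ) (y : Y) :
    ℂ := tensorEval I (π y) f g

/-- The derivative `X f` of a function `f` along a vector field `X`. -/
def derivAlong (X : ∀ y : Y, TangentSpace I y) (f : Y → ℂ) (y : Y) : ℂ := diffAt I f y (X y)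

/-- The function `f` is holomorphic on the set `U`. -/
abbrev HolomorphicOn (f : Y → ℂ) (U : Set Y) : Prop := ContMDiffOn I 𝓘(ℂ, ℂ) ω f U

/-- `π` is a Poisson bivector field on the complex manifold `Y`: it is antisymmetric, holomorphic
(that is, `π (df, dg)` is holomorphic for all locally defined holomorphic functions `f, g`), and
the bracket of locally defined holomorphic functions satisfies the Jacobi identity. -/
structure IsPoisson (π : ∀ y : Y, TangentSpace I y ⊗[ℂ] TangentSpace I y) : Prop where
  antisymm : ∀ y, TensorProduct.comm ℂ (TangentSpace I y) (TangentSpace I y) (π y) = -π y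
  holomorphic : ∀ (U : Set Y) (f g : Y → ℂ), IsOpen U → HolomorphicOn I f U →
    HolomorphicOn I g U → HolomorphicOn I (poissonBracket I π f g) U
  jacobi : ∀ (U : Set Y) (f g h : Y → ℂ), IsOpen U → HolomorphicOn I f U →
    HolomorphicOn I g U → HolomorphicOn I h U → ∀ y ∈ U,
      poissonBracket I π f (poissonBracket I π g h) y +
        poissonBracket I π g (poissonBracket I π h f) y +
        poissonBracket I π h (poissonBracket I π f g) y = 0

/-- `ρ : L → 𝔛¹(Y)`, given as a family of linear maps `ρ y : L → T_y Y`, is a morphism of Lie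
algebras into the holomorphic vector fields on `Y`. -/
structure IsLieAction {L : Type*} [LieRing L] [LieAlgebra ℂ L] [IsManifold I ω Y]
    (ρ : ∀ y : Y, L →ₗ[ℂ] TangentSpace I y) : Prop where
  holomorphic : ∀ x : L,
    ContMDiff I I.tangent ω (fun y => (⟨y, ρ y x⟩ : TangentBundle I Y))
  map_lie : ∀ (x x' : L) (y : Y),
    ρ y ⁅x, x'⁆ = VectorField.mlieBracket I (fun z => ρ z x) (fun z => ρ z x') y

/-- The field of tensors `ρ(t) = ∑ᵢ ρ(xᵢ) ⊗ ρ(yᵢ)` for `t = ∑ᵢ xᵢ ⊗ yᵢ`. -/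
def pushTensor {L : Type*} [LieRing L] [LieAlgebra ℂ L] (ρ : ∀ y : Y, L →ₗ[ℂ] TangentSpace I y)
    (t : L ⊗[ℂ] L) (y : Y) : TangentSpace I y ⊗[ℂ] TangentSpace I y :=
  TensorProduct.map (ρ y) (ρ y) t

/-- `(Y, π, ρ)` is a right `(L, r)`-Poisson space: `(L, r)` is a quasitriangular Lie bialgebra,
`π` is a Poisson structure on `Y`, `ρ` is a morphism of Lie algebras `L → 𝔛¹(Y)`, and
`[ρ(x), π] = ρ(δ_r(x))` for all `x ∈ L`. The left-hand side is the Lie derivative of `π` along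
`ρ(x)`, whose value on `(df, dg)` is `X{f, g} - {X f, g} - {f, X g}` with `X = ρ(x)`. -/
structure IsRightPoissonSpace {L : Type*} [LieRing L] [LieAlgebra ℂ L] [IsManifold I ω Y]
    (r : L ⊗[ℂ] L) (π : ∀ y : Y, TangentSpace I y ⊗[ℂ] TangentSpace I y)
    (ρ : ∀ y : Y, L →ₗ[ℂ] TangentSpace I y) : Prop where
  quasitriangular : IsQuasitriangular r
  poisson : IsPoisson I π
  action : IsLieAction I ρ
  compatible : ∀ (x : L) (U : Set Y) (f g : Y → ℂ), IsOpen U → HolomorphicOn I f U →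
    HolomorphicOn I g U → ∀ y ∈ U,
      derivAlong I (fun z => ρ z x) (poissonBracket I π f g) y
          - poissonBracket I π (derivAlong I (fun z => ρ z x) f) g y
          - poissonBracket I π f (derivAlong I (fun z => ρ z x) g) y
        = tensorEval I (pushTensor I ρ (cobracket r x) y) f g

/-- The image under the biholomorphic map `e : M → Transport e` of a field of tensors on `M`. -/
def transportTensor {M Y : Type*} [TopologicalSpace M] [ChartedSpace H M] (e : M ≃ Y)
    (π : ∀ m : M, TangentSpace I m ⊗[ℂ] TangentSpace I m) (y : Transport e) :
    TangentSpace I y ⊗[ℂ] TangentSpace I y :=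
  TensorProduct.map (mfderiv I I (toTransport e).symm y).inverse.toLinearMap
    (mfderiv I I (toTransport e).symm y).inverse.toLinearMap (π ((toTransport e).symm y))

variable {E : Type*} [NormedAddCommGroup E] [NormedSpace ℂ E]
  {G : Type*} [TopologicalSpace G] [ChartedSpace E G] [Group G]

/-- The Lie algebra `𝔤` of the complex Lie group `G`: the tangent space at the identity, with the
bracket of left invariant vector fields. -/
def LieAlg (E : Type*) [NormedAddCommGroup E] [NormedSpace ℂ E] (G : Type*) [TopologicalSpace G]
    [ChartedSpace E G] [Group G] : Type _ :=
  GroupLieAlgebra 𝓘(ℂ, E) G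

instance [LieGroup 𝓘(ℂ, E) ω G] [CompleteSpace E] : LieRing (LieAlg E G) :=
  inferInstanceAs (LieRing (GroupLieAlgebra 𝓘(ℂ, E) G))

instance [LieGroup 𝓘(ℂ, E) ω G] [CompleteSpace E] : LieAlgebra ℂ (LieAlg E G) :=
  inferInstanceAs (LieAlgebra ℂ (GroupLieAlgebra 𝓘(ℂ, E) G))

variable [LieGroup 𝓘(ℂ, E) ω G] [CompleteSpace E]

/-- The infinitesimal action of `𝔤 ^ ι` defined by a right action `a : Y × G ^ ι → Y`. Its value
at `y` is the derivative at the identity of `g ↦ a(y, g)`, where the tangent space of `G ^ ι` at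
the identity is `𝔤 ^ ι`, and `a(y, 1) = y`. -/
def infinitesimal {ι : Type*} [Fintype ι] (a : Y → (ι → G) → Y) (y : Y) :
    (ι → LieAlg E G) →ₗ[ℂ] TangentSpace I y where
  toFun x := mfderiv (powModel E ι) I (a y) (1 : ι → G) x
  map_add' x x' := map_add (mfderiv (powModel E ι) I (a y) (1 : ι → G)) x x'
  map_smul' c x := map_smul (mfderiv (powModel E ι) I (a y) (1 : ι → G)) c x

end Poisson

/-! ## Marked surfaces, skeletons -/

section Surfaces

/-- The closed upper half plane. -/
abbrev HalfPlane : Type := {z : ℂ // 0 ≤ z.im}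

/-- The closed upper half plane as a complex model with boundary. A Riemann surface with boundary
is a complex manifold over this model. -/
def halfPlaneModel : ModelWithCorners ℂ ℂ HalfPlane where
  toFun := Subtype.val
  invFun z := ⟨⟨z.re, max z.im 0⟩, le_max_right _ _⟩
  source := Set.univ
  target := {z | 0 ≤ z.im}
  map_source' z _ := z.2
  map_target' _ _ := trivial
  left_inv' z _ := Subtype.ext (Complex.ext rfl (max_eq_left z.2))
  right_inv' z hz := Complex.ext rfl (max_eq_left hz)
  source_eq := rfl
  convex_range' := by
    simp only [instIsRCLikeNormedField, ↓reduceDIte]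
    apply Convex.convex_isRCLikeNormedField
    have : Set.range (Subtype.val : HalfPlane → ℂ) = {z | 0 ≤ z.im} := Subtype.range_val
    exact this ▸ convex_halfSpace_im_ge 0
  nonempty_interior' := by
    have : Set.range (Subtype.val : HalfPlane → ℂ) = {z | 0 ≤ z.im} := Subtype.range_val
    refine ⟨Complex.I, mem_interior.2 ⟨{z | 0 < z.im}, ?_, ?_, by simp⟩⟩
    · exact fun z (hz : 0 < z.im) => this ▸ hz.le
    · exact isOpen_lt continuous_const Complex.continuous_im
  continuous_toFun := continuous_subtype_val
  continuous_invFun := by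
    refine Continuous.subtype_mk ?_ _
    have : (fun z : ℂ => (⟨z.re, max z.im 0⟩ : ℂ)) =
        fun z => (z.re : ℂ) + (max z.im 0 : ℝ) * Complex.I := by
      ext z
      exact (Complex.mk_eq_add_mul_I _ _)
    rw [this]
    fun_prop

variable {S : Type*} [TopologicalSpace S]

/-- A finite oriented graph embedded in the space `S`, with set of vertices `V` and set of edges
`Edge`. Loops and multiple edges are allowed. -/
structure EmbeddedGraph (V : Finset S) (Edge : Type*) where
  /-- the source vertex of an edge -/
  src : Edge → V
  /-- the end vertex of an edge -/
  tgt : Edge → V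
  /-- the edge, as a path in `S` -/
  arc : ∀ e, Path (src e : S) (tgt e : S)
  /-- an edge has no self-intersection in its interior, and does not meet other edges there -/
  arc_injective : ∀ (e e' : Edge) (t t' : unitInterval), t ∈ Set.Ioo 0 1 →
    arc e t = arc e' t' → e = e' ∧ t = t'
  /-- the interior of an edge contains no vertex -/
  arc_not_mem : ∀ (e : Edge) (t : unitInterval), t ∈ Set.Ioo 0 1 → arc e t ∉ V

namespace EmbeddedGraph

variable {V : Finset S} {Edge : Type*} (Γ : EmbeddedGraph V Edge)

/-- The graph as a subset of `S`. -/
def carrier : Set S := (V : Set S) ∪ ⋃ e, Set.range (Γ.arc e)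

/-- The vertex of a half edge. The half edges of `e` are its source half edge `(e, false)` and its
end half edge `(e, true)`. -/
def base (α : Edge × Bool) : V := if α.2 then Γ.tgt α.1 else Γ.src α.1

/-- The half edges which are incident to `v`. -/
abbrev HalfEdgesAt (v : V) : Type _ := {α : Edge × Bool // Γ.base α = v}

/-- The parametrization of the edge of `α` which starts with the half edge `α`. -/
def ray (α : Edge × Bool) : unitInterval → S :=
  if α.2 then (Γ.arc α.1).symm else Γ.arc α.1

/-- The sign of a half edge: `1` for a source half edge, `-1` for an end half edge. -/
def sign (_Γ : EmbeddedGraph V Edge) (α : Edge × Bool) : ℤ := if α.2 then -1 else 1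

/-- The class of an edge in the fundamental groupoid. -/
def edgeClass (e : Edge) : Path.Homotopic.Quotient (Γ.src e : S) (Γ.tgt e : S) :=
  Path.Homotopic.Quotient.mk (Γ.arc e)

end EmbeddedGraph

/-- `S` deformation retracts onto the subset `A`. -/
def DeformationRetractsOnto (A : Set S) : Prop :=
  ∃ f : C(S, S), (∀ x, f x ∈ A) ∧ Nonempty ((ContinuousMap.id S).HomotopyRel f A)

variable [ChartedSpace HalfPlane S]

/-- `t` is the first time at which the curve `c` leaves the half disk of radius `R` around `v` in
the preferred holomorphic chart at `v`. -/
def ExitsAt (v : S) (c : unitInterval → S) (R : ℝ) (t : unitInterval) : Prop :=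
  IsLeast {t | ¬ (c t ∈ (extChartAt halfPlaneModel v).source ∧
    ‖extChartAt halfPlaneModel v (c t) - extChartAt halfPlaneModel v v‖ < R)} t

/-- The angle, in `[0, π]`, under which `y` is seen from the boundary point `v` in the preferred
holomorphic chart at `v` with values in the upper half plane. -/
def angle (v y : S) : ℝ :=
  Complex.arg (extChartAt halfPlaneModel v y - extChartAt halfPlaneModel v v)

/-- The curve `c` precedes the curve `d` in the counterclockwise order, with respect to the
orientation of the Riemann surface, of curves which start at the boundary point `v`: for all small
half disks around `v`, the point at which `c` first leaves the half disk has a smaller angle than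
the point at which `d` does. -/
def Precedes (v : S) (c d : unitInterval → S) : Prop :=
  ∀ᶠ R in 𝓝[>] (0 : ℝ), ∀ t u : unitInterval, ExitsAt v c R t → ExitsAt v d R u →
    angle v (c t) < angle v (d u)

/-- An oriented skeleton of the marked surface `(S, V)`: an embedded graph onto which `S`
deformation retracts, each edge being oriented, with the linear order of the half edges incident
to a vertex which is induced by the orientation of `S`. -/
structure OrientedSkeleton (V : Finset S) (Edge : Type*) extends EmbeddedGraph V Edge where
  retract : DeformationRetractsOnto toEmbeddedGraph.carrier
  order : ∀ v : V, LinearOrder (toEmbeddedGraph.HalfEdgesAt v)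
  order_iff : ∀ (v : V) (α β : toEmbeddedGraph.HalfEdgesAt v),
    (order v).lt α β ↔ Precedes (v : S) (toEmbeddedGraph.ray α) (toEmbeddedGraph.ray β)

end Surfaces

/-! ## The moduli space and the Fock--Rosly bivector field -/

section Moduli

variable {S : Type*} [TopologicalSpace S]

/-- The moduli space of flat `G`-connections trivialized over `V`: morphisms from the fundamental
groupoid of `S` with set of base points `V` to the group `G`. Here `p.trans q` is the path `p`
followed by the path `q`. -/
@[ext]
structure Moduli (V : Finset S) (G : Type*) [Group G] where
  /-- evaluation at (the homotopy class of) a path -/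
  ev : ∀ ⦃v w : V⦄, Path.Homotopic.Quotient (v : S) (w : S) → G
  ev_refl : ∀ v : V, ev (Path.Homotopic.Quotient.refl (v : S) : Path.Homotopic.Quotient _ _) = 1
  ev_trans : ∀ {u v w : V} (p : Path.Homotopic.Quotient (u : S) (v : S))
    (q : Path.Homotopic.Quotient (v : S) (w : S)), ev (p.trans q) = ev p * ev q

variable {V : Finset S} {G : Type*} [Group G]

/-- The right action of `G ^ V` by gauge transformations. -/
def Moduli.gauge (y : Moduli V G) (g : V → G) : Moduli V G where
  ev v w p := (g v)⁻¹ * y.ev p * g w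
  ev_refl v := by simp [y.ev_refl]
  ev_trans p q := by simp [y.ev_trans, mul_assoc]

/-- The right action `σ` of `G ^ (half edges)` on `G ^ (edges)`. -/
def halfEdgeAction {Edge : Type*} (g : Edge → G) (h : Edge × Bool → G) : Edge → G :=
  fun e => (h (e, false))⁻¹ * g e * h (e, true)

variable {L : Type*} [LieRing L] [LieAlgebra ℂ L] [ChartedSpace HalfPlane S]
  {Edge : Type*} [Fintype Edge]

open Classical in
/-- The inclusion of `L ^ Γ_v` into `L ^ Γ_{1/2} = ⨁ v, L ^ Γ_v`. -/
def inclAt (Γ : OrientedSkeleton V Edge) (v : V) :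
    (Γ.HalfEdgesAt v → L) →ₗ[ℂ] (Edge × Bool → L) :=
  ∑ α : Γ.HalfEdgesAt v, LinearMap.single ℂ (fun _ : Edge × Bool => L) α.1 ∘ₗ LinearMap.proj α

open Classical in
/-- The `r`-matrix `r_Γ = ∑_v (r_v^(ε_v, Γ_v))_v`. -/
def skeletonRMatrix (Γ : OrientedSkeleton V Edge) (r : V → L ⊗[ℂ] L) :
    (Edge × Bool → L) ⊗[ℂ] (Edge × Bool → L) :=
  ∑ v : V, TensorProduct.map (inclAt Γ v) (inclAt Γ v)
    (letI := Γ.order v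
     twist (Γ.HalfEdgesAt v) (fun α => Γ.sign α.1) (r v))

variable {E : Type*} [NormedAddCommGroup E] [NormedSpace ℂ E] [CompleteSpace E]
  [TopologicalSpace G] [ChartedSpace E G] [LieGroup 𝓘(ℂ, E) ω G]

/-- The bivector field `π_Γ = σ_Γ(r_Γ)` on `G ^ Γ₁`. -/
def skeletonBivector (Γ : OrientedSkeleton V Edge)
    (r : V → LieAlg E G ⊗[ℂ] LieAlg E G) (g : Edge → G) :
    TangentSpace (powModel E Edge) g ⊗[ℂ] TangentSpace (powModel E Edge) g :=
  pushTensor (powModel E Edge) (infinitesimal (powModel E Edge) halfEdgeAction)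
    (skeletonRMatrix Γ r) g

/-- The infinitesimal gauge action `ρ_V` of `𝔤 ^ V` on the moduli space, the latter with the complex
structure transported by a bijection `e` from `G ^ Γ₁`. -/
def gaugeAction (e : (Edge → G) ≃ Moduli V G) (y : Transport e) :
    (V → LieAlg E G) →ₗ[ℂ] TangentSpace (powModel E Edge) y :=
  infinitesimal (powModel E Edge) (Y := Transport e) (Moduli.gauge (V := V) (G := G)) y

end Moduli

end FockRosly

end

/-! The proof combines three independent ingredients.

Algebra. The tensor `skeletonRMatrix Γ r` is itself a quasitriangular r-matrix on 𝔤 ^ Γ_{1/2}. At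
one vertex this is `isQuasitriangular_twist`: the skew part of a twist has (j, k) component Λ + c s,
where c = -1, 0 or 1 according to the order of j and k. In the Yang--Baxter equation the terms
linear in s cancel because s is invariant, and the quadratic ones add up to φ_s by a sign identity
(`orderSign_identity`). Different vertices contribute commuting summands.

Geometry. Let σ be an infinitesimal action of a Lie algebra with a quasitriangular r = s + Λ such
that σ(s) = 0. Then σ(r) = σ(Λ) is Poisson (`IsDerivationAction.isPoisson`): in the Jacobi identity
the second derivatives combine into brackets, what remains is [Λ, Λ] = -φ_s evaluated on
differentials, and this vanishes since s♯ of a differential at y generates a field vanishing at y.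
For the half edge action the hypothesis holds because the symmetric part of r_Γ is the sum over
edges of s at the source half edge minus s at the end half edge. At g in G the source field of x is
the end field of -Ad(g⁻¹) x, and an invariant s is fixed by Ad ⊗ Ad since G is connected
(`map_conjInv_of_invariant`), so the two terms cancel. As for compatibility, the Lie derivative of
σ(t) along σ(x) is σ(ad_x t), the gauge action is σ composed with the pullback 𝔤 ^ V → 𝔤 ^ Γ_{1/2},
and ad of a pulled back x maps r_Γ to the image of δ_r(x) (`adTensor_skeletonRMatrix`).

Topology. Evaluation on edges is bijective (`EmbeddedGraph.bijective_evalEdges`). Surjectivity: glue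
a principal covering with discrete group G from two charts and take its monodromy. Injectivity:
deform a path into the graph so that it is constant near the times at which it meets a vertex; then
it is locally either constant at a vertex or contained in one edge, and two representations which
agree on edges agree along it. -/

noncomputable section

namespace FockRosly

/-! ### Tensors of degree two as maps from the dual, and the Yang--Baxter equation. -/

section Tensors

variable {L : Type*} [LieRing L] [LieAlgebra ℂ L]

@[simp] theorem swap_tmul (a b : L) : swap (a ⊗ₜ[ℂ] b) = b ⊗ₜ[ℂ] a := rfl

@[simp] theorem swap_swap (t : L ⊗[ℂ] L) : swap (swap t) = t := by
  induction t with
  | zero => simp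
  | tmul a b => simp
  | add x y hx hy => simp [hx, hy]

theorem symPart_add_skewPart (r : L ⊗[ℂ] L) : symPart r + skewPart r = r := by
  rw [symPart, skewPart, ← smul_add]
  module

theorem swap_symPart (r : L ⊗[ℂ] L) : swap (symPart r) = symPart r := by
  simp only [symPart, map_smul, map_add, swap_swap]
  module

theorem swap_skewPart (r : L ⊗[ℂ] L) : swap (skewPart r) = -skewPart r := by
  simp only [skewPart, map_smul, map_sub, swap_swap]
  module

theorem symPart_eq_of_add {r s p : L ⊗[ℂ] L} (h : r = s + p) (hs : swap s = s)
    (hp : swap p = -p) : symPart r = s := by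
  rw [symPart, h, map_add, hs, hp]
  module

theorem skewPart_eq_of_add {r s p : L ⊗[ℂ] L} (h : r = s + p) (hs : swap s = s)
    (hp : swap p = -p) : skewPart r = p := by
  rw [skewPart, h, map_add, hs, hp]
  module

theorem sharp_tmul (a b : L) (ξ : Module.Dual ℂ L) : sharp (a ⊗ₜ[ℂ] b) ξ = ξ a • b := by
  simp [sharp]

@[simp] theorem sharp_add (s t : L ⊗[ℂ] L) (ξ : Module.Dual ℂ L) :
    sharp (s + t) ξ = sharp s ξ + sharp t ξ := by
  simp [sharp]

@[simp] theorem sharp_zero (ξ : Module.Dual ℂ L) : sharp (0 : L ⊗[ℂ] L) ξ = 0 := by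
  simp [sharp]

@[simp] theorem sharp_neg (t : L ⊗[ℂ] L) (ξ : Module.Dual ℂ L) : sharp (-t) ξ = -sharp t ξ := by
  simp [sharp]

@[simp] theorem sharp_smul (c : ℂ) (t : L ⊗[ℂ] L) (ξ : Module.Dual ℂ L) :
    sharp (c • t) ξ = c • sharp t ξ := by
  simp [sharp]

theorem sharp_sum {κ : Type*} (A : Finset κ) (t : κ → L ⊗[ℂ] L) (ξ : Module.Dual ℂ L) :
    sharp (∑ i ∈ A, t i) ξ = ∑ i ∈ A, sharp (t i) ξ := by
  simp [sharp]

theorem sharp_map {L' : Type*} [LieRing L'] [LieAlgebra ℂ L'] (f g : L →ₗ[ℂ] L')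
    (t : L ⊗[ℂ] L) (ξ : Module.Dual ℂ L') :
    sharp (TensorProduct.map f g t) ξ = g (sharp t (ξ ∘ₗ f)) := by
  induction t with
  | zero => simp
  | tmul a b => simp [sharp_tmul]
  | add x y hx hy => simp [hx, hy]

theorem swap_map {L' : Type*} [LieRing L'] [LieAlgebra ℂ L'] (f g : L →ₗ[ℂ] L')
    (t : L ⊗[ℂ] L) : swap (TensorProduct.map f g t) = TensorProduct.map g f (swap t) := by
  induction t with
  | zero => simp
  | tmul a b => simp
  | add x y hx hy => simp [hx, hy]

theorem symPart_map {L' : Type*} [LieRing L'] [LieAlgebra ℂ L'] (f : L →ₗ[ℂ] L')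
    (t : L ⊗[ℂ] L) : symPart (TensorProduct.map f f t) = TensorProduct.map f f (symPart t) := by
  simp [symPart, swap_map]

theorem skewPart_map {L' : Type*} [LieRing L'] [LieAlgebra ℂ L'] (f : L →ₗ[ℂ] L')
    (t : L ⊗[ℂ] L) : skewPart (TensorProduct.map f f t) = TensorProduct.map f f (skewPart t) := by
  simp [skewPart, swap_map]

theorem symPart_sum {κ : Type*} (A : Finset κ) (t : κ → L ⊗[ℂ] L) :
    symPart (∑ i ∈ A, t i) = ∑ i ∈ A, symPart (t i) := by
  simp [symPart, Finset.smul_sum, Finset.sum_add_distrib]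

theorem skewPart_sum {κ : Type*} (A : Finset κ) (t : κ → L ⊗[ℂ] L) :
    skewPart (∑ i ∈ A, t i) = ∑ i ∈ A, skewPart (t i) := by
  simp only [skewPart, map_sum, ← Finset.sum_sub_distrib, Finset.smul_sum]

/-- The value of an adjoint-transformed tensor on two covectors, in terms of `sharp`. -/
theorem apply_sharp_adTensor (x : L) {s : L ⊗[ℂ] L} (hs : swap s = s) (ξ η : Module.Dual ℂ L) :
    η (sharp (adTensor x s) ξ) = ξ ⁅x, sharp s η⁆ + η ⁅x, sharp s ξ⁆ := by
  have key : ∀ t : L ⊗[ℂ] L,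
      η (sharp (adTensor x t) ξ) = ξ ⁅x, sharp (swap t) η⁆ + η ⁅x, sharp t ξ⁆ := by
    intro t
    induction t with
    | zero => simp
    | tmul a b =>
      simp [adTensor, sharp_tmul]
      ring
    | add x y hx hy =>
      simp only [map_add, sharp_add, lie_add, hx, hy]
      ring
  rw [key, hs]

/-- The swaps appear because `sharp` contracts the first factor, while here η and ζ are paired with
the second factors of P and Q. -/
theorem eval₃_bracketFirst (P Q : L ⊗[ℂ] L) (ξ η ζ : Module.Dual ℂ L) :
    eval₃ ξ η ζ (bracketFirst (P ⊗ₜ[ℂ] Q)) = ξ ⁅sharp (swap P) η, sharp (swap Q) ζ⁆ := by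
  induction P with
  | zero => simp
  | add x y hx hy => simp [TensorProduct.add_tmul, hx, hy]
  | tmul a b =>
    induction Q with
    | zero => simp
    | add x y hx hy => simp [TensorProduct.tmul_add, hx, hy]
    | tmul c d =>
      simp [eval₃, bracketFirst, sharp_tmul]
      ring

theorem eval₃_swap₁₂ (ξ η ζ : Module.Dual ℂ L) (t : L ⊗[ℂ] (L ⊗[ℂ] L)) :
    eval₃ ξ η ζ (swap₁₂ t) = eval₃ η ξ ζ t := by
  suffices h : eval₃ ξ η ζ ∘ₗ swap₁₂ = eval₃ η ξ ζ from LinearMap.congr_fun h t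
  ext a b c
  simp [eval₃, swap₁₂]
  ring

theorem eval₃_swap₂₃ (ξ η ζ : Module.Dual ℂ L) (t : L ⊗[ℂ] (L ⊗[ℂ] L)) :
    eval₃ ξ η ζ (swap₂₃ t) = eval₃ ξ ζ η t := by
  suffices h : eval₃ ξ η ζ ∘ₗ swap₂₃ = eval₃ ξ ζ η from LinearMap.congr_fun h t
  ext a b c
  simp [eval₃, swap₂₃, mul_comm]

/-- The six permutations fall into three pairs which agree by antisymmetry of the bracket. The signs
from `swap P = -P` cancel because P occurs twice. -/
theorem eval₃_schouten_self {P : L ⊗[ℂ] L} (hP : swap P = -P) (ξ η ζ : Module.Dual ℂ L) :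
    eval₃ ξ η ζ (schouten P P) = 2 * (ξ ⁅sharp P η, sharp P ζ⁆ + η ⁅sharp P ζ, sharp P ξ⁆ +
      ζ ⁅sharp P ξ, sharp P η⁆) := by
  have e₁ : ξ ⁅sharp P ζ, sharp P η⁆ = -ξ ⁅sharp P η, sharp P ζ⁆ := by
    rw [← lie_skew, map_neg]
  have e₂ : η ⁅sharp P ξ, sharp P ζ⁆ = -η ⁅sharp P ζ, sharp P ξ⁆ := by
    rw [← lie_skew, map_neg]
  have e₃ : ζ ⁅sharp P η, sharp P ξ⁆ = -ζ ⁅sharp P ξ, sharp P η⁆ := by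
    rw [← lie_skew, map_neg]
  simp only [schouten, wedge₃, LinearMap.add_apply, LinearMap.sub_apply, LinearMap.comp_apply,
    LinearMap.id_apply, map_add, map_sub, eval₃_swap₁₂, eval₃_swap₂₃, eval₃_bracketFirst, hP,
    sharp_neg, neg_lie, lie_neg, neg_neg, e₁, e₂, e₃]
  ring

/-- The classical Yang--Baxter equation in terms of the maps `P = Λ♯` and `S = s♯`. -/
def YangBaxter (P S : Module.Dual ℂ L → L) : Prop :=
  ∀ ξ η ζ : Module.Dual ℂ L,
    ξ ⁅P η, P ζ⁆ + η ⁅P ζ, P ξ⁆ + ζ ⁅P ξ, P η⁆ + ξ ⁅S η, S ζ⁆ = 0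

/-- The factor 2 produced by the Schouten bracket is the factor 2 in φ_s, so it can be divided out.
-/
theorem isQuasitriangular_iff (r : L ⊗[ℂ] L) :
    IsQuasitriangular r ↔ (∀ x : L, adTensor x (symPart r) = 0) ∧
      YangBaxter (sharp (skewPart r)) (sharp (symPart r)) := by
  have key : ∀ ξ η ζ : Module.Dual ℂ L, eval₃ ξ η ζ (schouten (skewPart r) (skewPart r)) +
      2 * ξ ⁅sharp (symPart r) η, sharp (symPart r) ζ⁆ =
      2 * (ξ ⁅sharp (skewPart r) η, sharp (skewPart r) ζ⁆ +
        η ⁅sharp (skewPart r) ζ, sharp (skewPart r) ξ⁆ +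
        ζ ⁅sharp (skewPart r) ξ, sharp (skewPart r) η⁆ +
        ξ ⁅sharp (symPart r) η, sharp (symPart r) ζ⁆) := fun ξ η ζ => by
    rw [eval₃_schouten_self (swap_skewPart r)]
    ring
  constructor
  · rintro ⟨h₁, h₂⟩
    refine ⟨h₁, fun ξ η ζ => ?_⟩
    have := h₂ ξ η ζ
    rw [key] at this
    simpa using this
  · rintro ⟨h₁, h₂⟩
    refine ⟨h₁, fun ξ η ζ => ?_⟩
    rw [key, h₂ ξ η ζ, mul_zero]

/-- This is the form in which invariance is used: the bilinear form (ξ, η) ↦ ξ [x, s♯ η] is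
antisymmetric. -/
theorem lie_sharp_symm {s : L ⊗[ℂ] L} (hs : swap s = s) (hinv : ∀ x : L, adTensor x s = 0)
    (x : L) (ξ η : Module.Dual ℂ L) : ξ ⁅x, sharp s η⁆ = -η ⁅x, sharp s ξ⁆ := by
  have := apply_sharp_adTensor x hs ξ η
  rw [hinv, sharp_zero, map_zero] at this
  linear_combination -this

end Tensors

/-! ### Sums of r-matrices with commuting images. -/

section Images

variable {V : Type*} [Fintype V] {L : V → Type*} [∀ v, LieRing (L v)] [∀ v, LieAlgebra ℂ (L v)]
  {H : Type*} [LieRing H] [LieAlgebra ℂ H]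

theorem adTensor_map {L : Type*} [LieRing L] [LieAlgebra ℂ L] {f g : L →ₗ[ℂ] H} {x : H}
    {x' : L} (hf : ∀ y, ⁅x, f y⁆ = f ⁅x', y⁆) (hg : ∀ y, ⁅x, g y⁆ = g ⁅x', y⁆) (t : L ⊗[ℂ] L) :
    adTensor x (TensorProduct.map f g t) = TensorProduct.map f g (adTensor x' t) := by
  induction t with
  | zero => simp
  | tmul a b => simp [adTensor, hf, hg]
  | add a b ha hb => simp [ha, hb]

/-- The images commute with each other, so the Yang--Baxter equation splits into one equation per
summand. The hypothesis `hH` makes each image stable under ad, which gives invariance in all of H.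
It serves both for the sum over V and for the sum defining r_Γ. -/
theorem isQuasitriangular_sum_map (f : ∀ v, L v →ₗ[ℂ] H)
    (hf : ∀ v x y, ⁅f v x, f v y⁆ = f v ⁅x, y⁆)
    (hf' : ∀ v w, v ≠ w → ∀ x y, ⁅f v x, f w y⁆ = 0)
    (hH : ∀ v (x : H), ∃ x' : L v, ∀ y, ⁅x, f v y⁆ = f v ⁅x', y⁆)
    {r : ∀ v, L v ⊗[ℂ] L v} (hr : ∀ v, IsQuasitriangular (r v)) :
    IsQuasitriangular (∑ v, TensorProduct.map (f v) (f v) (r v)) := by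
  rw [isQuasitriangular_iff, symPart_sum, skewPart_sum]
  simp only [symPart_map, skewPart_map]
  constructor
  · intro x
    rw [map_sum]
    refine Finset.sum_eq_zero fun v _ => ?_
    obtain ⟨x', hx'⟩ := hH v x
    rw [adTensor_map hx' hx', (hr v).invariant, map_zero]
  · have key : ∀ (a b : ∀ v, L v),
        ⁅∑ v, f v (a v), ∑ v, f v (b v)⁆ = ∑ v, f v ⁅a v, b v⁆ := by
      intro a b
      rw [lie_sum]
      refine Finset.sum_congr rfl fun v _ => ?_
      rw [sum_lie, Finset.sum_eq_single v (fun w _ hw => hf' w v hw _ _) (by simp), hf]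
    intro ξ η ζ
    simp only [sharp_sum, sharp_map, key, map_sum, ← Finset.sum_add_distrib]
    exact Finset.sum_eq_zero fun v _ =>
      ((isQuasitriangular_iff (r v)).1 (hr v)).2 (ξ ∘ₗ f v) (η ∘ₗ f v) (ζ ∘ₗ f v)

end Images

/-! ### Twists of an r-matrix over a linearly ordered set. -/

section Twist

variable {L : Type*} [LieRing L] [LieAlgebra ℂ L] {ι : Type*}

open Classical in
/-- The inclusion of `L` as the `j`-th component of `L ^ ι`. -/
def leg (j : ι) : L →ₗ[ℂ] (ι → L) := LinearMap.single ℂ (fun _ : ι => L) j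

theorem leg_apply_same (j : ι) (x : L) : (leg j x : ι → L) j = x := by
  simp [leg]

theorem leg_apply_ne {j k : ι} (h : k ≠ j) (x : L) : (leg j x : ι → L) k = 0 := by
  simp [leg, h]

theorem place_eq_map (j k : ι) (t : L ⊗[ℂ] L) :
    place j k t = TensorProduct.map (leg j) (leg k) t := rfl

theorem swap_place (j k : ι) (t : L ⊗[ℂ] L) : swap (place j k t) = place k j (swap t) :=
  swap_map _ _ _

theorem lie_leg (x : ι → L) (k : ι) (y : L) : ⁅x, (leg k y : ι → L)⁆ = leg k ⁅x k, y⁆ := by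
  funext i
  change ⁅x i, (leg k y : ι → L) i⁆ = _
  by_cases h : i = k
  · subst h
    rw [leg_apply_same, leg_apply_same]
  · rw [leg_apply_ne h, leg_apply_ne h, lie_zero]

theorem lie_leg_leg (k : ι) (x y : L) : ⁅(leg k x : ι → L), (leg k y : ι → L)⁆ = leg k ⁅x, y⁆ := by
  rw [lie_leg, leg_apply_same]

theorem lie_leg_leg_ne {j k : ι} (h : j ≠ k) (x y : L) :
    ⁅(leg j x : ι → L), (leg k y : ι → L)⁆ = 0 := by
  rw [lie_leg, leg_apply_ne h.symm, zero_lie, map_zero]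

theorem sum_leg [Fintype ι] (x : ι → L) : ∑ k, leg k (x k) = x := by
  funext i
  rw [Finset.sum_apply, Finset.sum_eq_single i (fun k _ hk => leg_apply_ne hk.symm _) (by simp),
    leg_apply_same]

theorem lie_sum_leg [Fintype ι] (a b : ι → L) :
    ⁅∑ k, leg k (a k), ∑ k, leg k (b k)⁆ = ∑ k, leg k ⁅a k, b k⁆ := by
  rw [sum_leg, sum_leg, sum_leg (fun k => ⁅a k, b k⁆)]
  rfl

theorem apply_lie_sum_leg [Fintype ι] (ξ : Module.Dual ℂ (ι → L)) (a b : ι → L) :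
    ξ ⁅∑ k, leg k (a k), ∑ k, leg k (b k)⁆ = ∑ k, (ξ ∘ₗ leg k) ⁅a k, b k⁆ := by
  rw [lie_sum_leg, map_sum]
  rfl

/-- The coefficient of the symmetric part in the off-diagonal components of a twist. -/
def orderSign [LinearOrder ι] (j k : ι) : ℂ := if j < k then -1 else if k < j then 1 else 0

theorem orderSign_swap [LinearOrder ι] (j k : ι) : orderSign k j = -orderSign j k := by
  rcases lt_trichotomy j k with h | h | h
  · simp [orderSign, h, h.not_gt]
  · simp [orderSign, h]
  · simp [orderSign, h, h.not_gt]

/-- The left-hand side is the coefficient of ξ [s♯ η, s♯ ζ] in the (i, j, k) component of the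
Yang--Baxter equation of a twist. The indicator is the contribution of the diagonal symmetric part.
-/
theorem orderSign_identity [LinearOrder ι] (i j k : ι) :
    orderSign j i * orderSign k i - orderSign j i * orderSign k j + orderSign k i * orderSign k j +
      (if i = j ∧ j = k then 1 else 0) = 1 := by
  unfold orderSign
  rcases lt_trichotomy i j with h | h | h <;> rcases lt_trichotomy j k with h' | h' | h' <;>
    rcases lt_trichotomy i k with h'' | h'' | h'' <;>
    first
    | (exfalso; order)
    | (subst_vars; simp [*, not_lt_of_gt, ne_of_lt, ne_of_gt])

/-- The antisymmetric part of a twist. -/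
def twistSkew (ι : Type*) [Fintype ι] [LinearOrder ι] (r : L ⊗[ℂ] L) : (ι → L) ⊗[ℂ] (ι → L) :=
  ∑ j : ι, ∑ k : ι, place j k (skewPart r + orderSign j k • symPart r)

theorem swap_twistSkew [Fintype ι] [LinearOrder ι] (r : L ⊗[ℂ] L) :
    swap (twistSkew ι r) = -twistSkew ι r := by
  simp only [twistSkew, map_sum, swap_place, map_add, map_smul, swap_skewPart, swap_symPart]
  rw [Finset.sum_comm, ← Finset.sum_neg_distrib]
  refine Finset.sum_congr rfl fun j _ => ?_
  rw [← Finset.sum_neg_distrib]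
  refine Finset.sum_congr rfl fun k _ => ?_
  rw [orderSign_swap j k, map_neg, neg_smul]
  abel

/-- Substituting r = s + Λ and swap r = s - Λ in `mix`, the entry of -mix at (j, k) is Λ - s if j <
k and Λ + s if k < j. -/
theorem twist_eq [Fintype ι] [LinearOrder ι] (ε : ι → ℤ) (r : L ⊗[ℂ] L) :
    twist ι ε r = ∑ j : ι, place j j (ε j • symPart r) + twistSkew ι r := by
  have hmix : mix ι r = ∑ j : ι, ∑ k : ι,
      ((if j < k then place j k (swap r) else 0) - (if k < j then place j k r else 0)) := by
    rw [mix]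
    simp only [Finset.sum_sub_distrib]
    rw [Finset.sum_comm (f := fun j k : ι => if k < j then place j k r else 0)]
    simp only [← Finset.sum_sub_distrib]
    refine Finset.sum_congr rfl fun j _ => Finset.sum_congr rfl fun k _ => ?_
    split_ifs <;> simp
  have hdiag : ∀ j : ι, place j j (ε j • symPart r + skewPart r) =
      place j j (ε j • symPart r) + ∑ k : ι, if j = k then place j k (skewPart r) else 0 := by
    intro j
    simp
  rw [twist, hmix, twistSkew, Finset.sum_congr rfl fun j _ => hdiag j, Finset.sum_add_distrib,
    add_sub_assoc]
  congr 1
  simp only [← Finset.sum_sub_distrib]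
  refine Finset.sum_congr rfl fun j _ => Finset.sum_congr rfl fun k _ => ?_
  have hs : swap r = symPart r - skewPart r := by
    conv_lhs => rw [← symPart_add_skewPart r]
    rw [map_add, swap_symPart, swap_skewPart, sub_eq_add_neg]
  rcases lt_trichotomy j k with h | rfl | h
  · simp only [h, h.ne, h.not_gt, if_true, if_false, orderSign, hs]
    simp only [map_sub, map_add, map_smul]
    module
  · simp [orderSign]
  · simp only [h, h.ne', h.not_gt, if_true, if_false, orderSign]
    conv_lhs => rw [← symPart_add_skewPart r]
    simp [add_comm]

theorem swap_twistSym [Fintype ι] (ε : ι → ℤ) (r : L ⊗[ℂ] L) :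
    swap (∑ j : ι, place j j (ε j • symPart r)) = ∑ j : ι, place j j (ε j • symPart r) := by
  simp only [map_sum, swap_place, map_zsmul, swap_symPart]

theorem symPart_twist [Fintype ι] [LinearOrder ι] (ε : ι → ℤ) (r : L ⊗[ℂ] L) :
    symPart (twist ι ε r) = ∑ j : ι, place j j (ε j • symPart r) :=
  symPart_eq_of_add (twist_eq ε r) (swap_twistSym ε r) (swap_twistSkew r)

theorem skewPart_twist [Fintype ι] [LinearOrder ι] (ε : ι → ℤ) (r : L ⊗[ℂ] L) :
    skewPart (twist ι ε r) = twistSkew ι r :=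
  skewPart_eq_of_add (twist_eq ε r) (swap_twistSym ε r) (swap_twistSkew r)

/-- The terms with one P and one S cancel in pairs by the antisymmetry `hS`. The terms with two S
are all multiples of ξ [S η, S ζ], with total coefficient 1 by `h`, and what is left is the equation
for P and S. -/
theorem yangBaxter_component {P S : Module.Dual ℂ L → L} (hP : YangBaxter P S)
    (hS : ∀ (x : L) (ξ η : Module.Dual ℂ L), ξ ⁅x, S η⁆ = -η ⁅x, S ξ⁆) {u v w δ : ℂ}
    (h : u * v - u * w + v * w + δ = 1) (ξ η ζ : Module.Dual ℂ L) :
    ξ ⁅P η + u • S η, P ζ + v • S ζ⁆ + η ⁅P ζ + w • S ζ, P ξ + (-u) • S ξ⁆ +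
      ζ ⁅P ξ + (-v) • S ξ, P η + (-w) • S η⁆ + δ * ξ ⁅S η, S ζ⁆ = 0 := by
  have hskew : ∀ (ξ : Module.Dual ℂ L) (x y : L), ξ ⁅x, y⁆ = -ξ ⁅y, x⁆ := fun ξ x y => by
    rw [← lie_skew, map_neg]
  have h₁ := hS (P ζ) ξ η
  have h₂ := hS (P η) ζ ξ
  have h₃ := hS (P ξ) η ζ
  have h₄ := hskew ξ (S η) (P ζ)
  have h₅ := hskew ζ (S ξ) (P η)
  have h₆ := hskew η (S ζ) (P ξ)
  have h₇ : η ⁅S ζ, S ξ⁆ = ξ ⁅S η, S ζ⁆ := by rw [hS, hskew, neg_neg]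
  have h₈ : ζ ⁅S ξ, S η⁆ = ξ ⁅S η, S ζ⁆ := by rw [hskew, hS, neg_neg]
  simp only [lie_add, add_lie, smul_lie, lie_smul, map_add, map_smul, smul_eq_mul]
  linear_combination hP ξ η ζ + u * h₄ - u * h₁ + v * h₂ - v * h₅ + w * h₆ - w * h₃
    - u * w * h₇ + v * w * h₈ + ξ ⁅S η, S ζ⁆ * h

/-- The equation is checked for each triple of components. The signs ε enter only through their
squares, because φ_s is quadratic in s. -/
theorem isQuasitriangular_twist [Fintype ι] [LinearOrder ι] {ε : ι → ℤ}
    (hε : ∀ j, ε j * ε j = 1) {r : L ⊗[ℂ] L} (hr : IsQuasitriangular r) :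
    IsQuasitriangular (twist ι ε r) := by
  rw [isQuasitriangular_iff, symPart_twist, skewPart_twist]
  obtain ⟨hinv, hyb⟩ := (isQuasitriangular_iff r).1 hr
  constructor
  · intro x
    rw [map_sum]
    refine Finset.sum_eq_zero fun j _ => ?_
    rw [place_eq_map, adTensor_map (lie_leg x j) (lie_leg x j), map_zsmul, hinv, smul_zero, map_zero]
  · set P := sharp (skewPart r) with hP
    set S := sharp (symPart r) with hS
    have hP' : ∀ ξ : Module.Dual ℂ (ι → L), sharp (twistSkew ι r) ξ =
        ∑ k, leg k (∑ j, (P (ξ ∘ₗ leg j) + orderSign j k • S (ξ ∘ₗ leg j))) := by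
      intro ξ
      simp only [twistSkew, sharp_sum, place_eq_map, sharp_map, map_sum, sharp_add, sharp_smul,
        hP, hS]
      rw [Finset.sum_comm]
    have hS' : ∀ ξ : Module.Dual ℂ (ι → L), sharp (∑ j : ι, place j j (ε j • symPart r)) ξ =
        ∑ k, leg k ((ε k : ℂ) • S (ξ ∘ₗ leg k)) := by
      intro ξ
      simp only [sharp_sum, place_eq_map, sharp_map, hS, ← Int.cast_smul_eq_zsmul ℂ, sharp_smul]
    intro ξ η ζ
    have hε' : ∀ k, (ε k : ℂ) * ε k = 1 := fun k => by exact_mod_cast hε k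
    -- The diagonal sum is written as a triple sum with an indicator, so that it can be added
    -- termwise to the other three.
    have hdiag : ∑ i, (ξ ∘ₗ leg i) ⁅(ε i : ℂ) • S (η ∘ₗ leg i), (ε i : ℂ) • S (ζ ∘ₗ leg i)⁆ =
        ∑ i, ∑ j, ∑ k, (if i = j ∧ j = k then (1 : ℂ) else 0) *
          (ξ ∘ₗ leg i) ⁅S (η ∘ₗ leg j), S (ζ ∘ₗ leg k)⁆ := by
      refine Finset.sum_congr rfl fun i _ => ?_
      rw [Finset.sum_eq_single i, Finset.sum_eq_single i]
      · simp only [smul_lie, lie_smul, map_smul, smul_eq_mul, and_self, if_true, ← mul_assoc, hε']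
      · intro k _ hk
        simp [hk.symm]
      · simp
      · intro j _ hj
        simp [hj.symm]
      · simp
    rw [hP', hP', hP', hS', hS']
    rw [apply_lie_sum_leg, apply_lie_sum_leg, apply_lie_sum_leg, apply_lie_sum_leg, hdiag]
    simp only [sum_lie_sum, map_sum]
    -- The three cyclic terms sum over j, k, i in rotated orders; they are brought to a common
    -- order.
    have rot₁ : ∀ f : ι → ι → ι → ℂ, ∑ j, ∑ k, ∑ i, f i j k = ∑ i, ∑ j, ∑ k, f i j k :=
      fun f => by
        rw [Finset.sum_congr rfl fun j _ => Finset.sum_comm, Finset.sum_comm]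
    have rot₂ : ∀ f : ι → ι → ι → ℂ, ∑ k, ∑ i, ∑ j, f i j k = ∑ i, ∑ j, ∑ k, f i j k :=
      fun f => by
        rw [Finset.sum_comm]
        exact Finset.sum_congr rfl fun i _ => Finset.sum_comm
    rw [rot₁ fun i j k => (η ∘ₗ leg j) ⁅P (ζ ∘ₗ leg k) + orderSign k j • S (ζ ∘ₗ leg k),
        P (ξ ∘ₗ leg i) + orderSign i j • S (ξ ∘ₗ leg i)⁆,
      rot₂ fun i j k => (ζ ∘ₗ leg k) ⁅P (ξ ∘ₗ leg i) + orderSign i k • S (ξ ∘ₗ leg i),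
        P (η ∘ₗ leg j) + orderSign j k • S (η ∘ₗ leg j)⁆]
    simp only [← Finset.sum_add_distrib]
    refine Finset.sum_eq_zero fun i _ => Finset.sum_eq_zero fun j _ =>
      Finset.sum_eq_zero fun k _ => ?_
    rw [orderSign_swap j i, orderSign_swap k i, orderSign_swap k j]
    exact yangBaxter_component hyb (lie_sharp_symm (swap_symPart r) hinv) (orderSign_identity i j k)
      _ _ _

/-- The diagonal embedding. -/
def diag (ι : Type*) : L →ₗ[ℂ] (ι → L) := LinearMap.pi fun _ => LinearMap.id

theorem sum_place [Fintype ι] (t : L ⊗[ℂ] L) :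
    ∑ j : ι, ∑ k : ι, place j k t = TensorProduct.map (diag ι) (diag ι) t := by
  induction t with
  | zero => simp
  | add a b ha hb => simp [Finset.sum_add_distrib, ha, hb]
  | tmul a b =>
    have h : ∀ x : L, ∑ j : ι, leg j x = diag ι x := fun x => sum_leg fun _ => x
    simp only [place_eq_map, TensorProduct.map_tmul, ← TensorProduct.tmul_sum,
      ← TensorProduct.sum_tmul, h]

/-- Invariance of s kills every symmetric contribution, so each component (j, k) becomes ad_x Λ =
ad_x r irrespective of order and signs, and the sum over all (j, k) is the diagonal image. -/
theorem adTensor_twist [Fintype ι] [LinearOrder ι] (ε : ι → ℤ) {r : L ⊗[ℂ] L}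
    (hr : IsQuasitriangular r) (x : L) :
    adTensor (diag ι x) (twist ι ε r) = TensorProduct.map (diag ι) (diag ι) (adTensor x r) := by
  have h : ∀ (j k : ι) (t : L ⊗[ℂ] L),
      adTensor (diag ι x) (place j k t) = place j k (adTensor x t) := fun j k t =>
    adTensor_map (lie_leg _ j) (lie_leg _ k) t
  have hr' : adTensor x (skewPart r) = adTensor x r := by
    conv_rhs => rw [← symPart_add_skewPart r, map_add, hr.invariant, zero_add]
  rw [twist_eq, twistSkew]
  simp only [map_add, map_sum, h, map_smul, map_zsmul, hr.invariant, smul_zero, map_zero,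
    Finset.sum_const_zero, zero_add, add_zero, hr', sum_place]

end Twist

/-! ### The r-matrix on the Lie algebra of the gauge group. -/

section DirectSum

variable {L : Type*} [LieRing L] [LieAlgebra ℂ L] {V : Type*} [Fintype V]

theorem isQuasitriangular_directSum {r : V → L ⊗[ℂ] L} (hr : ∀ v, IsQuasitriangular (r v)) :
    IsQuasitriangular (directSum r) := by
  simp only [directSum, place_eq_map]
  exact isQuasitriangular_sum_map (L := fun _ : V => L) (fun v => leg v) (fun v => lie_leg_leg v)
    (fun _ _ h => lie_leg_leg_ne h) (fun v x => ⟨x v, lie_leg x v⟩) hr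

theorem adTensor_directSum (x : V → L) (r : V → L ⊗[ℂ] L) :
    adTensor x (directSum r) = ∑ v, place v v (adTensor (x v) (r v)) := by
  rw [directSum, map_sum]
  exact Finset.sum_congr rfl fun v _ => adTensor_map (lie_leg x v) (lie_leg x v) (r v)

end DirectSum

/-! ### The r-matrix of a skeleton. -/

section Skeleton

variable {L : Type*} [LieRing L] [LieAlgebra ℂ L] {S : Type*} [TopologicalSpace S]
  [ChartedSpace HalfPlane S] {V : Finset S} {Edge : Type*} [Fintype Edge]
  (Γ : OrientedSkeleton V Edge)

open Classical in
theorem inclAt_eq (v : V) : inclAt (L := L) Γ v =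
    ∑ α : Γ.HalfEdgesAt v, leg α.1 ∘ₗ LinearMap.proj α := by
  unfold inclAt leg
  congr!

theorem inclAt_leg (v : V) (α : Γ.HalfEdgesAt v) (x : L) :
    inclAt Γ v (leg α x) = leg α.1 x := by
  simp only [inclAt_eq, LinearMap.sum_apply, LinearMap.comp_apply, LinearMap.proj_apply]
  rw [Finset.sum_eq_single α]
  · rw [leg_apply_same]
  · intro β _ hβ
    rw [leg_apply_ne hβ, map_zero]
  · simp

theorem inclAt_apply (v : V) (x : Γ.HalfEdgesAt v → L) (α : Γ.HalfEdgesAt v) :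
    inclAt Γ v x α.1 = x α := by
  simp only [inclAt_eq, LinearMap.sum_apply, LinearMap.comp_apply, LinearMap.proj_apply,
    Finset.sum_apply]
  rw [Finset.sum_eq_single α]
  · rw [leg_apply_same]
  · exact fun β _ hβ => leg_apply_ne (fun h => hβ (Subtype.ext h.symm)) _
  · simp

theorem inclAt_apply_ne (v : V) (x : Γ.HalfEdgesAt v → L) {α : Edge × Bool} (h : Γ.base α ≠ v) :
    inclAt Γ v x α = 0 := by
  simp only [inclAt_eq, LinearMap.sum_apply, LinearMap.comp_apply, LinearMap.proj_apply,
    Finset.sum_apply]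
  refine Finset.sum_eq_zero fun β _ => leg_apply_ne ?_ _
  rintro rfl
  exact h β.2

theorem lie_inclAt (v : V) (x : Edge × Bool → L) (y : Γ.HalfEdgesAt v → L) :
    ⁅x, inclAt Γ v y⁆ = inclAt Γ v ⁅fun α : Γ.HalfEdgesAt v => x α.1, y⁆ := by
  funext α
  change ⁅x α, inclAt Γ v y α⁆ = _
  by_cases h : Γ.base α = v
  · rw [inclAt_apply Γ v y ⟨α, h⟩, inclAt_apply Γ v _ ⟨α, h⟩]
    rfl
  · rw [inclAt_apply_ne Γ v _ h, inclAt_apply_ne Γ v _ h, lie_zero]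

theorem inclAt_lie (v : V) (x y : Γ.HalfEdgesAt v → L) :
    ⁅inclAt Γ v x, inclAt Γ v y⁆ = inclAt Γ v ⁅x, y⁆ := by
  rw [lie_inclAt]
  congr 2
  funext α
  exact inclAt_apply Γ v x α

theorem inclAt_lie_ne {v w : V} (h : v ≠ w) (x : Γ.HalfEdgesAt v → L) (y : Γ.HalfEdgesAt w → L) :
    ⁅inclAt Γ v x, inclAt Γ w y⁆ = 0 := by
  funext α
  change ⁅inclAt Γ v x α, inclAt Γ w y α⁆ = 0
  by_cases h' : Γ.base α = v
  · rw [inclAt_apply_ne Γ w y (h' ▸ h), lie_zero]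
  · rw [inclAt_apply_ne Γ v x h', zero_lie]

theorem isQuasitriangular_skeletonRMatrix {r : V → L ⊗[ℂ] L}
    (hr : ∀ v, IsQuasitriangular (r v)) : IsQuasitriangular (skeletonRMatrix Γ r) := by
  classical
  rw [skeletonRMatrix]
  refine isQuasitriangular_sum_map (L := fun v => Γ.HalfEdgesAt v → L) (fun v => inclAt Γ v)
    (inclAt_lie Γ) (fun v w h => inclAt_lie_ne Γ h) (fun v x => ⟨_, lie_inclAt Γ v x⟩)
    fun v => ?_
  let _ := Γ.order v
  refine isQuasitriangular_twist (fun α => ?_) (hr v)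
  unfold EmbeddedGraph.sign
  split_ifs <;> rfl

/-- Only the diagonal terms of the twists are symmetric. Since s is common to all vertices, the sum
over vertices and incident half edges can be regrouped by edges; for distinct symmetric parts the
two ends of an edge would not match. -/
theorem symPart_skeletonRMatrix {r : V → L ⊗[ℂ] L} {s : L ⊗[ℂ] L} (hs : ∀ v, symPart (r v) = s) :
    symPart (skeletonRMatrix Γ r) =
      ∑ e : Edge, (place (e, false) (e, false) s - place (e, true) (e, true) s) := by
  classical
  have h : ∀ α : Edge × Bool, Γ.sign α • place α α s =
      if α.2 then -place α α s else place α α s := by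
    rintro ⟨e, _ | _⟩ <;> simp [EmbeddedGraph.sign]
  have h' : ∀ v, TensorProduct.map (inclAt Γ v) (inclAt Γ v)
      (∑ α : Γ.HalfEdgesAt v, place α α (Γ.sign α.1 • s)) =
      ∑ α : Γ.HalfEdgesAt v, Γ.sign α.1 • place α.1 α.1 s := by
    intro v
    rw [map_sum]
    refine Finset.sum_congr rfl fun α _ => ?_
    have hc : inclAt Γ v ∘ₗ leg α = leg (L := L) α.1 := LinearMap.ext fun x => inclAt_leg Γ v α x
    rw [map_zsmul, map_zsmul, place_eq_map, ← LinearMap.comp_apply, ← TensorProduct.map_comp, hc]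
    rfl
  rw [skeletonRMatrix, symPart_sum]
  simp only [symPart_map, symPart_twist, hs]
  have := Finset.sum_congr rfl fun v (_ : v ∈ Finset.univ) => h' v
  convert! this.trans _ using 1
  have hsig : ∑ v : V, ∑ α : Γ.HalfEdgesAt v, Γ.sign α.1 • place α.1 α.1 s =
      ∑ α : Edge × Bool, Γ.sign α • place α α s := by
    rw [← Fintype.sum_sigma' fun (v : V) (α : Γ.HalfEdgesAt v) => Γ.sign α.1 • place α.1 α.1 s]
    exact Fintype.sum_equiv (Equiv.sigmaFiberEquiv Γ.base) _ _ fun x => rfl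
  rw [hsig, Fintype.sum_prod_type]
  refine Finset.sum_congr rfl fun e _ => ?_
  rw [Fintype.sum_bool, h, h, sub_eq_neg_add]
  rfl

/-- The linear map `𝔤 ^ V → 𝔤 ^ Γ_{1/2}` induced by the map which sends a half edge to its
vertex. -/
def pullBase (Γ : OrientedSkeleton V Edge) : (V → L) →ₗ[ℂ] (Edge × Bool → L) :=
  LinearMap.pi fun α => LinearMap.proj (Γ.base α)

/-- At the half edges of v a pulled back element is constant with value `x v`, so this reduces to
the diagonal case `adTensor_twist` at each vertex. -/
theorem adTensor_skeletonRMatrix {r : V → L ⊗[ℂ] L} (hr : ∀ v, IsQuasitriangular (r v))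
    (x : V → L) :
    adTensor (pullBase Γ x) (skeletonRMatrix Γ r) =
      TensorProduct.map (pullBase Γ) (pullBase Γ) (cobracket (directSum r) x) := by
  classical
  rw [cobracket, adTensor_directSum, skeletonRMatrix, map_sum, map_sum]
  refine Finset.sum_congr rfl fun v _ => ?_
  let _ := Γ.order v
  have h : ∀ y, ⁅pullBase Γ x, inclAt Γ v y⁆ = inclAt Γ v ⁅diag _ (x v), y⁆ := fun y => by
    rw [lie_inclAt Γ v]
    congr 2
    funext α
    exact congrArg x α.2
  have hc : pullBase Γ ∘ₗ leg v = inclAt Γ v ∘ₗ diag (L := L) (Γ.HalfEdgesAt v) := by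
    ext y α
    by_cases hα : Γ.base α = v
    · refine Eq.trans ?_ (inclAt_apply Γ v _ ⟨α, hα⟩).symm
      change (leg v y : V → L) (Γ.base α) = y
      rw [hα, leg_apply_same]
    · refine Eq.trans ?_ (inclAt_apply_ne Γ v _ hα).symm
      exact leg_apply_ne hα y
  rw [adTensor_map h h, adTensor_twist _ (hr v), place_eq_map, TensorProduct.map_map,
    TensorProduct.map_map, hc]

end Skeleton

/-! ### Poisson structures from r-matrices and infinitesimal actions. -/

section AbstractPoisson

variable {F : Type*} [NormedAddCommGroup F] [NormedSpace ℂ F] {H : Type*} [TopologicalSpace H]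
  (I : ModelWithCorners ℂ F H) {Y : Type*} [TopologicalSpace Y] [ChartedSpace H Y]
  {L : Type*} [LieRing L] [LieAlgebra ℂ L] (ρ : ∀ y : Y, L →ₗ[ℂ] TangentSpace I y)

/-- A family of linear maps `L → T_y Y` which defines a morphism of Lie algebras from `L` to the
derivations of the sheaf of holomorphic functions on `Y`. -/
structure IsDerivationAction : Prop where
  holomorphicOn : ∀ (x : L) (U : Set Y) (f : Y → ℂ), IsOpen U → HolomorphicOn I f U →
    HolomorphicOn I (derivAlong I (fun z => ρ z x) f) U
  lie : ∀ (x x' : L) (U : Set Y) (f : Y → ℂ), IsOpen U → HolomorphicOn I f U → ∀ y ∈ U,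
    derivAlong I (fun z => ρ z x) (derivAlong I (fun z => ρ z x') f) y -
      derivAlong I (fun z => ρ z x') (derivAlong I (fun z => ρ z x) f) y =
        derivAlong I (fun z => ρ z ⁅x, x'⁆) f y

variable {I ρ}

theorem HolomorphicOn.mdifferentiableAt {f : Y → ℂ} {U : Set Y} (hf : HolomorphicOn I f U)
    (hU : IsOpen U) {y : Y} (hy : y ∈ U) : MDifferentiableAt I 𝓘(ℂ, ℂ) f y :=
  (hf.contMDiffAt (hU.mem_nhds hy)).mdifferentiableAt (by simp)

theorem diffAt_add {f g : Y → ℂ} {y : Y} (hf : MDifferentiableAt I 𝓘(ℂ, ℂ) f y)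
    (hg : MDifferentiableAt I 𝓘(ℂ, ℂ) g y) (v : TangentSpace I y) :
    diffAt I (fun z => f z + g z) y v = diffAt I f y v + diffAt I g y v :=
  congrArg (fun T : TangentSpace I y →L[ℂ] ℂ => T v) (hf.hasMFDerivAt.add hg.hasMFDerivAt).mfderiv

theorem diffAt_mul {f g : Y → ℂ} {y : Y} (hf : MDifferentiableAt I 𝓘(ℂ, ℂ) f y)
    (hg : MDifferentiableAt I 𝓘(ℂ, ℂ) g y) (v : TangentSpace I y) :
    diffAt I (fun z => f z * g z) y v = diffAt I f y v * g y + f y * diffAt I g y v := by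
  refine (congrArg (fun T : TangentSpace I y →L[ℂ] ℂ => T v)
    (hf.hasMFDerivAt.mul hg.hasMFDerivAt).mfderiv).trans ?_
  change f y * diffAt I g y v + g y * diffAt I f y v = _
  ring

theorem mdifferentiableAt_sum {κ : Type*} (A : Finset κ) {f : κ → Y → ℂ} {y : Y}
    (hf : ∀ i, MDifferentiableAt I 𝓘(ℂ, ℂ) (f i) y) :
    MDifferentiableAt I 𝓘(ℂ, ℂ) (fun z => ∑ i ∈ A, f i z) y := by
  classical
  induction A using Finset.induction_on with
  | empty => simpa using! mdifferentiableAt_const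
  | insert i s hi IH =>
    simp only [Finset.sum_insert hi]
    exact (hf i).add IH

theorem diffAt_sum {κ : Type*} (A : Finset κ) {f : κ → Y → ℂ} {y : Y}
    (hf : ∀ i, MDifferentiableAt I 𝓘(ℂ, ℂ) (f i) y) (v : TangentSpace I y) :
    diffAt I (fun z => ∑ i ∈ A, f i z) y v = ∑ i ∈ A, diffAt I (f i) y v := by
  classical
  induction A using Finset.induction_on with
  | empty =>
    simp only [Finset.sum_empty, diffAt]
    rw [mfderiv_const]
    rfl
  | insert i s hi IH =>
    simp only [Finset.sum_insert hi]
    rw [diffAt_add (hf i) (mdifferentiableAt_sum s hf), IH]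

theorem diffAt_sum_mul {κ : Type*} (A : Finset κ) {f g : κ → Y → ℂ} {y : Y}
    (hf : ∀ i, MDifferentiableAt I 𝓘(ℂ, ℂ) (f i) y)
    (hg : ∀ i, MDifferentiableAt I 𝓘(ℂ, ℂ) (g i) y) (v : TangentSpace I y) :
    diffAt I (fun z => ∑ i ∈ A, f i z * g i z) y v =
      ∑ i ∈ A, (diffAt I (f i) y v * g i y + f i y * diffAt I (g i) y v) := by
  rw [diffAt_sum (f := fun i z => f i z * g i z) A fun i => (hf i).mul (hg i)]
  exact Finset.sum_congr rfl fun i _ => diffAt_mul (hf i) (hg i) v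

/-- The differential of `f` at `y`, seen as a linear form on `L`. -/
def pullDiff (I : ModelWithCorners ℂ F H) (ρ : ∀ y : Y, L →ₗ[ℂ] TangentSpace I y) (f : Y → ℂ)
    (y : Y) : Module.Dual ℂ L := diffAt I f y ∘ₗ ρ y

theorem pullDiff_apply (f : Y → ℂ) (y : Y) (x : L) :
    pullDiff I ρ f y x = derivAlong I (fun z => ρ z x) f y := rfl

theorem tensorEval_pushTensor_sum {κ : Type*} (A : Finset κ) (a b : κ → L) (f g : Y → ℂ) (y : Y) :
    tensorEval I (pushTensor I ρ (∑ i ∈ A, a i ⊗ₜ[ℂ] b i) y) f g =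
      ∑ i ∈ A, pullDiff I ρ f y (a i) * pullDiff I ρ g y (b i) := by
  simp [tensorEval, pushTensor, pullDiff]

theorem tensorEval_pushTensor (t : L ⊗[ℂ] L) (f g : Y → ℂ) (y : Y) :
    tensorEval I (pushTensor I ρ t y) f g = pullDiff I ρ g y (sharp t (pullDiff I ρ f y)) := by
  simp only [tensorEval, pushTensor]
  induction t with
  | zero => simp
  | tmul a b => simp [pullDiff, sharp_tmul]
  | add s t hs ht => simp only [map_add, sharp_add, hs, ht]

/-- Contracting the vanishing tensor with df in its first factor gives the vector in question. -/
theorem map_sharp_eq_zero {t : L ⊗[ℂ] L} {y : Y} (h : pushTensor I ρ t y = 0) (f : Y → ℂ) :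
    ρ y (sharp t (pullDiff I ρ f y)) = 0 := by
  have key : ∀ t : L ⊗[ℂ] L, ρ y (sharp t (pullDiff I ρ f y)) =
      TensorProduct.lid ℂ (TangentSpace I y) (TensorProduct.map (diffAt I f y) LinearMap.id
        (pushTensor I ρ t y)) := by
    intro t
    simp only [pushTensor]
    induction t with
    | zero => simp
    | tmul a b => simp [pullDiff, sharp_tmul]
    | add s t hs ht => simp only [map_add, sharp_add, hs, ht]
  rw [key, h, map_zero, map_zero]

theorem exists_sum_tmul (t : L ⊗[ℂ] L) :
    ∃ (A : Finset (L × L)), t = ∑ i ∈ A, i.1 ⊗ₜ[ℂ] i.2 := TensorProduct.exists_finset t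

variable (hρ : IsDerivationAction I ρ)

include hρ

theorem IsDerivationAction.holomorphicOn_poissonBracket (t : L ⊗[ℂ] L) {U : Set Y} {f g : Y → ℂ}
    (hU : IsOpen U) (hf : HolomorphicOn I f U) (hg : HolomorphicOn I g U) :
    HolomorphicOn I (poissonBracket I (pushTensor I ρ t) f g) U := by
  obtain ⟨A, rfl⟩ := exists_sum_tmul t
  have : poissonBracket I (pushTensor I ρ (∑ i ∈ A, i.1 ⊗ₜ[ℂ] i.2)) f g = fun y =>
      ∑ i ∈ A, derivAlong I (fun z => ρ z i.1) f y * derivAlong I (fun z => ρ z i.2) g y :=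
    funext fun y => tensorEval_pushTensor_sum A _ _ f g y
  rw [this]
  refine contMDiffOn_finsetSum fun i _ => ?_
  exact (hρ.holomorphicOn i.1 U f hU hf).mul (hρ.holomorphicOn i.2 U g hU hg)

/-- The derivative of a bracket along the field defined by `x`. -/
theorem IsDerivationAction.derivAlong_poissonBracket (A : Finset (L × L)) {U : Set Y}
    {f g : Y → ℂ} (hU : IsOpen U) (hf : HolomorphicOn I f U) (hg : HolomorphicOn I g U) {y : Y}
    (hy : y ∈ U) (x : L) :
    derivAlong I (fun z => ρ z x)
        (poissonBracket I (pushTensor I ρ (∑ i ∈ A, i.1 ⊗ₜ[ℂ] i.2)) f g) y =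
      ∑ i ∈ A, ((pullDiff I ρ (derivAlong I (fun z => ρ z x) f) y i.1 +
          pullDiff I ρ f y ⁅x, i.1⁆) * pullDiff I ρ g y i.2 +
        pullDiff I ρ f y i.1 * (pullDiff I ρ (derivAlong I (fun z => ρ z x) g) y i.2 +
          pullDiff I ρ g y ⁅x, i.2⁆)) := by
  have : poissonBracket I (pushTensor I ρ (∑ i ∈ A, i.1 ⊗ₜ[ℂ] i.2)) f g = fun y =>
      ∑ i ∈ A, derivAlong I (fun z => ρ z i.1) f y * derivAlong I (fun z => ρ z i.2) g y :=
    funext fun y => tensorEval_pushTensor_sum A _ _ f g y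
  rw [this, derivAlong, diffAt_sum_mul A
    (fun i => (hρ.holomorphicOn i.1 U f hU hf).mdifferentiableAt hU hy)
    (fun i => (hρ.holomorphicOn i.2 U g hU hg).mdifferentiableAt hU hy)]
  refine Finset.sum_congr rfl fun i _ => ?_
  have h₁ := hρ.lie x i.1 U f hU hf y hy
  have h₂ := hρ.lie x i.2 U g hU hg y hy
  simp only [pullDiff_apply]
  rw [← h₁, ← h₂]
  simp only [derivAlong]
  ring

/-- By the Leibniz rule, moving the derivation past those of the two factors of t produces
commutators, that is the action of x on these factors. -/
theorem IsDerivationAction.lieDerivative_poissonBracket (t : L ⊗[ℂ] L) {U : Set Y}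
    {f g : Y → ℂ} (hU : IsOpen U) (hf : HolomorphicOn I f U) (hg : HolomorphicOn I g U) {y : Y}
    (hy : y ∈ U) (x : L) :
    derivAlong I (fun z => ρ z x) (poissonBracket I (pushTensor I ρ t) f g) y
        - poissonBracket I (pushTensor I ρ t) (derivAlong I (fun z => ρ z x) f) g y
        - poissonBracket I (pushTensor I ρ t) f (derivAlong I (fun z => ρ z x) g) y
      = tensorEval I (pushTensor I ρ (adTensor x t) y) f g := by
  obtain ⟨A, rfl⟩ := exists_sum_tmul t
  rw [hρ.derivAlong_poissonBracket A hU hf hg hy, poissonBracket, poissonBracket,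
    tensorEval_pushTensor_sum, tensorEval_pushTensor_sum, tensorEval_pushTensor, map_sum,
    sharp_sum, map_sum, ← Finset.sum_sub_distrib, ← Finset.sum_sub_distrib]
  refine Finset.sum_congr rfl fun i _ => ?_
  simp [adTensor, sharp_tmul]
  ring

/-- With v = t♯ df at y, the left-hand side is the derivative of {g, h} along v at y. The formula
separates second derivatives from brackets in L, ready for the cyclic sum. -/
theorem IsDerivationAction.poissonBracket_poissonBracket {t : L ⊗[ℂ] L} (ht : swap t = -t)
    {U : Set Y} {f g h : Y → ℂ} (hU : IsOpen U) (hg : HolomorphicOn I g U)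
    (hh : HolomorphicOn I h U) {y : Y} (hy : y ∈ U) :
    poissonBracket I (pushTensor I ρ t) f (poissonBracket I (pushTensor I ρ t) g h) y =
      pullDiff I ρ (derivAlong I (fun z => ρ z (sharp t (pullDiff I ρ f y))) h) y
          (sharp t (pullDiff I ρ g y))
        - pullDiff I ρ (derivAlong I (fun z => ρ z (sharp t (pullDiff I ρ f y))) g) y
          (sharp t (pullDiff I ρ h y))
        + pullDiff I ρ h y ⁅sharp t (pullDiff I ρ f y), sharp t (pullDiff I ρ g y)⁆
        - pullDiff I ρ g y ⁅sharp t (pullDiff I ρ f y), sharp t (pullDiff I ρ h y)⁆ := by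
  have hneg : ∀ ξ, sharp t ξ = -sharp (swap t) ξ := fun ξ => by rw [ht, sharp_neg, neg_neg]
  rw [hneg (pullDiff I ρ h y)]
  rw [poissonBracket, tensorEval_pushTensor]
  -- This element of L depends on y, but the outer bracket is evaluated at y only, so it may be
  -- treated as constant.
  generalize hv : sharp t (pullDiff I ρ f y) = v
  rw [pullDiff_apply]
  clear hneg ht hv
  obtain ⟨A, rfl⟩ := exists_sum_tmul t
  rw [hρ.derivAlong_poissonBracket A hU hg hh hy]
  simp only [sharp_sum, map_sum, swap_tmul, sharp_tmul, lie_neg, map_neg, lie_sum, lie_smul,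
    map_smul, smul_eq_mul, sub_neg_eq_add, ← Finset.sum_add_distrib]
  refine Finset.sum_congr rfl fun i _ => ?_
  ring

/-- Since the symmetric part acts by zero, only Λ matters, and the Jacobi identity becomes the
Yang--Baxter equation with its φ_s term removed. -/
theorem IsDerivationAction.isPoisson {r : L ⊗[ℂ] L} (hr : IsQuasitriangular r)
    (hsym : ∀ y, pushTensor I ρ (symPart r) y = 0) : IsPoisson I (pushTensor I ρ r) := by
  have hpush : pushTensor I ρ r = pushTensor I ρ (skewPart r) := by
    funext y
    conv_lhs => rw [← symPart_add_skewPart r]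
    have := hsym y
    simp only [pushTensor, map_add] at this ⊢
    rw [this, zero_add]
  have hcomm : ∀ (t : L ⊗[ℂ] L) (y : Y), TensorProduct.comm ℂ (TangentSpace I y)
      (TangentSpace I y) (pushTensor I ρ t y) = pushTensor I ρ (swap t) y := by
    intro t y
    simp only [pushTensor]
    induction t with
    | zero => simp
    | tmul a b => simp
    | add s t hs ht => simp only [map_add, hs, ht]
  rw [hpush]
  refine ⟨fun y => ?_, fun U f g hU hf hg => hρ.holomorphicOn_poissonBracket _ hU hf hg,
    fun U f g h hU hf hg hh y hy => ?_⟩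
  · rw [hcomm, swap_skewPart]
    simp [pushTensor]
  · have hs := swap_skewPart r
    rw [hρ.poissonBracket_poissonBracket hs hU hg hh hy,
      hρ.poissonBracket_poissonBracket hs hU hh hf hy,
      hρ.poissonBracket_poissonBracket hs hU hf hg hy]
    set w := sharp (skewPart r)
    set ξ := pullDiff I ρ f y with hξ
    set η := pullDiff I ρ g y with hη
    set ζ := pullDiff I ρ h y with hζ
    have hyb := ((isQuasitriangular_iff r).1 hr).2 ξ η ζ
    have hlie : ∀ (k : Y → ℂ) (_ : HolomorphicOn I k U) (x x' : L),
        pullDiff I ρ (derivAlong I (fun z => ρ z x') k) y x -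
          pullDiff I ρ (derivAlong I (fun z => ρ z x) k) y x' = pullDiff I ρ k y ⁅x, x'⁆ :=
      fun k hk x x' => hρ.lie x x' U k hU hk y hy
    -- The fields generated by s♯ η and s♯ ζ vanish at y, hence so does their commutator at y.
    have hzero : ξ ⁅sharp (symPart r) η, sharp (symPart r) ζ⁆ = 0 := by
      rw [hξ, ← hlie f hf]
      simp only [pullDiff, LinearMap.comp_apply]
      rw [hη, hζ, map_sharp_eq_zero (hsym y), map_sharp_eq_zero (hsym y), map_zero, map_zero,
        sub_zero]
    -- In the cyclic sum, the second derivatives of each function occur as an antisymmetric pair,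
    -- which is a first derivative along a bracket.
    have e₁ := hlie f hf (w ζ) (w η)
    have e₂ := hlie g hg (w ξ) (w ζ)
    have e₃ := hlie h hh (w η) (w ξ)
    have s₁ : ξ ⁅w ζ, w η⁆ = -ξ ⁅w η, w ζ⁆ := by rw [← lie_skew, map_neg]
    have s₂ : η ⁅w ξ, w ζ⁆ = -η ⁅w ζ, w ξ⁆ := by rw [← lie_skew, map_neg]
    have s₃ : ζ ⁅w η, w ξ⁆ = -ζ ⁅w ξ, w η⁆ := by rw [← lie_skew, map_neg]
    rw [hzero] at hyb
    rw [← hξ, ← hη, ← hζ] at *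
    linear_combination hyb + e₁ + e₂ + e₃

end AbstractPoisson

/-! ### Calculus on powers of a manifold. -/

section PowerManifold

variable {E : Type*} [NormedAddCommGroup E] [NormedSpace ℂ E] {ι : Type*} [Fintype ι]
  {M : Type*} [TopologicalSpace M] [ChartedSpace E M]
  {F : Type*} [NormedAddCommGroup F] [NormedSpace ℂ F] {H : Type*} [TopologicalSpace H]
  {I : ModelWithCorners ℂ F H} {N : Type*} [TopologicalSpace N] [ChartedSpace H N]

theorem powModel_range : Set.range (powModel E ι) = Set.univ :=
  Set.range_eq_univ.2 fun x : ι → E => ⟨x, rfl⟩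

instance : (powModel E ι).Boundaryless := ⟨powModel_range⟩

theorem contMDiffAt_pow_iff {f : N → ι → M} {x : N} {n : ℕ∞ω} :
    ContMDiffAt I (powModel E ι) n f x ↔ ∀ i, ContMDiffAt I 𝓘(ℂ, E) n (fun y => f y i) x := by
  simp only [contMDiffAt_iff, continuousAt_pi, forall_and]
  refine and_congr Iff.rfl ?_
  exact contDiffWithinAt_pi

theorem contMDiff_pow_iff {f : N → ι → M} {n : ℕ∞ω} :
    ContMDiff I (powModel E ι) n f ↔ ∀ i, ContMDiff I 𝓘(ℂ, E) n (fun y => f y i) :=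
  ⟨fun h i x => contMDiffAt_pow_iff.1 (h x) i, fun h x => contMDiffAt_pow_iff.2 fun i => h i x⟩

/-- The preferred charts of a power are products of preferred charts, so this is componentwise
differentiability in the model space. -/
theorem hasMFDerivAt_pow_iff {f : N → ι → M} {x : N} {f' : F →L[ℂ] (ι → E)} :
    HasMFDerivAt I (powModel E ι) f x f' ↔
      ∀ i, HasMFDerivAt I 𝓘(ℂ, E) (fun y => f y i) x (ContinuousLinearMap.proj i ∘L f') := by
  simp only [HasMFDerivAt, continuousAt_pi, forall_and]
  refine and_congr Iff.rfl ?_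
  exact hasFDerivWithinAt_pi'

theorem contMDiff_apply (i : ι) {n : ℕ∞ω} [IsManifold 𝓘(ℂ, E) ω M]:
    ContMDiff (powModel E ι) 𝓘(ℂ, E) n (fun m : ι → M => m i) :=
  contMDiff_pow_iff.1 contMDiff_id i

theorem hasMFDerivAt_apply (i : ι) (m : ι → M) :
    HasMFDerivAt (powModel E ι) 𝓘(ℂ, E) (fun m : ι → M => m i) m
      (ContinuousLinearMap.proj (R := ℂ) (φ := fun _ : ι => E) i) :=
  hasMFDerivAt_pow_iff.1 (hasMFDerivAt_id m) i

end PowerManifold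

/-! ### Calculus on a space with transported structure. -/

section Transport

variable {F : Type*} [NormedAddCommGroup F] [NormedSpace ℂ F] {H : Type*} [TopologicalSpace H]
  {I : ModelWithCorners ℂ F H} {M Y : Type*} [TopologicalSpace M] [ChartedSpace H M] (e : M ≃ Y)
  {F' : Type*} [NormedAddCommGroup F'] [NormedSpace ℂ F'] {H' : Type*} [TopologicalSpace H']
  {I' : ModelWithCorners ℂ F' H'} {N : Type*} [TopologicalSpace N] [ChartedSpace H' N]

/-- The charts of the transported space are those of M composed with the inverse bijection, so both
sides have the same expression in charts. Only continuity needs an argument. -/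
theorem hasMFDerivAt_transport_iff {f : N → Transport e} {x : N} {f' : F' →L[ℂ] F} :
    HasMFDerivAt I' I f x f' ↔ HasMFDerivAt I' I (fun y => (toTransport e).symm (f y)) x f' := by
  simp only [HasMFDerivAt]
  refine and_congr ?_ Iff.rfl
  exact ((toTransport e).symm.comp_continuousAt_iff f x).symm

theorem contMDiffAt_transport_iff {f : N → Transport e} {x : N} {n : ℕ∞ω} :
    ContMDiffAt I' I n f x ↔ ContMDiffAt I' I n (fun y => (toTransport e).symm (f y)) x := by
  simp only [contMDiffAt_iff]
  refine and_congr ?_ Iff.rfl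
  exact ((toTransport e).symm.comp_continuousAt_iff f x).symm

theorem contMDiff_toTransport {n : ℕ∞ω} [IsManifold I ω M] :
    ContMDiff I I n (toTransport e) := fun _ =>
  (contMDiffAt_transport_iff e).2 (by simpa using! contMDiffAt_id)

theorem contMDiff_toTransport_symm {n : ℕ∞ω} [IsManifold I ω M] :
    ContMDiff I I n (toTransport e).symm := fun _ =>
  (contMDiffAt_transport_iff e).1 contMDiffAt_id

theorem hasMFDerivAt_toTransport_symm (y : Transport e) :
    HasMFDerivAt I I (toTransport e).symm y (ContinuousLinearMap.id ℂ F) :=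
  (hasMFDerivAt_transport_iff e).1 (hasMFDerivAt_id y)

/-- Both tangent spaces are the model space F, and the derivative of the transport is the identity
of F. -/
theorem transportTensor_eq (π : ∀ m : M, TangentSpace I m ⊗[ℂ] TangentSpace I m)
    (y : Transport e) :
    transportTensor I e π y = π ((toTransport e).symm y) := by
  have key : ∀ T : F →L[ℂ] F, T = ContinuousLinearMap.id ℂ F → ∀ p : F ⊗[ℂ] F,
      TensorProduct.map T.inverse.toLinearMap T.inverse.toLinearMap p = p := by
    rintro _ rfl p
    rw [ContinuousLinearMap.inverse_id]
    exact LinearMap.congr_fun TensorProduct.map_id p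
  exact key _ (hasMFDerivAt_toTransport_symm e y).mfderiv _

end Transport

/-! ### Symmetry of second derivatives. -/

section Calculus

/-- Partial derivatives of a function of two complex variables commute. -/
theorem deriv_deriv_comm {g : ℂ × ℂ → ℂ} (hg : ContDiffAt ℂ ω g 0) :
    deriv (fun t => deriv (fun u => g (t, u)) 0) 0 =
      deriv (fun u => deriv (fun t => g (t, u)) 0) 0 := by
  have hd : ∀ᶠ p in 𝓝 (0 : ℂ × ℂ), DifferentiableAt ℂ g p := by
    have := hg.eventually (by simp)
    exact this.mono fun p hp => hp.differentiableAt (by simp)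
  have hd2 : DifferentiableAt ℂ (fderiv ℂ g) 0 :=
    (hg.fderiv_right (m := 1) (by simp)).differentiableAt (by simp)
  have hc₁ : ContinuousAt (fun t : ℂ => ((t, 0) : ℂ × ℂ)) 0 := by fun_prop
  have hc₂ : ContinuousAt (fun u : ℂ => ((0, u) : ℂ × ℂ)) 0 := by fun_prop
  have e₁ : (fun t => deriv (fun u => g (t, u)) 0) =ᶠ[𝓝 0] fun t => fderiv ℂ g (t, 0) (0, 1) := by
    filter_upwards [hc₁.eventually hd] with t ht
    have h : HasDerivAt (fun u : ℂ => ((t, u) : ℂ × ℂ)) (0, 1) 0 :=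
      (hasDerivAt_const _ _).prodMk (hasDerivAt_id _)
    exact (ht.hasFDerivAt.comp_hasDerivAt (0 : ℂ) h).deriv
  have e₂ : (fun u => deriv (fun t => g (t, u)) 0) =ᶠ[𝓝 0] fun u => fderiv ℂ g (0, u) (1, 0) := by
    filter_upwards [hc₂.eventually hd] with u hu
    have h : HasDerivAt (fun t : ℂ => ((t, u) : ℂ × ℂ)) (1, 0) 0 :=
      (hasDerivAt_id _).prodMk (hasDerivAt_const _ _)
    exact (hu.hasFDerivAt.comp_hasDerivAt (0 : ℂ) h).deriv
  rw [e₁.deriv_eq, e₂.deriv_eq]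
  have h₁ : HasDerivAt (fun t : ℂ => ((t, 0) : ℂ × ℂ)) (1, 0) 0 :=
    (hasDerivAt_id _).prodMk (hasDerivAt_const _ _)
  have h₂ : HasDerivAt (fun u : ℂ => ((0, u) : ℂ × ℂ)) (0, 1) 0 :=
    (hasDerivAt_const _ _).prodMk (hasDerivAt_id _)
  have k₁ := ((HasFDerivAt.comp_hasDerivAt (f := fun t : ℂ => ((t, 0) : ℂ × ℂ)) (0 : ℂ)
    hd2.hasFDerivAt h₁).clm_apply (hasDerivAt_const (0 : ℂ) ((0, 1) : ℂ × ℂ))).deriv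
  have k₂ := ((HasFDerivAt.comp_hasDerivAt (f := fun u : ℂ => ((0, u) : ℂ × ℂ)) (0 : ℂ)
    hd2.hasFDerivAt h₂).clm_apply (hasDerivAt_const (0 : ℂ) ((1, 0) : ℂ × ℂ))).deriv
  simp only [Function.comp_def, map_zero, add_zero] at k₁ k₂
  rw [k₁, k₂]
  exact (hg.isSymmSndFDerivAt (by simp)) _ _

end Calculus

/-! ### Lie brackets of vector fields as commutators of derivations. -/

section LieBracket

variable {F : Type*} [NormedAddCommGroup F] [NormedSpace ℂ F] [CompleteSpace F] {H : Type*}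
  [TopologicalSpace H] {I : ModelWithCorners ℂ F H} [I.Boundaryless] {M : Type*}
  [TopologicalSpace M] [ChartedSpace H M] [IsManifold I ω M]

omit [CompleteSpace F] [IsManifold I ω M] in
theorem diffAt_eq_fderiv {f : M → ℂ} {y : M} (hf : MDifferentiableAt I 𝓘(ℂ, ℂ) f y)
    (v : F) :
    diffAt I f y v = fderiv ℂ (f ∘ (extChartAt I y).symm) (extChartAt I y y) v := by
  have key : ∀ T : F →L[ℂ] ℂ,
      HasFDerivWithinAt (f ∘ (extChartAt I y).symm) T (Set.range I) (extChartAt I y y) →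
      T v = fderiv ℂ (f ∘ (extChartAt I y).symm) (extChartAt I y y) v := by
    intro T h
    rw [I.range_eq_univ, hasFDerivWithinAt_univ] at h
    rw [h.fderiv]
  exact key _ hf.hasMFDerivAt.2

/-- A vector field in the preferred chart at `y`. -/
def chartField (I : ModelWithCorners ℂ F H) (y : M) (W : ∀ m : M, TangentSpace I m) : F → F :=
  fun x => VectorField.mpullbackWithin 𝓘(ℂ, F) I (extChartAt I y).symm W (Set.range I) x

omit [CompleteSpace F] in
-- The chart field is the pullback by the inverse chart, whose derivative is invertible on the
-- target; the derivative and its inverse cancel.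
theorem fderiv_comp_extChartAt_symm (W : ∀ m : M, TangentSpace I m) {f : M → ℂ} {y : M} {x : F}
    (hx : x ∈ (extChartAt I y).target)
    (hf : MDifferentiableAt I 𝓘(ℂ, ℂ) f ((extChartAt I y).symm x)) :
    fderiv ℂ (f ∘ (extChartAt I y).symm) x (chartField I y W x) =
      derivAlong I W f ((extChartAt I y).symm x) := by
  have : IsManifold I 1 M := IsManifold.of_le (n := ω) (by simp)
  have hφ := mdifferentiableWithinAt_extChartAt_symm hx
  have hinv := isInvertible_mfderivWithin_extChartAt_symm hx
  rw [chartField, VectorField.mpullbackWithin_apply]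
  rw [I.range_eq_univ] at *
  rw [mfderivWithin_univ] at *
  rw [mdifferentiableWithinAt_univ] at hφ
  have hc := mfderiv_comp x hf hφ
  rw [mfderiv_eq_fderiv] at hc
  rw [hc]
  change mfderiv I 𝓘(ℂ, ℂ) f _ (mfderiv 𝓘(ℂ, F) I (extChartAt I y).symm x _) = _
  obtain ⟨T, hT⟩ := hinv
  rw [← hT, ContinuousLinearMap.inverse_equiv]
  erw [T.apply_symm_apply]
  rfl

omit [CompleteSpace F] [I.Boundaryless] in
theorem chartField_self (W : ∀ m : M, TangentSpace I m) (y : M) :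
    chartField I y W (extChartAt I y y) = W y := by
  have : IsManifold I 1 M := IsManifold.of_le (n := ω) (by simp)
  rw [chartField, VectorField.mpullbackWithin_apply, mfderivWithin_range_extChartAt_symm]
  have key : ∀ z, z = y → (ContinuousLinearMap.id ℂ F).inverse (W z : F) = (W y : F) := by
    rintro z rfl
    rw [ContinuousLinearMap.inverse_id]
    rfl
  exact key _ (extChartAt_to_inv y)

theorem differentiableAt_chartField {W : ∀ m : M, TangentSpace I m}
    (hW : ContMDiff I I.tangent ω (fun m => (⟨m, W m⟩ : TangentBundle I M))) (y : M) :
    DifferentiableAt ℂ (chartField I y W) (extChartAt I y y) := by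
  have : IsManifold I 2 M := IsManifold.of_le (n := ω) (by simp)
  have h := MDifferentiableWithinAt.differentiableWithinAt_mpullbackWithin_vectorField
    (s := Set.univ) ((hW y).mdifferentiableAt (by simp)).mdifferentiableWithinAt
  rw [Set.preimage_univ, Set.univ_inter, I.range_eq_univ] at h
  rw [← differentiableWithinAt_univ, show chartField I y W = _ from rfl]
  unfold chartField
  rw [I.range_eq_univ]
  exact h

omit [CompleteSpace F] in
theorem mlieBracket_eq_chartField (V W : ∀ m : M, TangentSpace I m) (y : M) :
    VectorField.mlieBracket I V W y =
      fderiv ℂ (chartField I y W) (extChartAt I y y) (V y) -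
        fderiv ℂ (chartField I y V) (extChartAt I y y) (W y) := by
  have : IsManifold I 1 M := IsManifold.of_le (n := ω) (by simp)
  rw [VectorField.mlieBracket, VectorField.mlieBracketWithin_apply, mfderiv_extChartAt_self]
  have key : ∀ v : F, (ContinuousLinearMap.id ℂ F).inverse v = v := by
    intro v
    rw [ContinuousLinearMap.inverse_id]
    rfl
  refine (key _).trans ?_
  rw [Set.preimage_univ, Set.univ_inter]
  have h := VectorField.lieBracketWithin_univ (𝕜 := ℂ) (V := chartField I y V)
    (W := chartField I y W)
  have h' := congrFun h (extChartAt I y y)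
  rw [VectorField.lieBracket, chartField_self, chartField_self, ← I.range_eq_univ] at h'
  exact h'

/-- The derivative along the Lie bracket of two vector fields is the commutator of derivatives. -/
theorem diffAt_mlieBracket {V W : ∀ m : M, TangentSpace I m}
    (hV : ContMDiff I I.tangent ω (fun m => (⟨m, V m⟩ : TangentBundle I M)))
    (hW : ContMDiff I I.tangent ω (fun m => (⟨m, W m⟩ : TangentBundle I M)))
    {f : M → ℂ} {y : M} (hf : ContMDiffAt I 𝓘(ℂ, ℂ) ω f y)
    (hVf : MDifferentiableAt I 𝓘(ℂ, ℂ) (derivAlong I V f) y)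
    (hWf : MDifferentiableAt I 𝓘(ℂ, ℂ) (derivAlong I W f) y) :
    diffAt I f y (VectorField.mlieBracket I V W y) =
      derivAlong I V (derivAlong I W f) y - derivAlong I W (derivAlong I V f) y := by
  have : IsManifold I 1 M := IsManifold.of_le (n := ω) (by simp)
  have hft : ContDiffAt ℂ ω (f ∘ (extChartAt I y).symm) (extChartAt I y y) := by
    have := (contMDiffAt_iff.1 hf).2
    rw [I.range_eq_univ, contDiffWithinAt_univ] at this
    exact this
  have hft1 : DifferentiableAt ℂ (fderiv ℂ (f ∘ (extChartAt I y).symm)) (extChartAt I y y) :=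
    (hft.fderiv_right (m := 1) (by simp)).differentiableAt (by simp)
  -- The identity is needed on a neighbourhood and not only at the base point, since it is
  -- differentiated once more.
  have hev : ∀ W : ∀ m : M, TangentSpace I m,
      derivAlong I W f ∘ (extChartAt I y).symm =ᶠ[𝓝 (extChartAt I y y)] fun x =>
        fderiv ℂ (f ∘ (extChartAt I y).symm) x (chartField I y W x) := by
    intro W
    have h₁ : ∀ᶠ z in 𝓝 y, MDifferentiableAt I 𝓘(ℂ, ℂ) f z :=
      ((contMDiffAt_iff_contMDiffAt_nhds (by simp)).1 hf).mono fun z hz =>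
        hz.mdifferentiableAt (by simp)
    rw [← extChartAt_to_inv (I := I) y] at h₁
    filter_upwards [(continuousAt_extChartAt_symm (I := I) y).eventually h₁,
      extChartAt_target_mem_nhds y] with x hx₁ hx₂
    exact (fderiv_comp_extChartAt_symm W hx₂ hx₁).symm
  -- The derivative of x ↦ f'(x)(W x) along V is f''(V, W) + f'(W' V). The first term is symmetric
  -- and drops out of the commutator; the second gives the bracket.
  have hsnd : ∀ {V W : ∀ m : M, TangentSpace I m},
      ContMDiff I I.tangent ω (fun m => (⟨m, W m⟩ : TangentBundle I M)) →
      MDifferentiableAt I 𝓘(ℂ, ℂ) (derivAlong I W f) y →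
      derivAlong I V (derivAlong I W f) y =
        fderiv ℂ (fderiv ℂ (f ∘ (extChartAt I y).symm)) (extChartAt I y y) (V y) (W y) +
        fderiv ℂ (f ∘ (extChartAt I y).symm) (extChartAt I y y)
          (fderiv ℂ (chartField I y W) (extChartAt I y y) (V y)) := by
    intro V W hW hWf
    refine (diffAt_eq_fderiv hWf (V y)).trans ?_
    rw [(hev W).fderiv_eq,
      (hft1.hasFDerivAt.clm_apply (differentiableAt_chartField hW y).hasFDerivAt).fderiv,
      ← chartField_self W y]
    exact add_comm _ _
  have hsymm := hft.isSymmSndFDerivAt (by simp) (V y) (W y)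
  rw [hsnd hV hVf, hsnd hW hWf, mlieBracket_eq_chartField]
  refine (diffAt_eq_fderiv (hf.mdifferentiableAt (by simp)) _).trans ?_
  have h := (fderiv ℂ (f ∘ (extChartAt I y).symm) (extChartAt I y y)).map_sub
    (fderiv ℂ (chartField I y W) (extChartAt I y y) (V y))
    (fderiv ℂ (chartField I y V) (extChartAt I y y) (W y))
  rw [hsymm]
  refine h.trans ?_
  ring

end LieBracket

/-! ### Differentiation of functions along fields, curves and maps. -/

section Fields

variable {F : Type*} [NormedAddCommGroup F] [NormedSpace ℂ F] {H : Type*}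
  [TopologicalSpace H] {I : ModelWithCorners ℂ F H} {M : Type*}
  [TopologicalSpace M] [ChartedSpace H M]

/-- X f is the vector component of the tangent map of f composed with the section X, and both are
holomorphic. -/
theorem holomorphicOn_derivAlong [IsManifold I ω M] {X : ∀ m : M, TangentSpace I m}
    (hX : ContMDiff I I.tangent ω (fun m => (⟨m, X m⟩ : TangentBundle I M)))
    {U : Set M} (hU : IsOpen U) {f : M → ℂ} (hf : HolomorphicOn I f U) :
    HolomorphicOn I (derivAlong I X f) U := by
  have : IsManifold I 1 M := IsManifold.of_le (n := ω) (by simp)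
  have h₁ := hf.contMDiffOn_tangentMapWithin (m := ω) (by simp) hU.uniqueMDiffOn
  have h₂ := h₁.comp (hX.contMDiffOn (s := U)) fun m hm => hm
  have h₃ := (contMDiff_snd_tangentBundle_modelSpace (n := ω) ℂ 𝓘(ℂ, ℂ)).comp_contMDiffOn h₂
  refine h₃.congr fun m hm => ?_
  change diffAt I f m (X m) = mfderivWithin I 𝓘(ℂ, ℂ) f U m (X m)
  rw [mfderivWithin_of_isOpen hU hm]
  rfl

theorem deriv_comp_eq_diffAt {c : ℂ → M} {T : ℂ →L[ℂ] F} {t : ℂ}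
    (hc : HasMFDerivAt 𝓘(ℂ, ℂ) I c t T) {f : M → ℂ} (hf : MDifferentiableAt I 𝓘(ℂ, ℂ) f (c t)) :
    deriv (fun u => f (c u)) t = diffAt I f (c t) (T 1) := by
  have h := hf.hasMFDerivAt.comp t hc
  have key : ∀ S : ℂ →L[ℂ] ℂ, HasMFDerivAt 𝓘(ℂ, ℂ) 𝓘(ℂ, ℂ) (f ∘ c) t S →
      deriv (fun u => f (c u)) t = S 1 := fun S hS => by
    have h : HasFDerivAt (f ∘ c) S t := hasMFDerivAt_iff_hasFDerivAt.1 hS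
    exact h.hasDerivAt.deriv
  exact key _ h

theorem diffAt_comp {F' : Type*} [NormedAddCommGroup F'] [NormedSpace ℂ F'] {H' : Type*}
    [TopologicalSpace H'] {I' : ModelWithCorners ℂ F' H'} {N : Type*}
    [TopologicalSpace N] [ChartedSpace H' N] {a : N → M} {n : N} {f : M → ℂ}
    (hf : MDifferentiableAt I 𝓘(ℂ, ℂ) f (a n)) (ha : MDifferentiableAt I' I a n)
    (v : TangentSpace I' n) :
    diffAt I' (fun k => f (a k)) n v = diffAt I f (a n) (mfderiv I' I a n v) := by
  rw [diffAt]
  exact congrArg (fun T : F' →L[ℂ] ℂ => T v) (mfderiv_comp n hf ha)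

end Fields

/-! ### Curves through the identity of a Lie group. -/

section Curve

variable {E : Type*} [NormedAddCommGroup E] [NormedSpace ℂ E]
  {G : Type*} [TopologicalSpace G] [ChartedSpace E G] [Group G]

/-- A straight line through the identity, in the preferred chart. -/
def curve (x : LieAlg E G) (t : ℂ) : G :=
  (extChartAt 𝓘(ℂ, E) (1 : G)).symm (extChartAt 𝓘(ℂ, E) (1 : G) 1 + t • (show E from x))

theorem curve_zero (x : LieAlg E G) : curve x 0 = 1 := by
  rw [curve, zero_smul, add_zero, extChartAt_to_inv]

theorem contMDiffAt_curve [IsManifold 𝓘(ℂ, E) ω G] (x : LieAlg E G) :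
    ContMDiffAt 𝓘(ℂ, ℂ) 𝓘(ℂ, E) ω (curve x) 0 := by
  have h₁ : ContMDiffAt 𝓘(ℂ, E) 𝓘(ℂ, E) ω (extChartAt 𝓘(ℂ, E) (1 : G)).symm
      (extChartAt 𝓘(ℂ, E) (1 : G) 1 + (0 : ℂ) • (show E from x)) := by
    rw [zero_smul, add_zero]
    exact (contMDiffOn_extChartAt_symm (1 : G)).contMDiffAt (extChartAt_target_mem_nhds (1 : G))
  have h₂ : ContDiff ℂ ω fun t : ℂ => extChartAt 𝓘(ℂ, E) (1 : G) 1 + t • (show E from x) :=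
    contDiff_const.add (contDiff_id.smul contDiff_const)
  exact h₁.comp (0 : ℂ) h₂.contDiffAt.contMDiffAt

/-- Only the velocity at 0 is used below. No exponential map or one-parameter subgroup is involved.
-/
theorem hasMFDerivAt_curve [IsManifold 𝓘(ℂ, E) ω G] (x : LieAlg E G) :
    HasMFDerivAt 𝓘(ℂ, ℂ) 𝓘(ℂ, E) (curve x) 0
      (ContinuousLinearMap.toSpanSingleton ℂ (show E from x)) := by
  refine ⟨(contMDiffAt_curve x).continuousAt, ?_⟩
  have h₂ : HasFDerivAt (fun t : ℂ => extChartAt 𝓘(ℂ, E) (1 : G) 1 + t • (show E from x))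
      (ContinuousLinearMap.toSpanSingleton ℂ (show E from x)) 0 :=
    (ContinuousLinearMap.toSpanSingleton ℂ (show E from x)).hasFDerivAt.const_add _
  have hev : writtenInExtChartAt 𝓘(ℂ, ℂ) 𝓘(ℂ, E) 0 (curve x) =ᶠ[𝓝 0]
      fun t : ℂ => extChartAt 𝓘(ℂ, E) (1 : G) 1 + t • (show E from x) := by
    have hc := h₂.continuousAt
    have ht : ∀ᶠ z in 𝓝 (extChartAt 𝓘(ℂ, E) (1 : G) 1 + (0 : ℂ) • (show E from x)),
        z ∈ (extChartAt 𝓘(ℂ, E) (1 : G)).target := by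
      rw [zero_smul, add_zero]
      exact extChartAt_target_mem_nhds (1 : G)
    filter_upwards [hc.eventually ht] with t ht
    have h0 : (writtenInExtChartAt 𝓘(ℂ, ℂ) 𝓘(ℂ, E) 0 (curve x)) t =
      extChartAt 𝓘(ℂ, E) (curve x 0) (curve x t) := rfl
    rw [h0, curve_zero, curve]
    exact (extChartAt 𝓘(ℂ, E) (1 : G)).right_inv ht
  exact (h₂.congr_of_eventuallyEq hev).hasFDerivWithinAt

theorem deriv_comp_curve [IsManifold 𝓘(ℂ, E) ω G] (x : LieAlg E G) {f : G → ℂ}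
    (hf : MDifferentiableAt 𝓘(ℂ, E) 𝓘(ℂ, ℂ) f 1) :
    deriv (fun t => f (curve x t)) 0 = diffAt 𝓘(ℂ, E) f 1 x := by
  have h := deriv_comp_eq_diffAt (hasMFDerivAt_curve x) (f := f) (by rwa [curve_zero])
  rw [h, curve_zero]
  exact congrArg (fun v : E => diffAt 𝓘(ℂ, E) f 1 v) (one_smul ℂ (show E from x))

end Curve

/-! ### Holomorphic right actions and their infinitesimal actions. -/

section Action

variable {E : Type*} [NormedAddCommGroup E] [NormedSpace ℂ E] [CompleteSpace E]
  {G : Type*} [TopologicalSpace G] [ChartedSpace E G] [Group G] [LieGroup 𝓘(ℂ, E) ω G]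
  {F : Type*} [NormedAddCommGroup F] [NormedSpace ℂ F] {H : Type*}
  [TopologicalSpace H] (I : ModelWithCorners ℂ F H) {M : Type*}
  [TopologicalSpace M] [ChartedSpace H M]

/-- A holomorphic right action of a complex Lie group on a complex manifold. -/
structure IsHolomorphicAction (A : M → G → M) : Prop where
  contMDiff : ContMDiff (I.prod 𝓘(ℂ, E)) I ω (fun p : M × G => A p.1 p.2)
  one : ∀ m, A m 1 = m
  mul : ∀ m g h, A (A m g) h = A m (g * h)

/-- The infinitesimal action defined by a right action. -/
def actionField (A : M → G → M) (m : M) : LieAlg E G →ₗ[ℂ] TangentSpace I m where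
  toFun x := mfderiv 𝓘(ℂ, E) I (A m) 1 x
  map_add' x x' := map_add (mfderiv 𝓘(ℂ, E) I (A m) 1) x x'
  map_smul' c x := map_smul (mfderiv 𝓘(ℂ, E) I (A m) 1) c x

variable {I}

omit [CompleteSpace E] in
-- The fields generated by right multiplication are the left invariant ones, so this action carries
-- the definition of the bracket of 𝔤.
theorem isHolomorphicAction_mul : IsHolomorphicAction (E := E) 𝓘(ℂ, E) (fun g h : G => g * h) where
  contMDiff := contMDiff_mul 𝓘(ℂ, E) ω
  one := mul_one
  mul := mul_assoc

variable {A : M → G → M} (hA : IsHolomorphicAction (E := E) I A)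

include hA

omit [CompleteSpace E] [LieGroup 𝓘(ℂ, E) ω G] in
theorem IsHolomorphicAction.contMDiff_right (m : M) : ContMDiff 𝓘(ℂ, E) I ω (A m) :=
  hA.contMDiff.comp (contMDiff_const.prodMk contMDiff_id)

theorem IsHolomorphicAction.derivAlong_eq_diffAt (x : LieAlg E G) {f : M → ℂ} {m : M}
    (hf : MDifferentiableAt I 𝓘(ℂ, ℂ) f m) :
    derivAlong I (fun z => actionField I A z x) f m =
      diffAt 𝓘(ℂ, E) (fun g => f (A m g)) 1 x := by
  have h := diffAt_comp (I := I) (I' := 𝓘(ℂ, E)) (a := A m) (n := 1) (f := f)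
    (by rwa [hA.one]) ((hA.contMDiff_right m).mdifferentiableAt (by simp)) x
  rw [h, hA.one]
  rfl

theorem IsHolomorphicAction.derivAlong_eq_deriv (x : LieAlg E G) {f : M → ℂ} {m : M}
    (hf : MDifferentiableAt I 𝓘(ℂ, ℂ) f m) :
    derivAlong I (fun z => actionField I A z x) f m =
      deriv (fun t => f (A m (curve x t))) 0 := by
  rw [hA.derivAlong_eq_diffAt x hf, deriv_comp_curve (f := fun g => f (A m g))]
  exact MDifferentiableAt.comp (g := f) 1 (by rwa [hA.one])
    ((hA.contMDiff_right m).mdifferentiableAt (by simp))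

/-- The field is the tangent map of the action applied to the zero vector at m and the fixed vector
x at the identity, a composite of holomorphic maps. -/
theorem IsHolomorphicAction.contMDiff_actionField [IsManifold I ω M] (x : LieAlg E G) :
    ContMDiff I I.tangent ω (fun m => (⟨m, actionField I A m x⟩ : TangentBundle I M)) := by
  have : IsManifold I 1 M := IsManifold.of_le (n := ω) (by simp)
  have : IsManifold 𝓘(ℂ, E) 1 G := IsManifold.of_le (n := ω) (by simp)
  let fm : M → TangentBundle I M := fun m => Bundle.TotalSpace.mk' F m 0
  have sfm : ContMDiff I I.tangent ω fm := Bundle.contMDiff_zeroSection _ _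
  let fv : M → TangentBundle 𝓘(ℂ, E) G := fun _ => Bundle.TotalSpace.mk' E 1 x
  have sfv : ContMDiff I 𝓘(ℂ, E).tangent ω fv := contMDiff_const
  have S₁ := sfm.prodMk sfv
  have S₂ : ContMDiff (I.tangent.prod 𝓘(ℂ, E).tangent) (I.prod 𝓘(ℂ, E)).tangent ω
    (equivTangentBundleProd I M 𝓘(ℂ, E) G).symm := contMDiff_equivTangentBundleProd_symm
  have S₃ : ContMDiff (I.prod 𝓘(ℂ, E)).tangent I.tangent ω
      (tangentMap (I.prod 𝓘(ℂ, E)) I fun p : M × G => A p.1 p.2) :=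
    hA.contMDiff.contMDiff_tangentMap (m := ω) (by simp)
  have S := (S₃.comp S₂).comp S₁
  have key : ∀ m, (⟨m, actionField I A m x⟩ : TangentBundle I M) =
      tangentMap (I.prod 𝓘(ℂ, E)) I (fun p : M × G => A p.1 p.2)
        ((equivTangentBundleProd I M 𝓘(ℂ, E) G).symm (fm m, fv m)) := by
    intro m
    have h := mfderiv_prod_eq_add_apply (I := I) (I' := 𝓘(ℂ, E)) (p := ((m, 1) : M × G))
      (v := ((0 : F), (show E from x))) (hA.contMDiff.mdifferentiableAt (by simp))
    refine Bundle.TotalSpace.ext (hA.one m).symm (heq_of_eq (Eq.trans ?_ h.symm))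
    have key : ∀ a b : F, a = 0 → b = a + b := fun a b ha => by rw [ha, zero_add]
    exact key _ _ (map_zero (mfderiv I I (fun z => A z 1) m))
  exact S.congr key

theorem IsHolomorphicAction.derivAlong_derivAlong {B : M → G → M}
    (hB : IsHolomorphicAction (E := E) I B) [IsManifold I ω M]
    (x y : LieAlg E G) {U : Set M} (hU : IsOpen U) {f : M → ℂ} (hf : HolomorphicOn I f U) {m : M}
    (hm : m ∈ U) :
    derivAlong I (fun z => actionField I A z x) (derivAlong I (fun z => actionField I B z y) f) m =
      deriv (fun t => deriv (fun u => f (B (A m (curve x t)) (curve y u))) 0) 0 := by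
  have h := holomorphicOn_derivAlong (hB.contMDiff_actionField y) hU hf
  rw [hA.derivAlong_eq_deriv x (h.mdifferentiableAt hU hm)]
  refine Filter.EventuallyEq.deriv_eq ?_
  have hc : ContinuousAt (fun t => A m (curve x t)) 0 :=
    (hA.contMDiff_right m).continuous.continuousAt.comp (contMDiffAt_curve x).continuousAt
  have hU' : ∀ᶠ z in 𝓝 (A m (curve x 0)), z ∈ U := by
    rw [curve_zero, hA.one]
    exact hU.mem_nhds hm
  filter_upwards [hc.eventually hU'] with t ht
  exact hB.derivAlong_eq_deriv y (hf.mdifferentiableAt hU ht)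

/-- Both sides are iterated derivatives of the same function of two complex variables, so they agree
by symmetry of mixed partial derivatives. -/
theorem IsHolomorphicAction.derivAlong_comm {B : M → G → M}
    (hB : IsHolomorphicAction (E := E) I B) (hAB : ∀ m g h, B (A m g) h = A (B m h) g)
    [IsManifold I ω M] (x y : LieAlg E G) {U : Set M} (hU : IsOpen U) {f : M → ℂ}
    (hf : HolomorphicOn I f U) {m : M} (hm : m ∈ U) :
    derivAlong I (fun z => actionField I A z x) (derivAlong I (fun z => actionField I B z y) f) m =
      derivAlong I (fun z => actionField I B z y)
        (derivAlong I (fun z => actionField I A z x) f) m := by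
  rw [hA.derivAlong_derivAlong hB x y hU hf hm, hB.derivAlong_derivAlong hA y x hU hf hm]
  have hg : ContDiffAt ℂ ω (fun p : ℂ × ℂ => f (B (A m (curve x p.1)) (curve y p.2))) 0 := by
    rw [← contMDiffAt_iff_contDiffAt]
    have h₁ : ContMDiffAt 𝓘(ℂ, ℂ × ℂ) 𝓘(ℂ, E) ω (fun p : ℂ × ℂ => curve x p.1) 0 :=
      ContMDiffAt.comp (g := curve x) (0 : ℂ × ℂ) (contMDiffAt_curve x)
        contDiff_fst.contDiffAt.contMDiffAt
    have h₂ : ContMDiffAt 𝓘(ℂ, ℂ × ℂ) 𝓘(ℂ, E) ω (fun p : ℂ × ℂ => curve y p.2) 0 :=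
      ContMDiffAt.comp (g := curve y) (0 : ℂ × ℂ) (contMDiffAt_curve y)
        contDiff_snd.contDiffAt.contMDiffAt
    have h₃ : ContMDiffAt 𝓘(ℂ, ℂ × ℂ) I ω (fun p : ℂ × ℂ => A m (curve x p.1)) 0 :=
      ContMDiffAt.comp (g := A m) (0 : ℂ × ℂ) (hA.contMDiff_right m).contMDiffAt h₁
    have h₄ : ContMDiffAt 𝓘(ℂ, ℂ × ℂ) I ω
        (fun p : ℂ × ℂ => B (A m (curve x p.1)) (curve y p.2)) 0 :=
      ContMDiffAt.comp (g := fun q : M × G => B q.1 q.2)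
        (f := fun p : ℂ × ℂ => (A m (curve x p.1), curve y p.2)) (0 : ℂ × ℂ)
        hB.contMDiff.contMDiffAt (h₃.prodMk h₂)
    refine ContMDiffAt.comp (g := f) (0 : ℂ × ℂ) (hf.contMDiffAt ?_) h₄
    simp only [Prod.fst_zero, Prod.snd_zero, curve_zero, hA.one, hB.one]
    exact hU.mem_nhds hm
  have h := deriv_deriv_comm hg
  simp only [hAB] at h ⊢
  exact h

/-- By associativity, second derivatives of f along the action at m are those of g ↦ f (m g) along
left invariant fields at the identity. There the commutator is the bracket of 𝔤 by definition. -/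
theorem IsHolomorphicAction.derivAlong_lie [IsManifold I ω M]
    (x y : LieAlg E G) {U : Set M} (hU : IsOpen U) {f : M → ℂ} (hf : HolomorphicOn I f U) {m : M}
    (hm : m ∈ U) :
    derivAlong I (fun z => actionField I A z x) (derivAlong I (fun z => actionField I A z y) f) m -
      derivAlong I (fun z => actionField I A z y)
        (derivAlong I (fun z => actionField I A z x) f) m =
      derivAlong I (fun z => actionField I A z ⁅x, y⁆) f m := by
  have hG := isHolomorphicAction_mul (E := E) (G := G)
  have hU' : IsOpen (A m ⁻¹' U) := hU.preimage (hA.contMDiff_right m).continuous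
  have h1 : (1 : G) ∈ A m ⁻¹' U := by
    rw [Set.mem_preimage, hA.one]
    exact hm
  have hφ : HolomorphicOn 𝓘(ℂ, E) (fun g => f (A m g)) (A m ⁻¹' U) :=
    hf.comp (hA.contMDiff_right m).contMDiffOn fun g hg => hg
  have key : ∀ x y : LieAlg E G,
      derivAlong I (fun z => actionField I A z x)
        (derivAlong I (fun z => actionField I A z y) f) m =
      derivAlong 𝓘(ℂ, E) (fun z => actionField 𝓘(ℂ, E) (fun g h : G => g * h) z x)
        (derivAlong 𝓘(ℂ, E) (fun z => actionField 𝓘(ℂ, E) (fun g h : G => g * h) z y)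
          (fun g => f (A m g))) 1 := by
    intro x y
    rw [hA.derivAlong_derivAlong hA x y hU hf hm, hG.derivAlong_derivAlong hG x y hU' hφ h1]
    simp only [hA.mul, one_mul]
  have hhol := fun x => holomorphicOn_derivAlong (hG.contMDiff_actionField x) hU' hφ
  rw [key x y, key y x, ← diffAt_mlieBracket (hG.contMDiff_actionField x)
    (hG.contMDiff_actionField y) (hφ.contMDiffAt (hU'.mem_nhds h1))
    ((hhol x).mdifferentiableAt hU' h1) ((hhol y).mdifferentiableAt hU' h1),
    hA.derivAlong_eq_diffAt _ (hf.mdifferentiableAt hU hm)]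
  rfl

end Action

/-! ### Local coordinate functions, and functions with zero differential. -/

section ChartFunctions

variable {F : Type*} [NormedAddCommGroup F] [NormedSpace ℂ F] {H : Type*}
  [TopologicalSpace H] {I : ModelWithCorners ℂ F H} {M : Type*}
  [TopologicalSpace M] [ChartedSpace H M] [IsManifold I ω M]

/-- These local functions separate tangent vectors at y, which is how identities of derivations
become identities of vectors. -/
theorem holomorphicOn_comp_extChartAt (ξ : F →L[ℂ] ℂ) (y : M) :
    HolomorphicOn I (fun z => ξ (extChartAt I y z)) (extChartAt I y).source := by
  have h : ContMDiffOn I 𝓘(ℂ, F) ω (extChartAt I y) (extChartAt I y).source := by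
    rw [extChartAt_source]
    exact contMDiffOn_extChartAt
  exact ξ.contDiff.contMDiff.comp_contMDiffOn h

theorem diffAt_comp_extChartAt (ξ : F →L[ℂ] ℂ) (y : M) (v : TangentSpace I y) :
    diffAt I (fun z => ξ (extChartAt I y z)) y v = ξ v := by
  have : IsManifold I 1 M := IsManifold.of_le (n := ω) (by simp)
  have h : HasMFDerivAt I 𝓘(ℂ, F) (extChartAt I y) y (ContinuousLinearMap.id ℂ F) := by
    have := (mdifferentiableAt_extChartAt (I := I) (mem_chart_source H y)).hasMFDerivAt
    rwa [mfderiv_extChartAt_self] at this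
  have h' := (ξ.hasFDerivAt (x := extChartAt I y y)).hasMFDerivAt.comp y h
  exact congrArg (fun T : F →L[ℂ] ℂ => T v) h'.mfderiv

/-- A morphism of Lie algebras into derivations of the sheaf of holomorphic functions which is
given by holomorphic vector fields is a morphism into the Lie algebra of vector fields. -/
theorem IsDerivationAction.isLieAction [CompleteSpace F] [I.Boundaryless] {L : Type*} [LieRing L]
    [LieAlgebra ℂ L] {ρ : ∀ y : M, L →ₗ[ℂ] TangentSpace I y} (hρ : IsDerivationAction I ρ)
    (hρ' : ∀ x : L, ContMDiff I I.tangent ω (fun y => (⟨y, ρ y x⟩ : TangentBundle I M))) :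
    IsLieAction I ρ where
  holomorphic := hρ'
  map_lie x x' y := by
    have key : ∀ v w : F, (∀ ξ : F →L[ℂ] ℂ, ξ v = ξ w) → v = w := fun v w h =>
      (SeparatingDual.eq_iff_forall_dual_eq (R := ℂ)).2 h
    refine key _ _ fun ξ => ?_
    have hU : IsOpen (extChartAt I y).source := isOpen_extChartAt_source y
    have hy := mem_extChartAt_source (I := I) y
    have hf := holomorphicOn_comp_extChartAt (I := I) ξ y
    rw [← diffAt_comp_extChartAt ξ y, ← diffAt_comp_extChartAt ξ y,
      diffAt_mlieBracket (hρ' x) (hρ' x') (hf.contMDiffAt (hU.mem_nhds hy))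
        ((hρ.holomorphicOn x _ _ hU hf).mdifferentiableAt hU hy)
        ((hρ.holomorphicOn x' _ _ hU hf).mdifferentiableAt hU hy), hρ.lie x x' _ _ hU hf y hy]
    rfl

theorem isLocallyConstant_of_mfderiv_eq_zero [I.Boundaryless] {f : M → ℂ}
    (hf : MDifferentiable I 𝓘(ℂ, ℂ) f) (hf' : ∀ y v, diffAt I f y v = 0) :
    IsLocallyConstant f := by
  have : IsManifold I 1 M := IsManifold.of_le (n := ω) (by simp)
  rw [IsLocallyConstant.iff_eventually_eq]
  intro y
  have hder : ∀ x ∈ (extChartAt I y).target,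
      HasFDerivAt (f ∘ (extChartAt I y).symm) (0 : F →L[ℂ] ℂ) x := by
    intro x hx
    have hφ := mdifferentiableWithinAt_extChartAt_symm hx
    rw [I.range_eq_univ, mdifferentiableWithinAt_univ] at hφ
    have h := (hf ((extChartAt I y).symm x)).hasMFDerivAt.comp x hφ.hasMFDerivAt
    have key : ∀ T : F →L[ℂ] ℂ,
        HasMFDerivAt 𝓘(ℂ, F) 𝓘(ℂ, ℂ) (f ∘ (extChartAt I y).symm) x T → (∀ v, T v = 0) →
        HasFDerivAt (f ∘ (extChartAt I y).symm) (0 : F →L[ℂ] ℂ) x := by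
      intro T hT hT0
      obtain rfl : T = 0 := ContinuousLinearMap.ext hT0
      exact hasMFDerivAt_iff_hasFDerivAt.1 hT
    exact key _ h fun v => hf' _ _
  obtain ⟨ε, hε, hball⟩ := Metric.mem_nhds_iff.1 (extChartAt_target_mem_nhds (I := I) y)
  have hconst : ∀ x ∈ Metric.ball (extChartAt I y y) ε,
      f ((extChartAt I y).symm x) = f ((extChartAt I y).symm (extChartAt I y y)) := by
    intro x hx
    exact Metric.isOpen_ball.is_const_of_fderiv_eq_zero
      (convex_ball _ _).isPreconnected
      (fun z hz => (hder z (hball hz)).differentiableAt.differentiableWithinAt)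
      (fun z hz => (hder z (hball hz)).fderiv) hx (Metric.mem_ball_self hε)
  filter_upwards [(continuousAt_extChartAt (I := I) y).preimage_mem_nhds
    (Metric.ball_mem_nhds _ hε), extChartAt_source_mem_nhds (I := I) y] with z hz hz'
  have := hconst _ hz
  rwa [(extChartAt I y).left_inv hz', extChartAt_to_inv] at this

end ChartFunctions

/-! ### Families of commuting actions. -/

section Family

variable {E : Type*} [NormedAddCommGroup E] [NormedSpace ℂ E] [CompleteSpace E]
  {G : Type*} [TopologicalSpace G] [ChartedSpace E G] [Group G] [LieGroup 𝓘(ℂ, E) ω G]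
  {F : Type*} [NormedAddCommGroup F] [NormedSpace ℂ F] {H : Type*}
  [TopologicalSpace H] {I : ModelWithCorners ℂ F H} {M : Type*}
  [TopologicalSpace M] [ChartedSpace H M] {ι : Type*} [Fintype ι]

variable (I) in
/-- The infinitesimal action of `𝔤 ^ ι` defined by a family of right actions of `G`. -/
def familyField (A : ι → M → G → M) (m : M) : (ι → LieAlg E G) →ₗ[ℂ] TangentSpace I m :=
  ∑ α, actionField I (A α) m ∘ₗ LinearMap.proj α

theorem familyField_apply (A : ι → M → G → M) (m : M) (x : ι → LieAlg E G) :
    familyField I A m x = ∑ α, actionField I (A α) m (x α) := by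
  simp [familyField]

theorem derivAlong_familyField (A : ι → M → G → M) (x : ι → LieAlg E G) (f : M → ℂ) :
    derivAlong I (fun z => familyField I A z x) f =
      fun m => ∑ α, derivAlong I (fun z => actionField I (A α) z (x α)) f m := by
  funext m
  simp only [derivAlong, familyField_apply, map_sum]

variable {A : ι → M → G → M} (hA : ∀ α, IsHolomorphicAction (E := E) I (A α))

include hA in
theorem contMDiff_familyField [IsManifold I ω M] (x : ι → LieAlg E G) :
    ContMDiff I I.tangent ω (fun m => (⟨m, familyField I A m x⟩ : TangentBundle I M)) := by
  have : IsManifold I 1 M := IsManifold.of_le (n := ω) (by simp)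
  simp only [familyField_apply]
  exact ContMDiff.sum_section (s := Finset.univ) (V := fun m : M => TangentSpace I m)
    (t := fun α m => actionField I (A α) m (x α))
    fun α _ => (hA α).contMDiff_actionField (x α)

include hA in
-- In the commutator of two sums of fields, the cross terms vanish because the actions commute, and
-- the diagonal terms give the componentwise bracket.
theorem isDerivationAction_familyField [IsManifold I ω M]
    (hcomm : ∀ α β, α ≠ β → ∀ m g h, A β (A α m g) h = A α (A β m h) g) :
    IsDerivationAction I (familyField (E := E) I A) where
  holomorphicOn x U f hU hf := holomorphicOn_derivAlong (contMDiff_familyField hA x) hU hf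
  lie x x' U f hU hf y hy := by
    have hmd : ∀ (x : ι → LieAlg E G) (α : ι), MDifferentiableAt I 𝓘(ℂ, ℂ)
        (derivAlong I (fun z => actionField I (A α) z (x α)) f) y := fun x α =>
      (holomorphicOn_derivAlong ((hA α).contMDiff_actionField (x α)) hU hf).mdifferentiableAt hU hy
    have hexp : ∀ x x' : ι → LieAlg E G,
        derivAlong I (fun z => familyField I A z x)
          (derivAlong I (fun z => familyField I A z x') f) y =
        ∑ β, ∑ α, derivAlong I (fun z => actionField I (A α) z (x α))
          (derivAlong I (fun z => actionField I (A β) z (x' β)) f) y := by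
      intro x x'
      rw [derivAlong_familyField A x' f, derivAlong, diffAt_sum _ (hmd x')]
      refine Finset.sum_congr rfl fun β _ => ?_
      exact congrFun (derivAlong_familyField A x _) y
    rw [hexp, hexp, Finset.sum_comm (f := fun β α =>
      derivAlong I (fun z => actionField I (A α) z (x' α))
          (derivAlong I (fun z => actionField I (A β) z (x β)) f) y), ← Finset.sum_sub_distrib,
      derivAlong_familyField]
    refine Finset.sum_congr rfl fun β _ => ?_
    rw [← Finset.sum_sub_distrib, Finset.sum_eq_single β]
    · exact (hA β).derivAlong_lie (x β) (x' β) hU hf hy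
    · intro α _ hα
      rw [(hA α).derivAlong_comm (hA β) (hcomm α β hα) _ _ hU hf hy, sub_self]
    · simp

end Family

/-! ### Diagonal combinations of two actions. -/

section Diagonal

variable {E : Type*} [NormedAddCommGroup E] [NormedSpace ℂ E] [CompleteSpace E]
  {G : Type*} [TopologicalSpace G] [ChartedSpace E G] [Group G] [LieGroup 𝓘(ℂ, E) ω G]
  {F : Type*} [NormedAddCommGroup F] [NormedSpace ℂ F] {H : Type*}
  [TopologicalSpace H] {I : ModelWithCorners ℂ F H} {M : Type*}
  [TopologicalSpace M] [ChartedSpace H M]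

omit [CompleteSpace E] [Group G] [LieGroup 𝓘(ℂ, E) ω G] in
theorem mfderiv_apply_congr {f f' : G → M} {g g' : G} (hf : f = f') (hg : g = g') (v : E) :
    (show F from mfderiv 𝓘(ℂ, E) I f g v) = mfderiv 𝓘(ℂ, E) I f' g' v := by
  subst hf hg
  rfl

/-- The derivative of a map of two variables along the diagonal is the sum of its partial
derivatives. The actions need not commute. -/
theorem actionField_diagonal {A B : M → G → M} (hA : IsHolomorphicAction (E := E) I A)
    (hB : IsHolomorphicAction (E := E) I B) (m : M) (x : LieAlg E G) :
    actionField I (fun m g => B (A m g) g) m x = actionField I A m x + actionField I B m x := by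
  have hf : ContMDiff (𝓘(ℂ, E).prod 𝓘(ℂ, E)) I ω (fun p : G × G => B (A m p.1) p.2) :=
    hB.contMDiff.comp (((hA.contMDiff_right m).comp contMDiff_fst).prodMk contMDiff_snd)
  have hd : HasMFDerivAt 𝓘(ℂ, E) (𝓘(ℂ, E).prod 𝓘(ℂ, E)) (fun g : G => (g, g)) 1
      ((ContinuousLinearMap.id ℂ E).prod (ContinuousLinearMap.id ℂ E)) :=
    (hasMFDerivAt_id (1 : G)).prodMk (hasMFDerivAt_id (1 : G))
  have h := (hf.mdifferentiableAt (x := ((1 : G), (1 : G))) (by simp)).hasMFDerivAt.comp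
    (f := fun g : G => (g, g)) (1 : G) hd
  have h₂ := mfderiv_prod_eq_add_apply (I := 𝓘(ℂ, E)) (I' := 𝓘(ℂ, E)) (p := ((1 : G), (1 : G)))
      (v := ((show E from x), (show E from x))) (hf.mdifferentiableAt (by simp))
  refine (congrArg (fun T : E →L[ℂ] F => T x) h.mfderiv).trans (h₂.trans ?_)
  exact congrArg₂ (fun a b : F => a + b)
    (mfderiv_apply_congr (funext fun z => hB.one _) rfl _)
    (mfderiv_apply_congr (funext fun z => by rw [hA.one]) rfl _)

end Diagonal

/-! ### The adjoint action. -/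

section Adjoint

variable {E : Type*} [NormedAddCommGroup E] [NormedSpace ℂ E]
  {G : Type*} [TopologicalSpace G] [ChartedSpace E G] [Group G] [CompleteSpace E]
  [LieGroup 𝓘(ℂ, E) ω G]

/-- The derivative at the identity of `h ↦ g⁻¹ h⁻¹ g`. -/
def conjInv (g : G) : LieAlg E G →ₗ[ℂ] LieAlg E G where
  toFun x := mfderiv 𝓘(ℂ, E) 𝓘(ℂ, E) (fun h : G => g⁻¹ * (h⁻¹ * g)) 1 x
  map_add' x x' := map_add (mfderiv 𝓘(ℂ, E) 𝓘(ℂ, E) (fun h : G => g⁻¹ * (h⁻¹ * g)) 1) x x'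
  map_smul' c x := map_smul (mfderiv 𝓘(ℂ, E) 𝓘(ℂ, E) (fun h : G => g⁻¹ * (h⁻¹ * g)) 1) c x

omit [CompleteSpace E] in
theorem isHolomorphicAction_inv_mul :
    IsHolomorphicAction (E := E) 𝓘(ℂ, E) (fun m g : G => g⁻¹ * m) where
  contMDiff := (contMDiff_snd.inv).mul contMDiff_fst
  one m := by simp
  mul m g h := by simp [mul_assoc]

omit [CompleteSpace E] in
theorem mdifferentiableAt_conjInv (g h : G) :
    MDifferentiableAt 𝓘(ℂ, E) 𝓘(ℂ, E) (fun h : G => g⁻¹ * (h⁻¹ * g)) h := by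
  have : ContMDiff 𝓘(ℂ, E) 𝓘(ℂ, E) ω (fun h : G => g⁻¹ * (h⁻¹ * g)) :=
    contMDiff_const.mul (contMDiff_id.inv.mul contMDiff_const)
  exact this.mdifferentiableAt (by simp)

/-- This is the derivative at h = 1 of h⁻¹ g = g (g⁻¹ h⁻¹ g). -/
theorem actionField_inv_mul (g : G) (x : LieAlg E G) :
    actionField 𝓘(ℂ, E) (fun m g : G => g⁻¹ * m) g x =
      actionField 𝓘(ℂ, E) (fun m g : G => m * g) g (conjInv g x) := by
  have h := mfderiv_comp_of_eq (I := 𝓘(ℂ, E)) (I' := 𝓘(ℂ, E)) (I'' := 𝓘(ℂ, E)) (x := (1 : G))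
    (y := (1 : G)) (g := fun k : G => g * k) (f := fun h : G => g⁻¹ * (h⁻¹ * g))
    (((isHolomorphicAction_mul (E := E)).contMDiff_right g).mdifferentiableAt (by simp))
    (mdifferentiableAt_conjInv g 1) (by simp)
  have h' : (fun k : G => g * k) ∘ (fun h : G => g⁻¹ * (h⁻¹ * g)) = fun h => h⁻¹ * g := by
    funext h
    simp
  rw [h'] at h
  exact (congrArg (fun T : E →L[ℂ] E => T x) h).trans
    (mfderiv_apply_congr rfl (by simp) _)

/-- At the identity, g ↦ g⁻¹ · 1 · g is constant, so the fields of right multiplication and of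
inverse left multiplication add up to zero there. -/
theorem conjInv_one (x : LieAlg E G) : conjInv (1 : G) x = -x := by
  have h := actionField_diagonal (E := E) (G := G) isHolomorphicAction_mul
    isHolomorphicAction_inv_mul 1 x
  have h0 : actionField 𝓘(ℂ, E) (fun m g : G => g⁻¹ * (m * g)) 1 x = 0 := by
    have hc : (fun g : G => g⁻¹ * (1 * g)) = fun _ => 1 := by
      funext g
      simp
    have := mfderiv_const (I := 𝓘(ℂ, E)) (I' := 𝓘(ℂ, E)) (x := (1 : G)) (c := (1 : G))
    rw [← hc] at this
    exact congrArg (fun T : E →L[ℂ] E => T x) this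
  have h1 : ∀ x : LieAlg E G, actionField 𝓘(ℂ, E) (fun m g : G => m * g) 1 x = x := by
    intro x
    have hc : (fun g : G => 1 * g) = id := by
      funext g
      simp
    have := mfderiv_id (I := 𝓘(ℂ, E)) (x := (1 : G))
    rw [← hc] at this
    exact congrArg (fun T : E →L[ℂ] E => T x) this
  rw [h0, actionField_inv_mul, h1, h1] at h
  exact (neg_eq_of_add_eq_zero_right h.symm).symm

/-- The derivative along the adjoint action. -/
theorem conjInv_derivative (ξ : E →L[ℂ] ℂ) (x : LieAlg E G) :
    ContMDiff 𝓘(ℂ, E) 𝓘(ℂ, ℂ) ω (fun g : G => ξ (show E from conjInv g x)) ∧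
    ∀ (z : LieAlg E G) (g : G),
      derivAlong 𝓘(ℂ, E) (fun m => actionField 𝓘(ℂ, E) (fun m g : G => g⁻¹ * m) m z)
        (fun g : G => ξ (show E from conjInv g x)) g = ξ (show E from conjInv g ⁅z, x⁆) := by
  let J := 𝓘(ℂ, E).prod 𝓘(ℂ, E)
  -- Doubling the variable avoids differentiating a family of derivatives: in g⁻¹ h⁻¹ g the two
  -- occurrences of g become independent, and g ↦ `conjInv g x` becomes the restriction to the
  -- diagonal of a derivative along B.
  let A : G × G → G → G × G := fun m c => (c⁻¹ * m.1, m.2)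
  let B : G × G → G → G × G := fun m c => (m.1, c⁻¹ * m.2)
  have p₁ : ContMDiff (J.prod 𝓘(ℂ, E)) 𝓘(ℂ, E) ω (fun p : (G × G) × G => p.1.1) :=
    ContMDiff.comp (I' := J) contMDiff_fst contMDiff_fst
  have p₂ : ContMDiff (J.prod 𝓘(ℂ, E)) 𝓘(ℂ, E) ω (fun p : (G × G) × G => p.1.2) :=
    ContMDiff.comp (I' := J) contMDiff_snd contMDiff_fst
  have p₃ : ContMDiff (J.prod 𝓘(ℂ, E)) 𝓘(ℂ, E) ω (fun p : (G × G) × G => p.2⁻¹) :=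
    contMDiff_snd.inv
  have hA : IsHolomorphicAction (E := E) J A :=
    { contMDiff := (p₃.mul p₁).prodMk p₂
      one := fun m => by simp [A]
      mul := fun m g h => by simp [A, mul_assoc] }
  have hB : IsHolomorphicAction (E := E) J B :=
    { contMDiff := p₁.prodMk (p₃.mul p₂)
      one := fun m => by simp [B]
      mul := fun m g h => by simp [B, mul_assoc] }
  have hC : IsHolomorphicAction (E := E) J (fun m c => B (A m c) c) :=
    { contMDiff := (p₃.mul p₁).prodMk (p₃.mul p₂)
      one := fun m => by simp [A, B]
      mul := fun m g h => by simp [A, B, mul_assoc] }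
  let φ : G → ℂ := fun k => ξ (extChartAt 𝓘(ℂ, E) (1 : G) k)
  have hφ : HolomorphicOn 𝓘(ℂ, E) φ (extChartAt 𝓘(ℂ, E) (1 : G)).source :=
    holomorphicOn_comp_extChartAt ξ 1
  have hO : IsOpen (extChartAt 𝓘(ℂ, E) (1 : G)).source := isOpen_extChartAt_source 1
  let q : G × G → G := fun p => p.1⁻¹ * p.2
  have hq : ContMDiff J 𝓘(ℂ, E) ω q := contMDiff_fst.inv.mul contMDiff_snd
  let U : Set (G × G) := q ⁻¹' (extChartAt 𝓘(ℂ, E) (1 : G)).source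
  have hU : IsOpen U := hO.preimage hq.continuous
  let ψ : G × G → ℂ := fun p => φ (q p)
  have hψ : HolomorphicOn J ψ U := hφ.comp hq.contMDiffOn fun p hp => hp
  have hdU : ∀ g : G, (g, g) ∈ U := fun g => by
    change q (g, g) ∈ (extChartAt 𝓘(ℂ, E) (1 : G)).source
    simp only [q, inv_mul_cancel]
    exact mem_extChartAt_source (1 : G)
  have hdiag : ContMDiff 𝓘(ℂ, E) J ω (fun g : G => (g, g)) := contMDiff_id.prodMk contMDiff_id
  have hΨ := fun x => holomorphicOn_derivAlong (hB.contMDiff_actionField x) hU hψ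
  have hκ : ∀ x : LieAlg E G, (fun g : G => ξ (show E from conjInv g x)) =
      fun g => derivAlong J (fun m => actionField J B m x) ψ (g, g) := by
    intro x
    funext g
    rw [hB.derivAlong_eq_diffAt x (hψ.mdifferentiableAt hU (hdU g))]
    have hd : MDifferentiableAt 𝓘(ℂ, E) 𝓘(ℂ, ℂ) φ 1 :=
      hφ.mdifferentiableAt hO (mem_extChartAt_source (1 : G))
    have h := diffAt_comp (I := 𝓘(ℂ, E)) (I' := 𝓘(ℂ, E)) (f := φ)
      (a := fun h : G => g⁻¹ * (h⁻¹ * g)) (n := 1) (by simpa using hd)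
      (mdifferentiableAt_conjInv g 1) x
    have h1 : g⁻¹ * ((1 : G)⁻¹ * g) = 1 := by simp
    rw [h1] at h
    exact (h.trans (diffAt_comp_extChartAt (I := 𝓘(ℂ, E)) ξ (1 : G) _)).symm
  refine ⟨?_, fun z g => ?_⟩
  · rw [hκ]
    intro g
    exact ((hΨ x).contMDiffAt (hU.mem_nhds (hdU g))).comp (f := fun g : G => (g, g)) g hdiag.contMDiffAt
  · have hsum : ∀ (z : LieAlg E G) (f : G × G → ℂ),
        derivAlong J (fun m => actionField J (fun m c => B (A m c) c) m z) f =
        fun m => derivAlong J (fun m => actionField J A m z) f m +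
          derivAlong J (fun m => actionField J B m z) f m := by
      intro z f
      funext m
      simp only [derivAlong, actionField_diagonal hA hB, map_add]
    -- The function ψ depends only on p.1⁻¹ * p.2, which is unchanged by the simultaneous action, so
    -- its derivatives along A and B are opposite.
    have hzero : ∀ m ∈ U, derivAlong J (fun m => actionField J A m z) ψ m =
        -derivAlong J (fun m => actionField J B m z) ψ m := by
      intro m hm
      have h := congrFun (hsum z ψ) m
      rw [hC.derivAlong_eq_deriv z (hψ.mdifferentiableAt hU hm)] at h
      have h' : (fun t => ψ (B (A m (curve z t)) (curve z t))) = fun _ => ψ m := by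
        funext t
        simp [ψ, q, A, B]
      rw [h', deriv_const] at h
      exact eq_neg_of_add_eq_zero_left h.symm
    have hm := hdU g
    rw [hκ]
    refine Eq.trans ?_ (congrFun (hκ ⁅z, x⁆) g).symm
    have hmd := (hΨ x).mdifferentiableAt hU hm
    have hcomp := isHolomorphicAction_inv_mul.derivAlong_eq_deriv z
      (f := fun g : G => derivAlong J (fun m => actionField J B m x) ψ (g, g)) (m := g)
      (MDifferentiableAt.comp (g := derivAlong J (fun m => actionField J B m x) ψ) g hmd
        (hdiag.mdifferentiableAt (by simp)))
    rw [hcomp]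
    have hcomp' := hC.derivAlong_eq_deriv z hmd
    refine (hcomp'.symm.trans (congrFun (hsum z _) (g, g))).trans ?_
    -- Writing A and B also for the derivations: (A_z + B_z) B_x ψ = B_x A_z ψ + B_z B_x ψ = -B_x
    -- B_z ψ + B_z B_x ψ, which is the derivative of ψ along the B-field of [z, x].
    have hAB : ∀ m g h, B (A m g) h = A (B m h) g := fun m g h => rfl
    rw [hA.derivAlong_comm hB hAB z x hU hψ hm, ← hB.derivAlong_lie z x hU hψ hm]
    have hneg : derivAlong J (fun m => actionField J B m x)
        (derivAlong J (fun m => actionField J A m z) ψ) (g, g) =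
        -derivAlong J (fun m => actionField J B m x)
        (derivAlong J (fun m => actionField J B m z) ψ) (g, g) := by
      have hev : derivAlong J (fun m => actionField J A m z) ψ =ᶠ[𝓝 (g, g)]
          fun m => -derivAlong J (fun m => actionField J B m z) ψ m :=
        Filter.eventually_of_mem (hU.mem_nhds hm) hzero
      have h1 : MDifferentiableAt J 𝓘(ℂ, ℂ) (derivAlong J (fun m => actionField J A m z) ψ) (g, g) :=
        (holomorphicOn_derivAlong (hA.contMDiff_actionField z) hU hψ).mdifferentiableAt hU hm
      rw [hB.derivAlong_eq_deriv x h1, hB.derivAlong_eq_deriv x ((hΨ z).mdifferentiableAt hU hm),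
        ← deriv.fun_neg]
      refine Filter.EventuallyEq.deriv_eq ?_
      have hc : Filter.Tendsto (fun t => B (g, g) (curve x t)) (𝓝 0) (𝓝 (g, g)) := by
        have hc : ContinuousAt (fun t => B (g, g) (curve x t)) 0 :=
          (hB.contMDiff_right (g, g)).continuous.continuousAt.comp
            (contMDiffAt_curve x).continuousAt
        have := hc.tendsto
        rwa [curve_zero, hB.one] at this
      exact hc.eventually hev
    rw [hneg]
    ring

/-- The map h ↦ g h⁻¹ is a right inverse of k ↦ k⁻¹ g and sends g to 1, so its derivative gives
preimages. -/
theorem actionField_inv_mul_surjective (g : G) :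
    Function.Surjective (actionField (E := E) 𝓘(ℂ, E) (fun m g : G => g⁻¹ * m) g) := by
  have h := mfderiv_comp_of_eq (I := 𝓘(ℂ, E)) (I' := 𝓘(ℂ, E)) (I'' := 𝓘(ℂ, E)) (x := g)
    (y := (1 : G)) (g := fun k : G => k⁻¹ * g) (f := fun h : G => g * h⁻¹)
    (((isHolomorphicAction_inv_mul (E := E)).contMDiff_right g).mdifferentiableAt (by simp))
    (((contMDiff_const.mul contMDiff_id.inv :
      ContMDiff 𝓘(ℂ, E) 𝓘(ℂ, E) ω (fun h : G => g * h⁻¹))).mdifferentiableAt (by simp)) (by simp)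
  have h' : (fun k : G => k⁻¹ * g) ∘ (fun h : G => g * h⁻¹) = id := by
    funext h
    simp
  rw [h', mfderiv_id] at h
  intro v
  exact ⟨mfderiv 𝓘(ℂ, E) 𝓘(ℂ, E) (fun h : G => g * h⁻¹) g v,
    ((congrArg (fun T : E →L[ℂ] E => T v) h).trans
      (mfderiv_apply_congr rfl (by simp) _)).symm⟩

end Adjoint

/-! ### Invariant tensors under the adjoint group. -/

section Invariance

variable {E : Type*} [NormedAddCommGroup E] [NormedSpace ℂ E] [CompleteSpace E]
  [FiniteDimensional ℂ E] {G : Type*} [TopologicalSpace G] [ChartedSpace E G] [Group G]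
  [LieGroup 𝓘(ℂ, E) ω G] [ConnectedSpace G]

theorem tensor_ext {L : Type*} [AddCommGroup L] [Module ℂ L] [Module.Finite ℂ L]
    {t t' : L ⊗[ℂ] L} (h : ∀ ξ η : Module.Dual ℂ L,
      LinearMap.mul' ℂ ℂ (TensorProduct.map ξ η t) = LinearMap.mul' ℂ ℂ (TensorProduct.map ξ η t')) :
    t = t' := by
  let b := Module.finBasis ℂ L
  refine (b.tensorProduct b).ext_elem fun ⟨i, j⟩ => ?_
  have key : ∀ t : L ⊗[ℂ] L, (b.tensorProduct b).repr t (i, j) =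
      LinearMap.mul' ℂ ℂ (TensorProduct.map (b.coord i) (b.coord j) t) := by
    intro t
    induction t with
    | zero => simp
    | tmul x y => simp [mul_comm]
    | add t t' ht ht' => simp only [map_add, Finsupp.add_apply, ht, ht']
  rw [key, key, h]

/-- An invariant tensor is fixed by the adjoint action of the connected group. -/
theorem map_conjInv_of_invariant {s : LieAlg E G ⊗[ℂ] LieAlg E G}
    (hs : ∀ x, adTensor x s = 0) (g : G) :
    TensorProduct.map (conjInv (E := E) g) (conjInv g) s = s := by
  have : Module.Finite ℂ (LieAlg E G) := inferInstanceAs (Module.Finite ℂ E)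
  obtain ⟨A, rfl⟩ := exists_sum_tmul s
  refine tensor_ext fun ξ η => ?_
  let ξ' : E →L[ℂ] ℂ := LinearMap.toContinuousLinearMap (ξ : E →ₗ[ℂ] ℂ)
  let η' : E →L[ℂ] ℂ := LinearMap.toContinuousLinearMap (η : E →ₗ[ℂ] ℂ)
  have hξ : ∀ x, ContMDiff 𝓘(ℂ, E) 𝓘(ℂ, ℂ) ω (fun g : G => ξ (conjInv g x)) ∧
    ∀ (z : LieAlg E G) (g : G),
      derivAlong 𝓘(ℂ, E) (fun m => actionField 𝓘(ℂ, E) (fun m g : G => g⁻¹ * m) m z)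
        (fun g : G => ξ (conjInv g x)) g = ξ (conjInv g ⁅z, x⁆) := conjInv_derivative ξ'
  have hη : ∀ x, ContMDiff 𝓘(ℂ, E) 𝓘(ℂ, ℂ) ω (fun g : G => η (conjInv g x)) ∧
    ∀ (z : LieAlg E G) (g : G),
      derivAlong 𝓘(ℂ, E) (fun m => actionField 𝓘(ℂ, E) (fun m g : G => g⁻¹ * m) m z)
        (fun g : G => η (conjInv g x)) g = η (conjInv g ⁅z, x⁆) := conjInv_derivative η'
  let f : G → ℂ := fun g => ∑ i ∈ A, ξ (conjInv g i.1) * η (conjInv g i.2)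
  have hfA : ∀ g, f g = LinearMap.mul' ℂ ℂ (TensorProduct.map ξ η
      (TensorProduct.map (conjInv (E := E) g) (conjInv g) (∑ i ∈ A, i.1 ⊗ₜ[ℂ] i.2))) := by
    intro g
    simp [f]
  have hf : ContMDiff 𝓘(ℂ, E) 𝓘(ℂ, ℂ) ω f :=
    contMDiff_finsetSum fun i _ => (hξ i.1).1.mul (hη i.2).1
  -- Every tangent vector at g is the value of a field as in `conjInv_derivative`, and along it the
  -- derivative of f is f formed with ad_z s, which is 0.
  have hd : ∀ (g : G) v, diffAt 𝓘(ℂ, E) f g v = 0 := by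
    intro g v
    obtain ⟨z, rfl⟩ := actionField_inv_mul_surjective (E := E) g v
    have hs' := congrArg (fun t => LinearMap.mul' ℂ ℂ (TensorProduct.map (ξ ∘ₗ conjInv g)
      (η ∘ₗ conjInv g) t)) (hs z)
    rw [map_sum] at hs'
    simp only [adTensor, LinearMap.add_apply, TensorProduct.map_tmul, LieAlgebra.ad_apply,
      LinearMap.id_apply, map_sum, map_add, map_zero, LinearMap.comp_apply,
      LinearMap.mul'_apply] at hs'
    rw [← hs', diffAt_sum_mul A (fun i => (hξ i.1).1.mdifferentiableAt (by simp))
      (fun i => (hη i.2).1.mdifferentiableAt (by simp))]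
    refine Finset.sum_congr rfl fun i _ => ?_
    have h1 := (hξ i.1).2 z g
    have h2 := (hη i.2).2 z g
    simp only [derivAlong] at h1 h2
    rw [h1, h2]
  have hlc := isLocallyConstant_of_mfderiv_eq_zero (I := 𝓘(ℂ, E)) (hf.mdifferentiable (by simp)) hd
  -- Connectedness of G enters here. The value at 1 is the right one because `conjInv 1` is -1 and a
  -- tensor of degree two does not see the sign.
  have h1 : f g = f 1 := hlc.apply_eq_of_preconnectedSpace g 1
  rw [← hfA, h1]
  simp [f, conjInv_one]

end Invariance

/-! ### The half edge action. -/

section EdgeAction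

variable {E : Type*} [NormedAddCommGroup E] [NormedSpace ℂ E] [CompleteSpace E]
  {G : Type*} [TopologicalSpace G] [ChartedSpace E G] [Group G] [LieGroup 𝓘(ℂ, E) ω G]
  {Edge : Type*} [Fintype Edge]

omit [Fintype Edge] [TopologicalSpace G] in
open Classical in
/-- The action of `G` on `G ^ Γ₁` by the half edge `α`. -/
def edgeAction (α : Edge × Bool) (m : Edge → G) (h : G) : Edge → G :=
  Function.update m α.1 (if α.2 then m α.1 * h else h⁻¹ * m α.1)

omit [CompleteSpace E] in
theorem isHolomorphicAction_edgeAction (α : Edge × Bool) :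
    IsHolomorphicAction (E := E) (powModel E Edge) (edgeAction (G := G) α) where
  contMDiff := by
    classical
    refine contMDiff_pow_iff.2 fun e => ?_
    have hp : ∀ e : Edge, ContMDiff ((powModel E Edge).prod 𝓘(ℂ, E)) 𝓘(ℂ, E) ω
        (fun p : (Edge → G) × G => p.1 e) := fun e => (contMDiff_apply e).comp contMDiff_fst
    by_cases he : e = α.1
    · subst he
      simp only [edgeAction, Function.update_self]
      split_ifs
      · exact (hp _).mul contMDiff_snd
      · exact contMDiff_snd.inv.mul (hp _)
    · refine (hp e).congr fun p => ?_
      simp only [edgeAction, Function.update_of_ne he]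
  one m := by simp [edgeAction]
  mul m g h := by
    unfold edgeAction
    split_ifs <;> simp [mul_assoc]

omit [TopologicalSpace G] [Fintype Edge] in
-- The two half edges of one edge act by left and right multiplication; half edges of different
-- edges act on different coordinates.
theorem edgeAction_comm {α β : Edge × Bool} (hαβ : α ≠ β) (m : Edge → G) (g h : G) :
    edgeAction β (edgeAction α m g) h = edgeAction α (edgeAction β m h) g := by
  classical
  obtain ⟨e, a⟩ := α
  obtain ⟨e', b⟩ := β
  by_cases he : e = e'
  · subst he
    unfold edgeAction
    cases a <;> cases b <;> simp_all [mul_assoc]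
  · unfold edgeAction
    simp only [Function.update_of_ne he, Function.update_of_ne (Ne.symm he)]
    exact Function.update_comm he _ _ _

open Classical in
omit [CompleteSpace E] [Group G] [LieGroup 𝓘(ℂ, E) ω G] in
theorem contMDiff_update (m : Edge → G) (e : Edge) :
    ContMDiff 𝓘(ℂ, E) (powModel E Edge) ω (fun k => Function.update m e k) := by
  refine contMDiff_pow_iff.2 fun e' => ?_
  by_cases he : e' = e
  · subst he
    refine contMDiff_id.congr fun k => ?_
    simp
  · simp only [Function.update_of_ne he]
    exact contMDiff_const

theorem actionField_edgeAction (m : Edge → G) (e : Edge) (x : LieAlg E G) :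
    actionField (powModel E Edge) (edgeAction (e, false)) m x =
      actionField (powModel E Edge) (edgeAction (e, true)) m (conjInv (m e) x) := by
  classical
  have hu := contMDiff_update (E := E) m e
  have h₁ := mfderiv_comp_of_eq (I := 𝓘(ℂ, E)) (I' := 𝓘(ℂ, E)) (I'' := powModel E Edge)
    (x := (1 : G)) (y := m e) (g := fun k : G => Function.update m e k)
    (f := fun h : G => h⁻¹ * m e) (hu.mdifferentiableAt (by simp))
    (((isHolomorphicAction_inv_mul (E := E)).contMDiff_right (m e)).mdifferentiableAt (by simp))
    (by simp)
  have h₂ := mfderiv_comp_of_eq (I := 𝓘(ℂ, E)) (I' := 𝓘(ℂ, E)) (I'' := powModel E Edge)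
    (x := (1 : G)) (y := m e) (g := fun k : G => Function.update m e k)
    (f := fun h : G => m e * h) (hu.mdifferentiableAt (by simp))
    (((isHolomorphicAction_mul (E := E)).contMDiff_right (m e)).mdifferentiableAt (by simp))
    (by simp)
  have e₁ : edgeAction (e, false) m = (fun k : G => Function.update m e k) ∘ fun h : G => h⁻¹ * m e := by
    funext h
    unfold edgeAction
    simp
  have e₂ : edgeAction (e, true) m = (fun k : G => Function.update m e k) ∘ fun h : G => m e * h := by
    funext h
    unfold edgeAction
    simp
  rw [← e₁] at h₁
  rw [← e₂] at h₂
  have h := actionField_inv_mul (E := E) (m e) x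
  refine (congrArg (fun T : E →L[ℂ] (Edge → E) => T x) h₁).trans
    (Eq.trans ?_ (congrArg (fun T : E →L[ℂ] (Edge → E) => T (conjInv (m e) x)) h₂).symm)
  have key : ∀ (a b : G) (T : G → (E →L[ℂ] Edge → E)) (u v : E), a = b → u = v → T a u = T b v := by
    rintro a _ T u _ rfl rfl
    rfl
  exact key _ _ (fun a => mfderiv 𝓘(ℂ, E) (powModel E Edge) (fun k => Function.update m e k) a) _ _
    (by simp) h

omit [CompleteSpace E] [LieGroup 𝓘(ℂ, E) ω G] in
theorem hasMFDerivAt_mulSingle [DecidableEq Edge] (e : Edge) :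
    HasMFDerivAt 𝓘(ℂ, E) (powModel E Edge) (fun h : G => (Pi.mulSingle e h : Edge → G)) 1
      (ContinuousLinearMap.single ℂ (fun _ : Edge => E) e) := by
  refine hasMFDerivAt_pow_iff.2 fun e' => ?_
  have key : ∀ (T T' : E →L[ℂ] E) (f : G → G), T = T' →
      (fun h : G => (Pi.mulSingle e h : Edge → G) e') = f →
      HasMFDerivAt 𝓘(ℂ, E) 𝓘(ℂ, E) f 1 T' →
      HasMFDerivAt 𝓘(ℂ, E) 𝓘(ℂ, E) (fun h : G => (Pi.mulSingle e h : Edge → G) e') 1 T := by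
    rintro T _ _ rfl rfl h
    exact h
  by_cases he : e' = e
  · subst he
    refine key (ContinuousLinearMap.proj e' ∘L ContinuousLinearMap.single ℂ (fun _ : Edge => E) e')
      (ContinuousLinearMap.id ℂ E) id (by ext; simp) (by funext h; simp) (hasMFDerivAt_id _)
  · refine key (ContinuousLinearMap.proj e' ∘L ContinuousLinearMap.single ℂ (fun _ : Edge => E) e)
      0 (fun _ => 1) (by ext; simp [he]) (by funext h; simp [he]) (hasMFDerivAt_const _ _)

omit [CompleteSpace E] in
theorem contMDiff_halfEdgeAction (m : Edge → G) :
    ContMDiff (powModel E (Edge × Bool)) (powModel E Edge) ω (halfEdgeAction m) := by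
  refine contMDiff_pow_iff.2 fun e => ?_
  have hG := fun i : Edge × Bool => contMDiff_apply (E := E) (M := G) (n := ω) i
  exact ((hG (e, false)).inv.mul contMDiff_const).mul (hG (e, true))

open Classical in
omit [TopologicalSpace G] [Fintype Edge] in
theorem halfEdgeAction_mulSingle (m : Edge → G) (α : Edge × Bool) (h : G) :
    halfEdgeAction m (Pi.mulSingle α h) = edgeAction α m h := by
  obtain ⟨e, b⟩ := α
  funext e'
  by_cases he : e' = e
  · subst he
    cases b <;> simp [halfEdgeAction, edgeAction]
  · have h1 : ∀ c, ((e', c) : Edge × Bool) ≠ (e, b) := fun c h => he (congrArg Prod.fst h)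
    simp [halfEdgeAction, edgeAction, Function.update_of_ne he, Pi.mulSingle_eq_of_ne (h1 _)]

/-- By linearity it suffices to restrict the action to each factor of G ^ Γ_{1/2}, where it is the
action of one half edge. -/
theorem infinitesimal_halfEdgeAction (m : Edge → G) :
    infinitesimal (E := E) (powModel E Edge) halfEdgeAction m =
      familyField (powModel E Edge) edgeAction m := by
  classical
  have hleg : ∀ (α : Edge × Bool) (x : LieAlg E G),
      infinitesimal (E := E) (powModel E Edge) halfEdgeAction m (leg α x) =
        actionField (powModel E Edge) (edgeAction α) m x := by
    intro α x
    have h₁ : HasMFDerivAt (powModel E (Edge × Bool)) (powModel E Edge) (halfEdgeAction m)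
        (Pi.mulSingle α (1 : G)) (mfderiv (powModel E (Edge × Bool)) (powModel E Edge)
          (halfEdgeAction m) (Pi.mulSingle α (1 : G))) :=
      ((contMDiff_halfEdgeAction (E := E) m).mdifferentiableAt (by simp)).hasMFDerivAt
    have h := h₁.comp (f := fun h : G => (Pi.mulSingle α h : Edge × Bool → G)) (1 : G)
      (hasMFDerivAt_mulSingle (E := E) (G := G) α)
    have e₁ : halfEdgeAction m ∘ (fun h : G => (Pi.mulSingle α h : Edge × Bool → G)) =
        edgeAction α m := funext fun h => halfEdgeAction_mulSingle m α h
    rw [e₁] at h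
    refine Eq.trans ?_ (congrArg (fun T : E →L[ℂ] (Edge → E) => T x) h.mfderiv).symm
    have key : ∀ (a b : Edge × Bool → G) (T : (Edge × Bool → G) → ((Edge × Bool → E) →L[ℂ] Edge → E))
      (u v : Edge × Bool → E), a = b → u = v → T a u = T b v := by
      rintro a _ T u _ rfl rfl
      rfl
    refine key _ _ (fun a => mfderiv (powModel E (Edge × Bool)) (powModel E Edge)
          (halfEdgeAction m) a) _ _ (Pi.mulSingle_one α).symm ?_
    funext β
    by_cases hβ : β = α
    · subst hβ
      exact (leg_apply_same β x).trans (Pi.single_eq_same (M := fun _ => E) β x).symm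
    · exact (leg_apply_ne hβ x).trans (Pi.single_eq_of_ne (M := fun _ => E) hβ x).symm
  refine LinearMap.ext fun x => ?_
  rw [familyField_apply, ← sum_leg x, map_sum]
  refine Finset.sum_congr rfl fun α _ => ?_
  rw [hleg, sum_leg]

end EdgeAction

/-! ### Transported actions. -/

section TransportedAction

variable {E : Type*} [NormedAddCommGroup E] [NormedSpace ℂ E] [CompleteSpace E]
  {G : Type*} [TopologicalSpace G] [ChartedSpace E G] [Group G] [LieGroup 𝓘(ℂ, E) ω G]
  {F : Type*} [NormedAddCommGroup F] [NormedSpace ℂ F] {H : Type*}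
  [TopologicalSpace H] {I : ModelWithCorners ℂ F H} {M : Type*}
  [TopologicalSpace M] [ChartedSpace H M] [IsManifold I ω M] {Y : Type*} (e : M ≃ Y)

/-- The action on `Y` which corresponds to the action `A` on `M` by the bijection `e`. -/
def transportAction (A : M → G → M) (y : Transport e) (g : G) : Transport e :=
  toTransport e (A ((toTransport e).symm y) g)

omit [CompleteSpace E] [LieGroup 𝓘(ℂ, E) ω G] in
theorem isHolomorphicAction_transportAction {A : M → G → M}
    (hA : IsHolomorphicAction (E := E) I A) :
    IsHolomorphicAction (E := E) I (transportAction e A) where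
  contMDiff := (contMDiff_toTransport e).comp (hA.contMDiff.comp
    (((contMDiff_toTransport_symm e).comp contMDiff_fst).prodMk contMDiff_snd))
  one y := by simp [transportAction, hA.one]
  mul y g h := by simp [transportAction, hA.mul]

omit [IsManifold I ω M] in
theorem actionField_transportAction {A : M → G → M} (hA : IsHolomorphicAction (E := E) I A)
    (y : Transport e) :
    actionField (E := E) I (transportAction e A) y = actionField I A ((toTransport e).symm y) := by
  have h₁ := ((hA.contMDiff_right ((toTransport e).symm y)).mdifferentiableAt
    (x := 1) (by simp)).hasMFDerivAt
  have e₁ : A ((toTransport e).symm y) =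
    fun g => (toTransport e).symm (transportAction e A y g) := by
    funext g
    simp [transportAction]
  have key : ∀ T : E →L[ℂ] F, HasMFDerivAt 𝓘(ℂ, E) I (A ((toTransport e).symm y)) 1 T →
      HasMFDerivAt 𝓘(ℂ, E) I (transportAction e A y) 1 T := by
    intro T hT
    rw [e₁] at hT
    exact (hasMFDerivAt_transport_iff e).2 hT
  refine LinearMap.ext fun x => ?_
  exact congrArg (fun T : E →L[ℂ] F => T x) (key _ h₁).mfderiv

end TransportedAction

/-! ### The Poisson space structure, given an equivariant parametrization. -/

section PoissonSpace

variable {E : Type*} [NormedAddCommGroup E] [NormedSpace ℂ E] [CompleteSpace E]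
  {G : Type*} [TopologicalSpace G] [ChartedSpace E G] [Group G] [LieGroup 𝓘(ℂ, E) ω G]
  {S : Type*} [TopologicalSpace S] [ChartedSpace HalfPlane S] {V : Finset S}
  {Edge : Type*} [Fintype Edge] (Γ : OrientedSkeleton V Edge)

/-- On each edge the source field is the end field composed with `conjInv`, which fixes s
⊗-squarewise, so the two terms with opposite signs cancel. -/
theorem pushTensor_symPart_skeletonRMatrix [FiniteDimensional ℂ E] [ConnectedSpace G]
    {s : LieAlg E G ⊗[ℂ] LieAlg E G} {r : V → LieAlg E G ⊗[ℂ] LieAlg E G}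
    (hr : ∀ v, IsQuasitriangular (r v)) (hs : ∀ v, symPart (r v) = s) (m : Edge → G) :
    pushTensor (powModel E Edge) (familyField (powModel E Edge) edgeAction)
      (symPart (skeletonRMatrix Γ r)) m = 0 := by
  have hleg : ∀ α : Edge × Bool, familyField (powModel E Edge) edgeAction m ∘ₗ leg α =
      actionField (E := E) (G := G) (powModel E Edge) (edgeAction α) m := by
    intro α
    refine LinearMap.ext fun x => ?_
    rw [LinearMap.comp_apply, familyField_apply, Finset.sum_eq_single α]
    · rw [leg_apply_same]
    · intro β _ hβ
      rw [leg_apply_ne hβ, map_zero]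
    · simp
  rw [symPart_skeletonRMatrix Γ hs, pushTensor, map_sum]
  refine Finset.sum_eq_zero fun e _ => ?_
  have hinv : ∀ x, adTensor x s = 0 := fun x => by
    rw [← hs (Γ.src e)]
    exact (hr _).invariant x
  have hcomp : actionField (E := E) (powModel E Edge) (edgeAction (e, false)) m =
      actionField (powModel E Edge) (edgeAction (e, true)) m ∘ₗ conjInv (m e) :=
    LinearMap.ext fun x => actionField_edgeAction m e x
  have hp : ∀ α : Edge × Bool, TensorProduct.map (familyField (powModel E Edge) edgeAction m)
      (familyField (powModel E Edge) edgeAction m) (place α α s) =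
      TensorProduct.map (actionField (E := E) (powModel E Edge) (edgeAction α) m)
        (actionField (powModel E Edge) (edgeAction α) m) s := by
    intro α
    rw [place_eq_map, ← hleg, TensorProduct.map_comp]
    rfl
  rw [map_sub, hp, hp, sub_eq_zero, hcomp, TensorProduct.map_comp, LinearMap.comp_apply,
    map_conjInv_of_invariant hinv]

/-- In the coordinates given by the edges, a gauge transformation is the half edge action by
elements constant along each vertex; the chain rule gives the claim. -/
theorem gaugeAction_eq (I_Γ : (Edge → G) ≃ Moduli V G)
    (h : ∀ g k, (I_Γ g).gauge k = I_Γ (halfEdgeAction g fun α => k (Γ.base α)))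
    (y : Transport I_Γ) :
    gaugeAction (E := E) I_Γ y =
      familyField (powModel E Edge) edgeAction ((toTransport I_Γ).symm y) ∘ₗ pullBase Γ := by
  rw [← infinitesimal_halfEdgeAction]
  set m := (toTransport I_Γ).symm y with hm
  let b : (V → G) → (Edge × Bool → G) := fun k α => k (Γ.base α)
  let B : (V → E) →L[ℂ] (Edge × Bool → E) :=
    ContinuousLinearMap.pi fun α => ContinuousLinearMap.proj (Γ.base α)
  have hb : HasMFDerivAt (powModel E V) (powModel E (Edge × Bool)) b 1 B := by
    refine hasMFDerivAt_pow_iff.2 fun α => ?_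
    exact hasMFDerivAt_apply (Γ.base α) 1
  have h₁ : HasMFDerivAt (powModel E (Edge × Bool)) (powModel E Edge) (halfEdgeAction m)
      (b 1) (mfderiv (powModel E (Edge × Bool)) (powModel E Edge) (halfEdgeAction m) (b 1)) :=
    ((contMDiff_halfEdgeAction (E := E) m).mdifferentiableAt (by simp)).hasMFDerivAt
  have h₂ := h₁.comp (1 : V → G) hb
  have key : ∀ T : (V → E) →L[ℂ] (Edge → E),
      HasMFDerivAt (powModel E V) (powModel E Edge) (halfEdgeAction m ∘ b) 1 T →
      HasMFDerivAt (powModel E V) (powModel E Edge) (M' := Transport I_Γ)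
        (Moduli.gauge (V := V) (G := G) y) 1 T := by
    intro T hT
    have e₁ : halfEdgeAction m ∘ b = fun k => (toTransport I_Γ).symm
        (Moduli.gauge (V := V) (G := G) y k : Transport I_Γ) := by
      funext k
      have := congrArg I_Γ.symm (h m k)
      rw [Equiv.symm_apply_apply] at this
      refine this.symm.trans ?_
      have hy : I_Γ m = y := I_Γ.apply_symm_apply y
      rw [hy]
      rfl
    rw [e₁] at hT
    exact (hasMFDerivAt_transport_iff (f := Moduli.gauge (V := V) (G := G) y) I_Γ).2 hT
  refine LinearMap.ext fun x => ?_
  exact congrArg (fun T : (V → E) →L[ℂ] (Edge → E) => T x) (key _ h₂).mfderiv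

theorem isRightPoissonSpace_moduli [FiniteDimensional ℂ E] [ConnectedSpace G]
    {s : LieAlg E G ⊗[ℂ] LieAlg E G} {r : V → LieAlg E G ⊗[ℂ] LieAlg E G}
    (hr : ∀ v, IsQuasitriangular (r v)) (hs : ∀ v, symPart (r v) = s)
    (I_Γ : (Edge → G) ≃ Moduli V G)
    (h : ∀ g k, (I_Γ g).gauge k = I_Γ (halfEdgeAction g fun α => k (Γ.base α))) :
    IsRightPoissonSpace (Y := Transport I_Γ) (powModel E Edge) (directSum r)
      (transportTensor (powModel E Edge) I_Γ (skeletonBivector Γ r)) (gaugeAction I_Γ) := by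
  let A : Edge × Bool → Transport I_Γ → G → Transport I_Γ :=
    fun α => transportAction I_Γ (edgeAction α)
  have hA : ∀ α, IsHolomorphicAction (E := E) (powModel E Edge) (A α) := fun α =>
    isHolomorphicAction_transportAction I_Γ (isHolomorphicAction_edgeAction α)
  let σ : ∀ y : Transport I_Γ, (Edge × Bool → LieAlg E G) →ₗ[ℂ] TangentSpace (powModel E Edge) y :=
    familyField (powModel E Edge) A
  have hσ_eq : ∀ y : Transport I_Γ, σ y =
      familyField (powModel E Edge) edgeAction ((toTransport I_Γ).symm y) := by
    intro y
    simp only [σ, A, familyField,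
      actionField_transportAction I_Γ (isHolomorphicAction_edgeAction (E := E) (G := G) _)]
    rfl
  have hσ : IsDerivationAction (powModel E Edge) σ := isDerivationAction_familyField hA
    fun α β hαβ m g h => by simp [A, transportAction, edgeAction_comm hαβ]
  have hρ_eq : gaugeAction (E := E) I_Γ = fun y => σ y ∘ₗ pullBase Γ := by
    funext y
    rw [gaugeAction_eq Γ I_Γ h, hσ_eq]
    rfl
  have hπ_eq : transportTensor (powModel E Edge) I_Γ (skeletonBivector Γ r) =
      pushTensor (powModel E Edge) σ (skeletonRMatrix Γ r) := by
    funext y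
    rw [transportTensor_eq, skeletonBivector, pushTensor, pushTensor, hσ_eq,
      infinitesimal_halfEdgeAction]
    rfl
  have hρ : IsDerivationAction (powModel E Edge) (gaugeAction (E := E) I_Γ) := by
    rw [hρ_eq]
    exact
      { holomorphicOn := fun x => hσ.holomorphicOn (pullBase Γ x)
        lie := fun x x' => hσ.lie (pullBase Γ x) (pullBase Γ x') }
  refine ⟨isQuasitriangular_directSum hr, ?_, hρ.isLieAction ?_, ?_⟩
  · rw [hπ_eq]
    refine hσ.isPoisson (isQuasitriangular_skeletonRMatrix Γ hr) fun y => ?_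
    rw [pushTensor, hσ_eq]
    exact pushTensor_symPart_skeletonRMatrix Γ hr hs _
  · intro x
    rw [hρ_eq]
    exact contMDiff_familyField hA (pullBase Γ x)
  · intro x U f g hU hf hg y hy
    rw [hπ_eq, hρ_eq]
    refine (hσ.lieDerivative_poissonBracket (skeletonRMatrix Γ r) hU hf hg hy
      (pullBase Γ x)).trans ?_
    rw [adTensor_skeletonRMatrix Γ hr, pushTensor, pushTensor, TensorProduct.map_comp]
    rfl

end PoissonSpace

/-! ### Monodromy of principal coverings. -/

section Holonomy

open Bundle

variable {S : Type*} [TopologicalSpace S] {ι : Type*} {G : Type*} [Group G] [TopologicalSpace G]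
  [DiscreteTopology G] (Z : FiberBundleCore ι S G)

omit [Group G] in
theorem isCoveringMap_core : IsCoveringMap Z.proj :=
  IsCoveringMap.mk _ (fun _ => G) (fun x => Z.localTrivAt x) fun x => Z.mem_baseSet_at x

/-- Left multiplication on the fibres of a bundle of groups. -/
def fibreMul (b : G) (p : Z.TotalSpace) : Z.TotalSpace := ⟨p.1, (b * (show G from p.2) : G)⟩

variable {Z} {τ : ι → ι → S → G}
  (hZ : ∀ i j x (v : G), Z.coordChange i j x v = v * τ i j x)

include hZ

theorem continuous_fibreMul (b : G) : Continuous (fibreMul Z b) := by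
  rw [continuous_iff_continuousAt]
  intro p
  rw [FiberBundle.continuousAt_totalSpace]
  refine ⟨(FiberBundle.continuous_proj G Z.Fiber).continuousAt, ?_⟩
  have h := ((FiberBundle.continuousAt_totalSpace G (fun q : Z.TotalSpace => q) (x₀ := p)).1
    continuousAt_id).2
  have h' : (fun q : Z.TotalSpace =>
      (trivializationAt G Z.Fiber (fibreMul Z b p).proj (fibreMul Z b q)).2) =
      fun q => b * (trivializationAt G Z.Fiber p.proj q).2 := by
    funext q
    have key : ∀ (i j : ι) (x : S) (v : G),
        Z.coordChange i j x (b * v) = b * Z.coordChange i j x v := by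
      intro i j x v
      rw [hZ, hZ, mul_assoc]
    exact key _ _ _ _
  rw [h']
  exact (continuous_of_discreteTopology (f := fun a : G => b * a)).continuousAt.comp h

/-- Transition functions multiply on the right, so left multiplication is a continuous map of the
total space and carries lifts of γ to lifts of γ. Lifts are unique. -/
theorem monodromy_fibreMul (b : G) {x y : S} (γ : Path.Homotopic.Quotient x y)
    (p : Z.proj ⁻¹' {x}) (hp : fibreMul Z b p.1 ∈ Z.proj ⁻¹' {x}) :
    ((isCoveringMap_core Z).monodromy γ ⟨fibreMul Z b p.1, hp⟩).1 =
      fibreMul Z b ((isCoveringMap_core Z).monodromy γ p).1 := by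
  obtain ⟨γ⟩ := γ
  have h := ((isCoveringMap_core Z).eq_liftPath_iff' (γ := γ.toContinuousMap)
    (e := fibreMul Z b p.1) (γ.source.trans hp.symm)
    (Γ := (⟨fibreMul Z b, continuous_fibreMul hZ b⟩ : C(Z.TotalSpace, Z.TotalSpace)).comp
      ((isCoveringMap_core Z).liftPath γ.toContinuousMap p.1 (γ.source.trans p.2.symm)))).2
    ⟨(isCoveringMap_core Z).liftPath_lifts γ.toContinuousMap p.1 (γ.source.trans p.2.symm),
      congrArg (fibreMul Z b) ((isCoveringMap_core Z).liftPath_zero γ.toContinuousMap p.1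
        (γ.source.trans p.2.symm))⟩
  exact (DFunLike.congr_fun h 1).symm

/-- The representation of the fundamental groupoid given by the monodromy of a principal covering
with structure group `G`. -/
def monodromyModuli (V : Finset S) : Moduli V G where
  ev v w γ := ((isCoveringMap_core Z).monodromy γ ⟨⟨v, (1 : G)⟩, rfl⟩).1.2
  ev_refl v := by
    rw [IsCoveringMap.monodromy_refl]
    rfl
  ev_trans {u v w} p q := by
    rw [IsCoveringMap.monodromy_trans_apply]
    -- After p the lift is at `ev p` instead of 1; left equivariance moves the starting point out as
    -- a left factor.
    have key : ∀ a : Z.proj ⁻¹' {(v : S)},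
        ((isCoveringMap_core Z).monodromy q a).1.2 =
          (show G from a.1.2) * (show G from
            ((isCoveringMap_core Z).monodromy q ⟨⟨v, (1 : G)⟩, rfl⟩).1.2) := by
      intro a
      have ha : a.1 = fibreMul Z (show G from a.1.2) ⟨v, (1 : G)⟩ := by
        obtain ⟨⟨x, a⟩, h⟩ := a
        have hx : x = v := h
        subst hx
        exact congrArg (TotalSpace.mk (v : S)) (mul_one (show G from a)).symm
      have h := monodromy_fibreMul hZ (show G from a.1.2) q ⟨⟨v, (1 : G)⟩, rfl⟩ (ha ▸ a.2)
      have ha' : (⟨_, ha ▸ a.2⟩ : Z.proj ⁻¹' {(v : S)}) = a := Subtype.ext ha.symm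
      rw [ha'] at h
      rw [h]
      rfl
    exact key _

theorem monodromyModuli_ev_mk {V : Finset S} {v w : V} (γ : Path (v : S) (w : S)) {a : unitInterval → G}
    (ha : Continuous fun t => (⟨γ t, a t⟩ : Z.TotalSpace)) (h0 : a 0 = 1) :
    (monodromyModuli hZ V).ev (Path.Homotopic.Quotient.mk γ) = a 1 := by
  have h := ((isCoveringMap_core Z).eq_liftPath_iff (γ := γ.toContinuousMap)
    (e := ⟨v, (1 : G)⟩) γ.source (Γ := fun t => ⟨γ t, a t⟩)).2 ⟨ha, rfl, by
      rw [γ.source, h0]⟩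
  have h1 := congrFun h 1
  have key : ∀ p q : Z.TotalSpace, p = q → (show G from q.2) = (show G from p.2) := by
    rintro p _ rfl
    rfl
  exact key _ _ h1

end Holonomy

/-- The midpoint of the unit interval. -/
def midpoint : unitInterval := ⟨1 / 2, by norm_num, by norm_num⟩

theorem midpoint_mem : midpoint ∈ Set.Ioo (0 : unitInterval) 1 := by
  constructor <;> rw [← Subtype.coe_lt_coe] <;> norm_num [midpoint]

/-! ### Existence of representations with given values on edges. -/

namespace EmbeddedGraph

variable {S : Type*} [TopologicalSpace S] {V : Finset S} {Edge : Type*} (Γ : EmbeddedGraph V Edge)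

theorem eq_zero_or_one_of_arc_mem {e : Edge} {t : unitInterval} (h : Γ.arc e t ∈ V) :
    t = 0 ∨ t = 1 := by
  by_contra! h'
  exact Γ.arc_not_mem e t ⟨unitInterval.pos_iff_ne_zero.2 h'.1, unitInterval.lt_one_iff_ne_one.2 h'.2⟩ h

theorem arc_mem_carrier (e : Edge) (t : unitInterval) : Γ.arc e t ∈ Γ.carrier :=
  Or.inr (Set.mem_iUnion.2 ⟨e, t, rfl⟩)

theorem exists_arc_of_mem_carrier {x : S} (hx : x ∈ Γ.carrier) (hV : x ∉ V) :
    ∃ e, ∃ t ∈ Set.Ioo (0 : unitInterval) 1, x = Γ.arc e t := by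
  obtain hx | hx := hx
  · exact (hV hx).elim
  · obtain ⟨e, t, rfl⟩ := Set.mem_iUnion.1 hx
    refine ⟨e, t, ⟨unitInterval.pos_iff_ne_zero.2 ?_, unitInterval.lt_one_iff_ne_one.2 ?_⟩, rfl⟩
    · rintro rfl
      exact hV (by simp)
    · rintro rfl
      exact hV (by simp)

/-- Within the graph, the complement of an open piece of an edge interior is a finite union of
compact sets: the vertices, the other edges and the rest of this edge. -/
theorem isOpen_preimage_arc [T2Space S] [Finite Edge] {X : Type*} [TopologicalSpace X] {f : X → S}
    (hf : Continuous f) (hfA : ∀ x, f x ∈ Γ.carrier) (e : Edge) {W : Set unitInterval}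
    (hW : IsOpen W) (hW' : W ⊆ Set.Ioo 0 1) : IsOpen (f ⁻¹' (Γ.arc e '' W)) := by
  let C : Set S := (V ∪ ⋃ e' : {e' // e' ≠ e}, Set.range (Γ.arc e')) ∪ Γ.arc e '' Wᶜ
  have hC : IsClosed C := by
    refine (V.finite_toSet.isClosed.union (isClosed_iUnion_of_finite fun e' => ?_)).union ?_
    · exact (isCompact_range (Γ.arc e').continuous).isClosed
    · exact (hW.isClosed_compl.isCompact.image (Γ.arc e).continuous).isClosed
  have h : f ⁻¹' (Γ.arc e '' W) = f ⁻¹' Cᶜ := by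
    ext x
    constructor
    · rintro ⟨t, ht, htx⟩ ((hx | hx) | ⟨t', ht', hx⟩)
      · exact Γ.arc_not_mem e t (hW' ht) (htx ▸ hx)
      · obtain ⟨e', t', ht'⟩ := Set.mem_iUnion.1 hx
        exact e'.2 (Γ.arc_injective e e' t t' (hW' ht) (htx.trans ht'.symm)).1.symm
      · exact ht' ((Γ.arc_injective e e t t' (hW' ht) (htx.trans hx.symm)).2 ▸ ht)
    · intro hx
      obtain ⟨e', t, ht, htx⟩ := Γ.exists_arc_of_mem_carrier (hfA x) fun hV => hx (Or.inl (Or.inl hV))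
      obtain rfl : e' = e := by
        by_contra he
        exact hx (Or.inl (Or.inr (Set.mem_iUnion.2 ⟨⟨e', he⟩, t, htx.symm⟩)))
      refine ⟨t, ?_, htx.symm⟩
      by_contra ht
      exact hx (Or.inr ⟨t, ht, htx.symm⟩)
  rw [h]
  exact hC.isOpen_compl.preimage hf

section Multiplier

variable {G : Type*} [Group G] (f : S → S) (g : Edge → G)

open Classical in
/-- The function which is equal to `g e` over the second half of the edge `e`, and to `1`
elsewhere. -/
def multiplier (x : S) : G :=
  if h : ∃ e, f x ∈ Γ.arc e '' Set.Ioo midpoint 1 then g h.choose else 1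

variable {f}

theorem multiplier_of_lt {x : S} {e : Edge} {t : unitInterval} (ht : t ∈ Set.Ioo 0 midpoint)
    (hx : f x = Γ.arc e t) : Γ.multiplier f g x = 1 := by
  refine dif_neg ?_
  rintro ⟨e', t', ht', h⟩
  obtain ⟨-, rfl⟩ := Γ.arc_injective e e' t t' ⟨ht.1, ht.2.trans midpoint_mem.2⟩
    (hx.symm.trans h.symm)
  exact lt_asymm ht.2 ht'.1

theorem multiplier_of_gt {x : S} {e : Edge} {t : unitInterval} (ht : t ∈ Set.Ioo midpoint 1)
    (hx : f x = Γ.arc e t) : Γ.multiplier f g x = g e := by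
  have h : ∃ e, f x ∈ Γ.arc e '' Set.Ioo midpoint 1 := ⟨e, t, ht, hx.symm⟩
  rw [multiplier, dif_pos h]
  obtain ⟨t', ht', h'⟩ := h.choose_spec
  rw [(Γ.arc_injective e _ t t' ⟨midpoint_mem.1.trans ht.1, ht.2⟩ (hx.symm.trans h'.symm)).1]

/-- Away from vertices and midpoints, f x lies in an open half of an edge, and the multiplier is
constant over it. -/
theorem eventually_multiplier_eq [T2Space S] [Finite Edge] (hf : Continuous f)
    (hfA : ∀ x, f x ∈ Γ.carrier) {x : S} (hV : f x ∉ V) (hm : ∀ e, f x ≠ Γ.arc e midpoint) :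
    ∀ᶠ x' in 𝓝 x, Γ.multiplier f g x' = Γ.multiplier f g x := by
  obtain ⟨e, t, ht, hx⟩ := Γ.exists_arc_of_mem_carrier (hfA x) hV
  obtain h | h | h := lt_trichotomy t midpoint
  · have hU := Γ.isOpen_preimage_arc hf hfA e (W := Set.Ioo 0 midpoint) isOpen_Ioo
      fun s hs => ⟨hs.1, hs.2.trans midpoint_mem.2⟩
    filter_upwards [hU.mem_nhds ⟨t, ⟨ht.1, h⟩, hx.symm⟩] with x' ⟨t', ht', hx'⟩
    rw [Γ.multiplier_of_lt g ⟨ht.1, h⟩ hx, Γ.multiplier_of_lt g ht' hx'.symm]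
  · exact (hm e (h ▸ hx)).elim
  · have hU := Γ.isOpen_preimage_arc hf hfA e (W := Set.Ioo midpoint 1) isOpen_Ioo
      fun s hs => ⟨midpoint_mem.1.trans hs.1, hs.2⟩
    filter_upwards [hU.mem_nhds ⟨t, ⟨h, ht.2⟩, hx.symm⟩] with x' ⟨t', ht', hx'⟩
    rw [Γ.multiplier_of_gt g ⟨h, ht.2⟩ hx, Γ.multiplier_of_gt g ht' hx'.symm]

end Multiplier

/-- The transition functions of the covering defined by the multiplier `a`, for the charts over the
stars of the vertices (`false`) and over the interiors of the edges (`true`). -/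
def transition {G : Type*} [Group G] (a : G) : Bool → Bool → G
  | false, true => a⁻¹
  | true, false => a
  | _, _ => 1

open Classical in
/-- The principal covering of `S` with structure group `G` and holonomy `g` along the edges. -/
def core [T2Space S] [Finite Edge] {G : Type*} [Group G] [TopologicalSpace G] [DiscreteTopology G]
    {f : S → S} (hf : Continuous f) (hfA : ∀ x, f x ∈ Γ.carrier) (g : Edge → G) :
    FiberBundleCore Bool S G where
  baseSet i := if i then {x | f x ∉ V} else {x | ∀ e, f x ≠ Γ.arc e midpoint}
  isOpen_baseSet i := by
    cases i
    · have h : {x | ∀ e, f x ≠ Γ.arc e midpoint} =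
          f ⁻¹' (Set.range fun e => Γ.arc e midpoint)ᶜ := by
        ext x
        simp [eq_comm]
      simp only [Bool.false_eq_true, if_false, h]
      exact (Set.finite_range _).isClosed.isOpen_compl.preimage hf
    · simp only [if_true]
      exact V.finite_toSet.isClosed.isOpen_compl.preimage hf
  indexAt x := if ∀ e, f x ≠ Γ.arc e midpoint then false else true
  mem_baseSet_at x := by
    by_cases h : ∀ e, f x ≠ Γ.arc e midpoint
    · simp only [if_pos h, Bool.false_eq_true, if_false]
      exact h
    · simp only [if_neg h, if_true]
      push Not at h
      obtain ⟨e, he⟩ := h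
      change f x ∉ V
      rw [he]
      exact Γ.arc_not_mem e midpoint midpoint_mem
  coordChange i j x v := v * transition (Γ.multiplier f g x) i j
  coordChange_self i x _ v := by cases i <;> simp [transition]
  continuousOn_coordChange i j := by
    by_cases hij : i = j
    · have : ∀ a : G, transition a i j = 1 := fun a => by subst hij; cases i <;> rfl
      simp only [this, mul_one]
      exact continuousOn_snd
    · rintro ⟨x, v⟩ ⟨hx, -⟩
      have hx' : f x ∉ V ∧ ∀ e, f x ≠ Γ.arc e midpoint := by
        cases i <;> cases j <;> simp_all
      have hc : ContinuousAt (Γ.multiplier f g) x :=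
        continuousAt_const.congr ((Γ.eventually_multiplier_eq g hf hfA hx'.1 hx'.2).mono
          fun x' h => h.symm)
      have ht : Continuous fun a : G => transition a i j := continuous_of_discreteTopology
      have hm : Continuous fun p : G × G => p.1 * p.2 := continuous_of_discreteTopology
      have h₁ : ContinuousAt (fun p : S × G => (p.2, transition (Γ.multiplier f g p.1) i j))
          (x, v) :=
        continuousAt_snd.prodMk (ht.continuousAt.comp (ContinuousAt.comp (g := Γ.multiplier f g)
          (f := Prod.fst) (x := (x, v)) hc continuousAt_fst))
      exact (hm.continuousAt.comp h₁).continuousWithinAt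
  coordChange_comp i j k x _ v := by
    cases i <;> cases j <;> cases k <;> simp [transition]

theorem exists_moduli [T2Space S] [Finite Edge] {G : Type*} [Group G]
    {f : S → S} (hf : Continuous f) (hfA : ∀ x, f x ∈ Γ.carrier)
    (hfid : ∀ x ∈ Γ.carrier, f x = x) (g : Edge → G) :
    ∃ y : Moduli V G, ∀ e, y.ev (Γ.edgeClass e) = g e := by
  classical
  let _ : TopologicalSpace G := ⊥
  have : DiscreteTopology G := ⟨rfl⟩
  let Z := Γ.core hf hfA g
  have hZ : ∀ i j x (v : G), Z.coordChange i j x v = v * transition (Γ.multiplier f g x) i j :=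
    fun i j x v => rfl
  refine ⟨monodromyModuli hZ V, fun e => ?_⟩
  have hfe : ∀ t, f (Γ.arc e t) = Γ.arc e t := fun t => hfid _ (Γ.arc_mem_carrier e t)
  have hindex : ∀ t, t ≠ midpoint → Z.indexAt (Γ.arc e t) = false := by
    intro t ht
    refine if_pos fun e' he' => ht ?_
    rw [hfe] at he'
    exact (Γ.arc_injective e' e midpoint t midpoint_mem he'.symm).2.symm
  have hindex' : Z.indexAt (Γ.arc e midpoint) = true := by
    refine if_neg fun h => h e ?_
    rw [hfe]
  -- The lift of the edge is 1 in the star chart before the midpoint and `g e` in the star chart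
  -- after it. In the edge chart it is constantly 1. The midpoint itself uses the edge chart, hence
  -- the strict inequality.
  let a : unitInterval → G := fun t => if midpoint < t then g e else 1
  have ha : ∀ t, t ∈ Set.Ioo 0 1 →
      a t * transition (Γ.multiplier f g (Γ.arc e t)) (Z.indexAt (Γ.arc e t)) true = 1 := by
    intro t ht
    obtain h | rfl | h := lt_trichotomy t midpoint
    · rw [hindex t h.ne, Γ.multiplier_of_lt g ⟨ht.1, h⟩ (hfe t)]
      simp [a, transition, h.not_gt]
    · rw [hindex']
      simp [a, transition]
    · rw [hindex t h.ne', Γ.multiplier_of_gt g ⟨h, ht.2⟩ (hfe t)]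
      simp [a, transition, h]
  have hcont : Continuous fun t => (⟨Γ.arc e t, a t⟩ : Z.TotalSpace) := by
    rw [continuous_iff_continuousAt]
    intro t
    rw [FiberBundle.continuousAt_totalSpace]
    refine ⟨(Γ.arc e).continuous.continuousAt, ?_⟩
    change ContinuousAt (fun s => a s * transition (Γ.multiplier f g (Γ.arc e s))
      (Z.indexAt (Γ.arc e s)) (Z.indexAt (Γ.arc e t))) t
    obtain h | rfl | h := lt_trichotomy t midpoint
    · refine continuousAt_const.congr (f := fun _ => (1 : G)) ?_
      filter_upwards [isOpen_Iio.mem_nhds h] with s hs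
      rw [hindex t h.ne, hindex s (ne_of_lt hs)]
      simp [a, transition, (Set.mem_Iio.1 hs).not_gt]
    · refine continuousAt_const.congr (f := fun _ => (1 : G)) ?_
      filter_upwards [isOpen_Ioo.mem_nhds midpoint_mem] with s hs
      rw [hindex', ha s hs]
    · refine continuousAt_const.congr (f := fun _ => g e) ?_
      filter_upwards [isOpen_Ioi.mem_nhds h] with s hs
      rw [hindex t h.ne', hindex s (ne_of_gt hs)]
      simp [a, transition, Set.mem_Ioi.1 hs]
  refine (monodromyModuli_ev_mk hZ (Γ.arc e) hcont ?_).trans ?_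
  · simp [a]
  · simp [a, midpoint_mem.2]

end EmbeddedGraph

/-! ### Uniqueness of representations with given values on edges. -/

theorem cast_trans_quotient {S : Type*} [TopologicalSpace S] {x x' y z : S} (h : x' = x)
    (γ : Path.Homotopic.Quotient x y) (γ' : Path.Homotopic.Quotient y z) :
    (γ.cast h rfl).trans γ' = (γ.trans γ').cast h rfl := by
  subst h
  simp

/-- The homotopy from the identity of the unit interval to the map which stretches the middle half
of the interval and is constant near the endpoints. -/
def stretch (t s : unitInterval) : unitInterval :=
  Set.projIcc 0 1 zero_le_one ((s : ℝ) + t * (s - 1 / 2))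

theorem continuous_stretch : Continuous fun p : unitInterval × unitInterval => stretch p.1 p.2 := by
  unfold stretch
  exact continuous_projIcc.comp (by fun_prop)

theorem stretch_zero (s : unitInterval) : stretch 0 s = s := by
  simp [stretch]

theorem stretch_left (t : unitInterval) : stretch t 0 = 0 := by
  refine Set.projIcc_of_le_left zero_le_one ?_
  have := t.2.1
  simp only [Set.Icc.coe_zero]
  linarith

theorem stretch_right (t : unitInterval) : stretch t 1 = 1 := by
  refine Set.projIcc_of_right_le zero_le_one ?_
  have := t.2.1
  simp only [Set.Icc.coe_one]
  linarith

theorem stretch_one_eq {s : unitInterval} (hs : (s : ℝ) ∉ Set.Icc (1 / 4 : ℝ) (3 / 4)) :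
    stretch 1 s = 0 ∨ stretch 1 s = 1 := by
  rw [Set.mem_Icc, not_and_or, not_le, not_le] at hs
  obtain hs | hs := hs
  · refine Or.inl (Set.projIcc_of_le_left zero_le_one ?_)
    simp only [Set.Icc.coe_one]
    linarith
  · refine Or.inr (Set.projIcc_of_right_le zero_le_one ?_)
    simp only [Set.Icc.coe_one]
    linarith

namespace Moduli

variable {S : Type*} [TopologicalSpace S] {V : Finset S} {G : Type*} [Group G] (y y' : Moduli V G)

variable {y y'}

/-- Since (s σ⁻¹)(σ γ σ'⁻¹) = s' σ'⁻¹, agreement on two of these loops or paths forces agreement on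
the third by cancellation. -/
theorem ev_eq_of_connecting {u v v' : V} {x x' : S} {s : Path.Homotopic.Quotient (u : S) x}
    {s' : Path.Homotopic.Quotient (u : S) x'} {γ : Path.Homotopic.Quotient x x'} (hγ : s.trans γ = s')
    {σ : Path.Homotopic.Quotient (v : S) x} {σ' : Path.Homotopic.Quotient (v' : S) x'}
    (h : y.ev (s.trans σ.symm) = y'.ev (s.trans σ.symm))
    (h' : y.ev (s'.trans σ'.symm) = y'.ev (s'.trans σ'.symm)) :
    y.ev ((σ.trans γ).trans σ'.symm) = y'.ev ((σ.trans γ).trans σ'.symm) := by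
  have hcomp : (s.trans σ.symm).trans ((σ.trans γ).trans σ'.symm) = s'.trans σ'.symm := by
    rw [← hγ, Path.Homotopic.Quotient.trans_assoc, ← Path.Homotopic.Quotient.trans_assoc σ.symm,
      ← Path.Homotopic.Quotient.trans_assoc σ.symm, Path.Homotopic.Quotient.symm_trans,
      Path.Homotopic.Quotient.refl_trans, Path.Homotopic.Quotient.trans_assoc]
  rw [← hcomp, y.ev_trans, y'.ev_trans, h] at h'
  exact mul_left_cancel h'

end Moduli

/-- The class of a constant path. -/
def constClass {S : Type*} [TopologicalSpace S] {x x' : S} (h : x = x') : Path.Homotopic.Quotient x x' :=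
  Path.Homotopic.Quotient.mk ((Path.refl x).cast rfl h.symm)

namespace EmbeddedGraph

variable {S : Type*} [TopologicalSpace S] {V : Finset S} {Edge : Type*} (Γ : EmbeddedGraph V Edge)

theorem exists_collapse [T2Space S] [Finite Edge] :
    ∃ K : C(Γ.carrier × unitInterval, S), (∀ x, K (x, 0) = x) ∧
      (∀ (x : Γ.carrier) t, (x : S) ∈ V → K (x, t) = x) ∧
      ∀ (x : Γ.carrier) t e s, (x : S) = Γ.arc e s → K (x, t) = Γ.arc e (stretch t s) := by
  classical
  let _ : TopologicalSpace Edge := ⊥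
  have : DiscreteTopology Edge := ⟨rfl⟩
  let X := V ⊕ (Edge × unitInterval)
  let q : X → Γ.carrier := Sum.elim (fun v => ⟨v, Or.inl v.2⟩)
    (fun p => ⟨Γ.arc p.1 p.2, Γ.arc_mem_carrier p.1 p.2⟩)
  have hq : Continuous q := by
    refine Continuous.sumElim (Continuous.subtype_mk continuous_subtype_val _)
      (Continuous.subtype_mk ?_ _)
    exact continuous_prod_of_discrete_left.2 fun e => (Γ.arc e).continuous
  have hqs : Function.Surjective q := by
    rintro ⟨x, hx | hx⟩
    · exact ⟨Sum.inl ⟨x, hx⟩, rfl⟩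
    · obtain ⟨e, t, rfl⟩ := Set.mem_iUnion.1 hx
      exact ⟨Sum.inr (e, t), rfl⟩
  let Q : C(X × unitInterval, Γ.carrier × unitInterval) := ⟨Prod.map q id, hq.prodMap continuous_id⟩
  -- The map from the disjoint union of vertices and edges is a continuous surjection from a compact
  -- space to a Hausdorff space. A homotopy defined edge by edge therefore descends once it is
  -- compatible with the identifications at vertices.
  have hQ : Topology.IsQuotientMap Q :=
    Q.continuous.isClosedMap.isQuotientMap Q.continuous (hqs.prodMap Function.surjective_id)
  let k₁ : V × unitInterval → S := fun p => p.1
  let k₂ : (Edge × unitInterval) × unitInterval → S := fun p => Γ.arc p.1.1 (stretch p.2 p.1.2)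
  have hk₁ : Continuous k₁ := continuous_subtype_val.comp continuous_fst
  have hk₂ : Continuous k₂ := by
    have h : Continuous fun p : Edge × unitInterval => Γ.arc p.1 p.2 :=
      continuous_prod_of_discrete_left.2 fun e => (Γ.arc e).continuous
    exact h.comp ((continuous_fst.comp continuous_fst).prodMk
      (continuous_stretch.comp (continuous_snd.prodMk (continuous_snd.comp continuous_fst))))
  let k : X × unitInterval → S := Sum.elim k₁ k₂ ∘ Homeomorph.sumProdDistrib
  have hk : Continuous k := (hk₁.sumElim hk₂).comp (Homeomorph.continuous _)
  have harc : ∀ {e s} (t : unitInterval), Γ.arc e s ∈ V → Γ.arc e (stretch t s) = Γ.arc e s := by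
    intro e s t h
    obtain rfl | rfl := Γ.eq_zero_or_one_of_arc_mem h
    · rw [stretch_left]
    · rw [stretch_right]
  have hfac : Function.FactorsThrough k Q := by
    rintro ⟨a, t⟩ ⟨b, t'⟩ hab
    obtain ⟨hq', rfl⟩ : q a = q b ∧ t = t' := Prod.ext_iff.1 hab
    clear hab
    have hab := congrArg Subtype.val hq'
    obtain v | ⟨e, s⟩ := a <;> obtain v' | ⟨e', s'⟩ := b
    · exact hab
    · have hab : (v : S) = Γ.arc e' s' := hab
      exact hab.trans (harc t (hab ▸ v.2)).symm
    · have hab : Γ.arc e s = v' := hab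
      exact (harc t (hab ▸ v'.2)).trans hab
    · have hab : Γ.arc e s = Γ.arc e' s' := hab
      change Γ.arc e (stretch t s) = Γ.arc e' (stretch t s')
      by_cases hV : Γ.arc e s ∈ V
      · rw [harc t hV, harc t (hab ▸ hV), hab]
      · obtain ⟨rfl, rfl⟩ := Γ.arc_injective e e' s s' ⟨unitInterval.pos_iff_ne_zero.2 (by
          rintro rfl
          simp at hV), unitInterval.lt_one_iff_ne_one.2 (by
          rintro rfl
          simp at hV)⟩ hab
        rfl
  let K := hQ.lift ⟨k, hk⟩ hfac
  have hK : ∀ a t, K (q a, t) = k (a, t) := fun a t =>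
    DFunLike.congr_fun (hQ.lift_comp ⟨k, hk⟩ hfac) (a, t)
  have harcK : ∀ (x : Γ.carrier) t e s, (x : S) = Γ.arc e s → K (x, t) = Γ.arc e (stretch t s) := by
    intro x t e s h
    obtain rfl : x = q (Sum.inr (e, s)) := Subtype.ext h
    exact hK _ t
  have hVK : ∀ (x : Γ.carrier) t, (x : S) ∈ V → K (x, t) = x := by
    intro x t h
    exact hK (Sum.inl ⟨x, h⟩) t
  refine ⟨K, fun x => ?_, hVK, harcK⟩
  obtain ⟨v | ⟨e, s⟩, rfl⟩ := hqs x
  · exact hVK _ _ v.2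
  · rw [harcK _ _ e s rfl, stretch_zero]
    rfl

/-- The retraction f is followed by the stretching of edges. The map r is still homotopic to the
identity relative to V, but collapses onto vertices whatever f maps to the outer quarters of the
edges. -/
theorem exists_stretching [T2Space S] [Finite Edge] (h : DeformationRetractsOnto Γ.carrier) :
    ∃ f r : C(S, S), (∀ x, f x ∈ Γ.carrier) ∧
      Nonempty ((ContinuousMap.id S).HomotopyRel r V) ∧ (∀ x, f x ∈ V → r x = f x) ∧
      ∀ x e s, f x = Γ.arc e s → r x = Γ.arc e (stretch 1 s) := by
  obtain ⟨f, hf, ⟨F⟩⟩ := h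
  obtain ⟨K, hK0, hKV, hKarc⟩ := Γ.exists_collapse
  have hfid : ∀ x ∈ V, f x = x := fun x hx => (F.fst_eq_snd (Or.inl hx)).symm
  let k : C(unitInterval × S, S) :=
    ⟨fun p => K (⟨f p.2, hf p.2⟩, p.1), by fun_prop⟩
  let r : C(S, S) := ⟨fun x => K (⟨f x, hf x⟩, 1), by fun_prop⟩
  refine ⟨f, r, hf, ⟨ContinuousMap.HomotopyRel.trans (f₁ := f) ?_ ?_⟩, fun x hx => hKV _ _ hx,
    fun x e s hs => hKarc _ _ e s hs⟩
  · exact { toHomotopy := F.toHomotopy, prop' := fun t x hx => F.prop' t x (Or.inl hx) }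
  · exact
      { toContinuousMap := k
        map_zero_left := fun x => hK0 _
        map_one_left := fun x => rfl
        prop' := fun t x hx => hKV _ _ (by
          change f x ∈ V
          rw [hfid x hx]
          exact hx) }

/-- The class of the segment from the source of an edge to a point of this edge. -/
def segment (e : Edge) (s : unitInterval) {x : S} (h : Γ.arc e s = x) : Path.Homotopic.Quotient (Γ.src e : S) x :=
  Path.Homotopic.Quotient.mk (((Γ.arc e).subpath 0 s).cast (Γ.arc e).source.symm h.symm)

/-- The preferred paths from vertices to points of the graph: constant paths at vertices, and
segments of edges. -/
inductive IsAnchor : ∀ (v : V) (x : S), Path.Homotopic.Quotient (v : S) x → Prop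
  | vertex (v : V) : IsAnchor v v (Path.Homotopic.Quotient.refl (v : S))
  | edge (e : Edge) (s : unitInterval) (hs : s ∈ Set.Ioo 0 1) :
      IsAnchor (Γ.src e) (Γ.arc e s) (Γ.segment e s rfl)

theorem exists_isAnchor {x : S} (hx : x ∈ Γ.carrier) : ∃ v σ, Γ.IsAnchor v x σ := by
  by_cases hV : x ∈ V
  · exact ⟨⟨x, hV⟩, _, IsAnchor.vertex _⟩
  · obtain ⟨e, s, hs, rfl⟩ := Γ.exists_arc_of_mem_carrier hx hV
    exact ⟨_, _, IsAnchor.edge e s hs⟩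

/-- A path which stays in one edge comes from a path of parameters, and the unit interval is simply
connected. -/
theorem segment_trans {e : Edge} {s s' : unitInterval} {x x' : S} (h : Γ.arc e s = x)
    (h' : Γ.arc e s' = x') (γ : Path x x') (η : Path s s') (hγ : ∀ t, γ t = Γ.arc e (η t)) :
    (Γ.segment e s h).trans (Path.Homotopic.Quotient.mk γ) = Γ.segment e s' h' := by
  subst h h'
  obtain rfl : γ = η.map (Γ.arc e).continuous := Path.ext (funext hγ)
  let c : ∀ s : unitInterval, Path 0 s := fun s =>
    { toFun := Set.Icc.convexComb 0 s
      source' := by simp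
      target' := by simp }
  have : ContractibleSpace unitInterval := (convex_Icc (0 : ℝ) 1).contractibleSpace ⟨0, by simp⟩
  have hη : Path.Homotopic.Quotient.mk ((c s).trans η) = Path.Homotopic.Quotient.mk (c s') :=
    Path.Homotopic.Quotient.eq.2 (SimplyConnectedSpace.paths_homotopic _ _)
  have hc : ∀ s, Γ.segment e s rfl =
      (Path.Homotopic.Quotient.mk ((c s).map (Γ.arc e).continuous)).cast (Γ.arc e).source.symm rfl :=
    fun s => rfl
  rw [hc, hc, cast_trans_quotient, ← Path.Homotopic.Quotient.mk_trans, ← Path.map_trans]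
  have := congrArg (fun p => p.map ⟨Γ.arc e, (Γ.arc e).continuous⟩) hη
  exact congrArg (fun p : Path.Homotopic.Quotient (Γ.arc e 0) (Γ.arc e s') =>
    p.cast (Γ.arc e).source.symm rfl) this

section Agreement

variable {G : Type*} [Group G] {y y' : Moduli V G}

variable {Γ} in
theorem IsAnchor.ev_constClass {v : V} {x : S} {σ : Path.Homotopic.Quotient (v : S) x} (hσ : Γ.IsAnchor v x σ)
    {u : V} (h : (u : S) = x) :
    y.ev ((constClass h).trans σ.symm) = y'.ev ((constClass h).trans σ.symm) := by
  obtain _ | ⟨e, s, hs⟩ := hσ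
  · obtain rfl := Subtype.ext h
    have : (constClass h).trans (Path.Homotopic.Quotient.refl (u : S)).symm = Path.Homotopic.Quotient.refl (u : S) :=
      Path.Homotopic.Quotient.trans_symm _
    rw [this, y.ev_refl, y'.ev_refl]
  · exact (Γ.arc_not_mem e s hs (h ▸ u.2)).elim

variable {Γ} in
-- Out along the edge and back along an anchor is either trivial or the class of the whole edge,
-- where the representations agree by hypothesis.
theorem IsAnchor.ev_segment (hy : ∀ e, y.ev (Γ.edgeClass e) = y'.ev (Γ.edgeClass e)) {v : V}
    {x : S} {σ : Path.Homotopic.Quotient (v : S) x} (hσ : Γ.IsAnchor v x σ)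
    {e : Edge} {s : unitInterval} (h : Γ.arc e s = x) :
    y.ev ((Γ.segment e s h).trans σ.symm) = y'.ev ((Γ.segment e s h).trans σ.symm) := by
  obtain _ | ⟨e', s', hs'⟩ := hσ
  · have hr : ∀ v : S, (Path.Homotopic.Quotient.refl v).symm = Path.Homotopic.Quotient.refl v := by
      intro v
      rw [← Path.Homotopic.Quotient.mk_refl, ← Path.Homotopic.Quotient.mk_symm, Path.refl_symm]
    rw [hr, Path.Homotopic.Quotient.trans_refl]
    have hV : Γ.arc e s ∈ V := by
      rw [h]
      exact Subtype.prop _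
    obtain rfl | rfl := Γ.eq_zero_or_one_of_arc_mem hV
    · obtain rfl := Subtype.ext ((Γ.arc e).source.symm.trans h)
      have : Γ.segment e 0 h = Path.Homotopic.Quotient.refl (Γ.src e : S) := by
        rw [← Path.Homotopic.Quotient.mk_refl, segment]
        congr 1
        ext t
        simp
      rw [this, y.ev_refl, y'.ev_refl]
    · obtain rfl := Subtype.ext ((Γ.arc e).target.symm.trans h)
      have : Γ.segment e 1 h = Γ.edgeClass e := by
        rw [edgeClass, segment]
        congr 1
        ext t
        simp
      rw [this, hy]
  · obtain ⟨rfl, rfl⟩ := Γ.arc_injective e' e s' s hs' h.symm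
    rw [Path.Homotopic.Quotient.trans_symm, y.ev_refl, y'.ev_refl]

/-- If two representations agree on the pieces of a path, they agree on the path. -/
theorem ev_eq_of_eventually {v w : V} (q : Path (v : S) (w : S)) (hq : ∀ t, q t ∈ Γ.carrier)
    (hloc : ∀ t, ∀ᶠ t' in 𝓝 t, ∃ (u : V) (s : Path.Homotopic.Quotient (u : S) (q t))
      (s' : Path.Homotopic.Quotient (u : S) (q t')),
      s.trans (Path.Homotopic.Quotient.mk (q.subpath t t')) = s' ∧
      (∀ v' σ, Γ.IsAnchor v' (q t) σ → y.ev (s.trans σ.symm) = y'.ev (s.trans σ.symm)) ∧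
      ∀ v' σ, Γ.IsAnchor v' (q t') σ → y.ev (s'.trans σ.symm) = y'.ev (s'.trans σ.symm)) :
    y.ev (Path.Homotopic.Quotient.mk q) = y'.ev (Path.Homotopic.Quotient.mk q) := by
  choose n σ hσ using fun t => Γ.exists_isAnchor (hq t)
  let pre : ∀ t, Path.Homotopic.Quotient (v : S) (q t) := fun t =>
    (Path.Homotopic.Quotient.mk (q.subpath 0 t)).cast q.source.symm rfl
  have hpre : ∀ t t', (pre t).trans (Path.Homotopic.Quotient.mk (q.subpath t t')) = pre t' := by
    intro t t'
    rw [cast_trans_quotient, ← Path.Homotopic.Quotient.mk_trans]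
    exact congrArg (fun p : Path.Homotopic.Quotient (q 0) (q t') => p.cast q.source.symm rfl)
      (Path.Homotopic.Quotient.eq.2 ⟨Path.Homotopy.subpathTransSubpath q 0 t t'⟩)
  -- D compares the two representations on the initial part of q, closed up by anchors. The anchors
  -- need not vary continuously with t: D is locally constant because the representations agree on
  -- each small increment.
  let D : unitInterval → G := fun t =>
    y.ev ((pre t).trans (σ t).symm) * (y'.ev ((pre t).trans (σ t).symm))⁻¹
  have hD : IsLocallyConstant D := by
    rw [IsLocallyConstant.iff_eventually_eq]
    intro t
    filter_upwards [hloc t] with t' ⟨u, s, s', hs, h, h'⟩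
    have hB := Moduli.ev_eq_of_connecting hs (h _ _ (hσ t)) (h' _ _ (hσ t'))
    have hA : (pre t').trans (σ t').symm = ((pre t).trans (σ t).symm).trans
        (((σ t).trans (Path.Homotopic.Quotient.mk (q.subpath t t'))).trans (σ t').symm) := by
      rw [← hpre t t', Path.Homotopic.Quotient.trans_assoc (pre t) (σ t).symm,
        ← Path.Homotopic.Quotient.trans_assoc (σ t).symm,
        ← Path.Homotopic.Quotient.trans_assoc (σ t).symm, Path.Homotopic.Quotient.symm_trans,
        Path.Homotopic.Quotient.refl_trans, Path.Homotopic.Quotient.trans_assoc]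
    simp only [D]
    rw [hA, y.ev_trans, y'.ev_trans, hB]
    group
  have h0 : D 0 = 1 := by
    have hp : pre 0 = constClass q.source.symm := by
      simp only [pre, constClass]
      rw [← Path.Homotopic.Quotient.mk_cast]
      congr 1
      ext t
      simp
    simp only [D]
    rw [hp, (hσ 0).ev_constClass (y := y) (y' := y') q.source.symm, mul_inv_cancel]
  have h1 : D 1 = 1 := (hD.apply_eq_of_preconnectedSpace 1 0).trans h0
  have hp : pre 1 = (Path.Homotopic.Quotient.mk q).trans (constClass q.target.symm) := by
    have key : ∀ {x x' : S} (h : x = x') (γ : Path (v : S) x),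
        (Path.Homotopic.Quotient.mk γ).trans (constClass h) =
          Path.Homotopic.Quotient.mk (γ.cast rfl h.symm) := by
      intro x x' h γ
      subst h
      exact Path.Homotopic.Quotient.trans_refl _
    rw [key]
    simp only [pre]
    rw [← Path.Homotopic.Quotient.mk_cast]
    congr 1
    ext t
    simp
  have hc := (hσ 1).ev_constClass (y := y) (y' := y') q.target.symm
  have h2 := mul_inv_eq_one.1 h1
  rw [hp, Path.Homotopic.Quotient.trans_assoc, y.ev_trans, y'.ev_trans, hc] at h2
  exact mul_right_cancel h2

theorem ev_eq_of_edgeClass [T2Space S] [Finite Edge] (h : DeformationRetractsOnto Γ.carrier)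
    (hy : ∀ e, y.ev (Γ.edgeClass e) = y'.ev (Γ.edgeClass e)) : y = y' := by
  obtain ⟨f, r, hf, ⟨F⟩, hrV, hr⟩ := Γ.exists_stretching h
  have hrA : ∀ x, r x ∈ Γ.carrier := by
    intro x
    by_cases hV : f x ∈ V
    · rw [hrV x hV]
      exact hf x
    · obtain ⟨e, s, hs, hx⟩ := Γ.exists_arc_of_mem_carrier (hf x) hV
      rw [hr x e s hx]
      exact Γ.arc_mem_carrier _ _
  refine Moduli.ext (funext fun v => funext fun w => funext fun γ => ?_)
  obtain ⟨p, rfl⟩ := Path.Homotopic.Quotient.mk_surjective γ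
  have hrid : ∀ v : V, (v : S) = r v := fun v => F.fst_eq_snd v.2
  let q : Path (v : S) (w : S) := (p.map r.continuous).cast (hrid v) (hrid w)
  have hqr : ∀ t, q t = r (p t) := fun t => rfl
  have hpq : Path.Homotopic.Quotient.mk p = Path.Homotopic.Quotient.mk q := by
    refine Path.Homotopic.Quotient.eq.2 ⟨?_⟩
    exact
      { toFun := fun a => F (a.1, p a.2)
        map_zero_left := fun t => F.apply_zero _
        map_one_left := fun t => F.apply_one _
        prop' := fun t s hs => by
          refine F.eq_fst t ?_
          obtain rfl | rfl := hs
          · simp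
          · simp }
  rw [hpq]
  refine Γ.ev_eq_of_eventually q (fun t => hrA _) fun t => ?_
  have hsmall : ∀ O : Set unitInterval, IsOpen O → t ∈ O →
      ∀ᶠ t' in 𝓝 t, ∀ u, Set.Icc.convexComb t t' u ∈ O := by
    intro O hO ht
    have h₁ : Filter.Tendsto (fun t' => Set.uIcc t t') (𝓝 t) (𝓝 t).smallSets :=
      tendsto_const_nhds.uIcc Filter.tendsto_id
    filter_upwards [h₁.eventually (Filter.eventually_smallSets_subset.2 (hO.mem_nhds ht))] with t' h u
    exact h (Path.range_subpathAux t t' ▸ Set.mem_range_self u)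
  -- A path may pass through a vertex into several edges infinitely often near t. Stretching removes
  -- this difficulty: near such a t the curve q is constant.
  by_cases hV : f (p t) ∈ V
  -- C consists of the closed middle halves of the edges. Outside C the curve is stretched into the
  -- finite discrete set V.
  · let C : Set S := ⋃ e, Γ.arc e '' ((↑) ⁻¹' Set.Icc (1 / 4 : ℝ) (3 / 4))
    have hC : IsClosed C := isClosed_iUnion_of_finite fun e =>
      ((isClosed_Icc.preimage continuous_subtype_val).isCompact.image
        (Γ.arc e).continuous).isClosed
    have hO : IsOpen ((fun s => f (p s)) ⁻¹' Cᶜ) :=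
      hC.isOpen_compl.preimage (f.continuous.comp p.continuous)
    have ht : t ∈ (fun s => f (p s)) ⁻¹' Cᶜ := by
      intro ht
      obtain ⟨e, s, hs, hs'⟩ := Set.mem_iUnion.1 ht
      have hs : (1 / 4 : ℝ) ≤ s ∧ (s : ℝ) ≤ 3 / 4 := hs
      refine Γ.arc_not_mem e s ⟨?_, ?_⟩ (by
        rw [hs']
        exact hV)
      · exact Subtype.coe_lt_coe.1 (by
          simp only [Set.Icc.coe_zero]
          linarith)
      · exact Subtype.coe_lt_coe.1 (by
          simp only [Set.Icc.coe_one]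
          linarith)
    have hOV : ∀ s ∈ (fun s => f (p s)) ⁻¹' Cᶜ, q s ∈ V := by
      intro s hs
      by_cases hV' : f (p s) ∈ V
      · rw [hqr, hrV _ hV']
        exact hV'
      · obtain ⟨e, a, -, ha⟩ := Γ.exists_arc_of_mem_carrier (hf (p s)) hV'
        have : (a : ℝ) ∉ Set.Icc (1 / 4 : ℝ) (3 / 4) := fun h =>
          hs (Set.mem_iUnion.2 ⟨e, a, h, ha.symm⟩)
        rw [hqr, hr _ e a ha]
        obtain h | h := stretch_one_eq this
        · simp [h]
        · simp [h]
    filter_upwards [hsmall _ hO ht] with t' ht'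
    let c : unitInterval → V := fun u => ⟨q.subpath t t' u, hOV _ (ht' u)⟩
    have hc : Continuous c := (q.subpath t t').continuous.subtype_mk _
    have hconst : ∀ u, q.subpath t t' u = q t := fun u =>
      (congrArg Subtype.val (PreconnectedSpace.constant inferInstance hc (x := u) (y := 0))).trans
        (q.subpath t t').source
    have htt : q t = q t' := (hconst 1).symm.trans (q.subpath t t').target
    refine ⟨⟨q t, hOV t ht⟩, constClass rfl, constClass htt, ?_, fun v' σ hσ => hσ.ev_constClass _,
      fun v' σ hσ => hσ.ev_constClass _⟩
    have hsub : q.subpath t t' = (Path.refl (q t)).cast rfl htt.symm := by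
      ext u
      exact hconst u
    rw [hsub]
    exact Path.Homotopic.Quotient.refl_trans _
  · obtain ⟨e, s, hs, hx⟩ := Γ.exists_arc_of_mem_carrier (hf (p t)) hV
    have hfp : Continuous fun s => f (p s) := f.continuous.comp p.continuous
    have hO := fun (W : Set unitInterval) hW hW' =>
      Γ.isOpen_preimage_arc (W := W) hfp (fun s => hf (p s)) e hW hW'
    filter_upwards [hsmall _ (hO _ isOpen_Ioo subset_rfl) ⟨s, hs, hx.symm⟩] with t' ht'
    -- Near t the curve f ∘ p stays in the interior of one edge. Its parameter θ is unique there,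
    -- and it is continuous because open pieces of the edge have open preimages.
    choose θ hθ hθ' using ht'
    have hθc : Continuous θ := by
      rw [continuous_iff_continuousAt]
      intro u
      rw [ContinuousAt, (nhds_basis_opens (θ u)).tendsto_right_iff]
      rintro W ⟨huW, hW⟩
      have hopen := (hO (W ∩ Set.Ioo 0 1) (hW.inter isOpen_Ioo) Set.inter_subset_right).preimage
        (Set.Icc.continuous_convexComb t t')
      filter_upwards [hopen.mem_nhds ⟨θ u, ⟨huW, hθ u⟩, hθ' u⟩] with u' ⟨a, ha, hau⟩
      rw [(Γ.arc_injective e e _ _ (hθ u') ((hθ' u').trans hau.symm)).2]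
      exact ha.1
    let η : Path (stretch 1 (θ 0)) (stretch 1 (θ 1)) :=
      { toFun := fun u => stretch 1 (θ u)
        continuous_toFun := continuous_stretch.comp (continuous_const.prodMk hθc)
        source' := rfl
        target' := rfl }
    have hη : ∀ u, q.subpath t t' u = Γ.arc e (η u) := fun u => hr _ e (θ u) (hθ' u).symm
    have h₀ : Γ.arc e (stretch 1 (θ 0)) = q t := (hη 0).symm.trans (q.subpath t t').source
    have h₁ : Γ.arc e (stretch 1 (θ 1)) = q t' := (hη 1).symm.trans (q.subpath t t').target
    exact ⟨Γ.src e, Γ.segment e _ h₀, Γ.segment e _ h₁, Γ.segment_trans h₀ h₁ _ η hη,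
      fun v' σ hσ => hσ.ev_segment hy h₀, fun v' σ hσ => hσ.ev_segment hy h₁⟩

end Agreement

end EmbeddedGraph

/-! ### The parametrization by edges and its equivariance. -/

namespace EmbeddedGraph

variable {S : Type*} [TopologicalSpace S] [T2Space S] {V : Finset S} {Edge : Type*} [Finite Edge]
  (Γ : EmbeddedGraph V Edge) (h : DeformationRetractsOnto Γ.carrier) (G : Type*) [Group G]

/-- Evaluation of representations of the fundamental groupoid on the edges of a skeleton. -/
def evalEdges (y : Moduli V G) (e : Edge) : G := y.ev (Γ.edgeClass e)

include h in
theorem bijective_evalEdges : Function.Bijective (Γ.evalEdges G) := by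
  refine ⟨fun y y' hy => Γ.ev_eq_of_edgeClass h (congrFun hy), fun g => ?_⟩
  obtain ⟨f, hf, ⟨F⟩⟩ := h
  obtain ⟨y, hy⟩ := Γ.exists_moduli f.continuous hf (fun x hx => (F.fst_eq_snd hx).symm) g
  exact ⟨y, funext hy⟩

/-- The representation of the fundamental groupoid with given values on the edges of a skeleton. -/
def moduliEquiv : (Edge → G) ≃ Moduli V G :=
  (Equiv.ofBijective (Γ.evalEdges G) (Γ.bijective_evalEdges h G)).symm

variable {G}

theorem moduliEquiv_ev (g : Edge → G) (e : Edge) :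
    (Γ.moduliEquiv h G g).ev (Γ.edgeClass e) = g e :=
  congrFun ((Equiv.ofBijective (Γ.evalEdges G) (Γ.bijective_evalEdges h G)).apply_symm_apply g) e

/-- By injectivity of evaluation it is enough to compare values on edges, where both sides are the
conjugation formula at the two ends. -/
theorem gauge_moduliEquiv (g : Edge → G) (k : V → G) :
    (Γ.moduliEquiv h G g).gauge k =
      Γ.moduliEquiv h G (halfEdgeAction g fun α => k (Γ.base α)) := by
  refine (Γ.bijective_evalEdges h G).1 (funext fun e => ?_)
  rw [evalEdges, evalEdges, moduliEquiv_ev]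
  change (k (Γ.src e))⁻¹ * (Γ.moduliEquiv h G g).ev (Γ.edgeClass e) * k (Γ.tgt e) = _
  rw [moduliEquiv_ev]
  rfl

end EmbeddedGraph

end FockRosly

end

open FockRosly in
theorem corollary4p4
    -- the connected complex Lie group `G`
    {E : Type*} [NormedAddCommGroup E] [NormedSpace ℂ E] [FiniteDimensional ℂ E] [CompleteSpace E]
    {G : Type*} [TopologicalSpace G] [ChartedSpace E G] [Group G] [LieGroup 𝓘(ℂ, E) ω G]
    [ConnectedSpace G]
    -- the marked surface `(S, V)`
    {S : Type*} [TopologicalSpace S] [T2Space S] [CompactSpace S] [ChartedSpace HalfPlane S]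
    [IsManifold halfPlaneModel ω S]
    (V : Finset S) (hV : V.Nonempty) (hV_boundary : (V : Set S) ⊆ halfPlaneModel.boundary S)
    -- the oriented skeleton `Γ`
    {Edge : Type*} [Fintype Edge] (Γ : OrientedSkeleton V Edge)
    -- the quasitriangular `r`-matrices `r v`, with common symmetric part `s`
    (s : LieAlg E G ⊗[ℂ] LieAlg E G)
    (r : V → LieAlg E G ⊗[ℂ] LieAlg E G)
    (hr : ∀ v, IsQuasitriangular (r v)) (hs : ∀ v, symPart (r v) = s) :
    ∃ I_Γ : (Edge → G) ≃ Moduli V G,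
      (∀ g e, (I_Γ g).ev (Γ.edgeClass e) = g e) ∧
      IsRightPoissonSpace (Y := Transport I_Γ) (powModel E Edge) (directSum r)
        (transportTensor (powModel E Edge) I_Γ (skeletonBivector Γ r)) (gaugeAction I_Γ) := by
  exact ⟨Γ.moduliEquiv Γ.retract G, Γ.moduliEquiv_ev Γ.retract,
    isRightPoissonSpace_moduli Γ hr hs _ (Γ.gauge_moduliEquiv Γ.retract)⟩
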